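/- \textbf{Setting.} ZX-calculus diagrams with $n$ inputs and $m$ outputs are built by parallel and sequential composition from wires (including crossings, cups and caps), green and red spiders with any numbers of inputs and outputs and a phase $\alpha\in\mathbb{R}/2\pi\mathbb{Z}$, Hadamard nodes $H$ with one input and one output, and star nodes $\star$ without legs. The standard interpretation $[\![D]\!]$ is the $2^m\times 2^n$ complex matrix for which parallel composition is the Kronecker product, sequential composition is the matrix product, wires, crossings, cups and caps have their usual meaning (identity, swap, $|00\rangle+|11\rangle$, $\langle00|+\langle11|$), $H=|+\rangle\langle0|+|-\rangle\langle1|$, $\star=\tfrac12$, and a spider $n\to m$ of phase $\alpha$ is $|0\rangle^{\otimes m}\langle0|^{\otimes n}+e^{i\alpha}|1\rangle^{\otimes m}\langle1|^{\otimes n}$ (green) or $|+\rangle^{\otimes m}\langle+|^{\otimes n}+e^{i\alpha}|-\rangle^{\otimes m}\langle-|^{\otimes n}$ (red). A diagram is a \emph{stabilizer diagram} if all its phases are integer multiples of $\pi/2$, and a \emph{zero diagram} if $[\![D]\!]=0$. Two diagrams are \emph{topologically equal} if they agree up to graph isomorphism fixing the order of inputs and outputs (inputs and outputs of spiders, and the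 two ends of a Hadamard node, are not distinguished). Write $\langle\alpha,\beta\rangle$ for the scalar diagram consisting of a red state of phase $\beta$ connected to a green effect of phase $\alpha$, and let unlabelled nodes have phase $0$. Two diagrams are \emph{equal in the stabilizer ZX-calculus} if one can be rewritten into the other by topological equality and by replacing subdiagrams, in either direction, according to instances with phases in $\tfrac{\pi}{2}\mathbb{Z}$ of the following rules, each of which may also be used with the colours exchanged and upside-down: \begin{itemize} \item spider: green spiders of phases $\alpha,\beta$ joined by a wire merge into one of phase $\alpha+\beta$; \item loop: a self-loop on a green spider may be removed; \item cup: a green spider with two outputs and no inputs equals a cup; \item bialgebra: $\langle0,0\rangle$ beside two green spiders $1\to2$ connected (with one crossing) to two red spiders $2\to1$ equals a red spider $2\to1$ followed by a green spider $1\to2$; \item copy: $\langle0,0\rangle$ beside a red state followed by a green spider $1\to2$ equals two red states; \item $\pi$-copy: a green $\pi$ phase shift followed by a red spider $1\to m$ equals that red spider followed by a green $\pi$ phase shift on every output; \item $\pi$-commutation: $\langle0,0\rangle$ beside a green phase shift $\alpha$ followed by a red phase shift $\pi$ equals $\langle\alpha,\pi\rangle$ beside a red phase shift $\pi$ followed by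 a green phase shift $-\alpha$; \item colour change: a green spider with a Hadamard node on every leg equals the red spider of the same phase; \item Euler decomposition: two copies of $\langle0,0\rangle$ beside a Hadamard node equal $\langle-\tfrac\pi2,-\tfrac\pi2\rangle$ beside the sequence of a green, a red and a green phase shift, each of phase $\tfrac\pi2$; \item star: $\star$ beside a legless green node of phase $0$ equals the empty diagram; \item zero: a legless green node of phase $\pi$ beside a wire equals the same node beside a green effect and, disconnected from it, a red state; \item zero scalar: legless green nodes of phases $\pi$ and $\alpha$ side by side equal a legless green node of phase $\pi$. \end{itemize} For colours $c,d$, a diagram is a \emph{zero normal form} (with colours $c,d$) if it is a disconnected juxtaposition of one phase-$0$ node of colour $c$ on each input, one phase-$0$ node of colour $d$ on each output, and exactly one legless green node of phase $\pi$. \textbf{Theorem.} Let $D$ be a stabilizer diagram with $n$ inputs and $m$ outputs and $[\![D]\!]=0$, and let $c,d$ be any colours. Then $D$ can be rewritten in the stabilizer ZX-calculus into a zero normal form $N$ with colours $c,d$, $n$ inputs and $m$ outputs, and this normal form is unique: every zero normal form with these colours, $n$ inputs and $m$ outputs is topologically equal to $N$. Hence the stabilizer ZX-calculus is complete for zero diagrams: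 if $D_1,D_2$ are stabilizer diagrams with the same numbers of inputs and outputs and $[\![D_1]\!]=0=[\![D_2]\!]$, then $D_1$ and $D_2$ are equal in the stabilizer ZX-calculus. -/

import Mathlib

noncomputable section

namespace ZX

/-- The two colours of spiders. -/
inductive Colour where
  | green : Colour
  | red : Colour

/-- Exchange of the two colours. -/
def Colour.other : Colour → Colour
  | .green => .red
  | .red => .green

/-- Terms for ZX-calculus diagrams with `n` inputs and `m` outputs. Phases are angles modulo `2π`.
`wires n` is `n` parallel wires (`wires 0` is the empty diagram), `swap n m` is the crossing of a
bundle of `n` wires with a bundle of `m` wires, `cup` has two outputs and `cap` has two inputs.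
`seq D E` connects the outputs of `D` to the inputs of `E`, and `par D E` is `D` to the left
of `E`. Diagrams proper are such terms up to the relation `TopEq` below. -/
inductive Diag : ℕ → ℕ → Type where
  | wires (n : ℕ) : Diag n n
  | swap (n m : ℕ) : Diag (n + m) (m + n)
  | cup : Diag 0 2
  | cap : Diag 2 0
  | spider (c : Colour) (n m : ℕ) (α : Real.Angle) : Diag n m
  | had : Diag 1 1
  | star : Diag 0 0
  | seq {n m k : ℕ} (D : Diag n m) (E : Diag m k) : Diag n k
  | par {n m n' m' : ℕ} (D : Diag n m) (E : Diag n' m') : Diag (n + n') (m + m')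

namespace Diag

/-! ### The standard interpretation -/

/-- Entry `j` of the `i`-th vector of the orthonormal basis belonging to a colour:
`|0⟩, |1⟩` for green and `|+⟩, |-⟩` for red. -/
def basisVec : Colour → Fin 2 → Fin 2 → ℂ
  | .green, i, j => if i = j then 1 else 0
  | .red, i, j => (-1) ^ ((i : ℕ) * (j : ℕ)) / (Real.sqrt 2 : ℂ)

/-- The entry at the bit string `x` of the `n`-fold tensor power of a qubit vector `v`. -/
def tensorPow (v : Fin 2 → ℂ) {n : ℕ} (x : Fin n → Fin 2) : ℂ := ∏ i, v (x i)

/-- The interpretation as a `2^m` by `2^n` matrix, with rows and columns indexed by bit strings.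
All basis vectors used are real, so the entries of a bra are those of the corresponding ket. -/
def interp : {n m : ℕ} → Diag n m → Matrix (Fin m → Fin 2) (Fin n → Fin 2) ℂ
  | _, _, wires _ => 1
  | _, _, swap n m => fun y x =>
      if (∀ i : Fin n, y (Fin.natAdd m i) = x (Fin.castAdd m i)) ∧
         (∀ j : Fin m, y (Fin.castAdd n j) = x (Fin.natAdd n j)) then 1 else 0
  | _, _, cup => fun y _ => if y 0 = y 1 then 1 else 0
  | _, _, cap => fun _ x => if x 0 = x 1 then 1 else 0
  | _, _, spider c _ _ α => fun y x =>
      tensorPow (basisVec c 0) y * tensorPow (basisVec c 0) x +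
        (Real.Angle.toCircle α : ℂ) * (tensorPow (basisVec c 1) y * tensorPow (basisVec c 1) x)
  | _, _, had => fun y x => basisVec .red (x 0) (y 0)
  | _, _, star => fun _ _ => 1 / 2
  | _, _, seq D E => interp E * interp D
  | _, _, @par n m n' m' D E => fun y x =>
      interp D (fun i => y (Fin.castAdd m' i)) (fun i => x (Fin.castAdd n' i)) *
        interp E (fun i => y (Fin.natAdd m i)) (fun i => x (Fin.natAdd n i))

/-! ### Stabilizer diagrams and operations on diagrams -/

/-- All phases are integer multiples of `π/2`. -/
def IsStabilizer : {n m : ℕ} → Diag n m → Prop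
  | _, _, spider _ _ _ α => ∃ k : ℤ, α = k • ((Real.pi / 2 : ℝ) : Real.Angle)
  | _, _, seq D E => IsStabilizer D ∧ IsStabilizer E
  | _, _, par D E => IsStabilizer D ∧ IsStabilizer E
  | _, _, _ => True

/-- The diagram with the colours red and green exchanged. -/
def recolour : {n m : ℕ} → Diag n m → Diag n m
  | _, _, wires n => wires n
  | _, _, swap n m => swap n m
  | _, _, cup => cup
  | _, _, cap => cap
  | _, _, spider c n m α => spider c.other n m α
  | _, _, had => had
  | _, _, star => star
  | _, _, seq D E => seq (recolour D) (recolour E)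
  | _, _, par D E => par (recolour D) (recolour E)

/-- The diagram turned upside-down (the phases are kept). -/
def flip : {n m : ℕ} → Diag n m → Diag m n
  | _, _, wires n => wires n
  | _, _, swap n m => swap m n
  | _, _, cup => cap
  | _, _, cap => cup
  | _, _, spider c n m α => spider c m n α
  | _, _, had => had
  | _, _, star => star
  | _, _, seq D E => seq (flip E) (flip D)
  | _, _, par D E => par (flip D) (flip E)

/-- `n` copies side by side of a diagram with one input and one output. -/
def copies (D : Diag 1 1) : (n : ℕ) → Diag n n
  | 0 => wires 0
  | n + 1 => par (copies D n) D

/-- Rewriting the number of inputs along an equality of natural numbers. -/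
def retype {n n' m : ℕ} (h : n = n') (D : Diag n m) : Diag n' m := h ▸ D

/-- A green spider. -/
abbrev gn (n m : ℕ) (α : Real.Angle) : Diag n m := spider .green n m α

/-- A red spider. -/
abbrev rn (n m : ℕ) (α : Real.Angle) : Diag n m := spider .red n m α

/-- The phase `π`. -/
abbrev pie : Real.Angle := ((Real.pi : ℝ) : Real.Angle)

/-- The phase `π/2`. -/
abbrev halfPi : Real.Angle := ((Real.pi / 2 : ℝ) : Real.Angle)

/-- The scalar diagram in which a red state of phase `β` meets a green effect of phase `α`. -/
abbrev inner (α β : Real.Angle) : Diag 0 0 := seq (rn 0 1 β) (gn 1 0 α)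

end Diag

open Diag

/-- The congruence (with respect to `seq` and `par`) generated by a relation between diagrams. The
two sides are not required to have definitionally equal numbers of inputs and outputs, so that
strict associativity and unit laws can be written without transports. -/
inductive Cong (R : ∀ {n m n' m' : ℕ}, Diag n m → Diag n' m' → Prop) :
    ∀ {n m n' m' : ℕ}, Diag n m → Diag n' m' → Prop where
  | of {n m n' m' : ℕ} {D : Diag n m} {E : Diag n' m'} : R D E → Cong R D E
  | refl {n m : ℕ} (D : Diag n m) : Cong R D D
  | symm {n m n' m' : ℕ} {D : Diag n m} {E : Diag n' m'} : Cong R D E → Cong R E D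
  | trans {n m n' m' n'' m'' : ℕ} {D : Diag n m} {E : Diag n' m'} {F : Diag n'' m''} :
      Cong R D E → Cong R E F → Cong R D F
  | seq {n m k n' m' k' : ℕ} {D : Diag n m} {E : Diag m k} {D' : Diag n' m'} {E' : Diag m' k'} :
      Cong R D D' → Cong R E E' → Cong R (Diag.seq D E) (Diag.seq D' E')
  | par {n m k l n' m' k' l' : ℕ} {D : Diag n m} {E : Diag k l} {D' : Diag n' m'}
      {E' : Diag k' l'} :
      Cong R D D' → Cong R E E' → Cong R (Diag.par D E) (Diag.par D' E')

/-- Generating equalities for "only the topology matters": the axioms of a strict symmetric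
monoidal category with a self-dual compact structure, and the fact that the legs of a spider, and
the two ends of a Hadamard node, need not be distinguished. -/
inductive TopAx : ∀ {n m n' m' : ℕ}, Diag n m → Diag n' m' → Prop where
  -- category
  | seq_assoc {n m k l : ℕ} (D : Diag n m) (E : Diag m k) (F : Diag k l) :
      TopAx (seq (seq D E) F) (seq D (seq E F))
  | wires_seq {n m : ℕ} (D : Diag n m) : TopAx (seq (wires n) D) D
  | seq_wires {n m : ℕ} (D : Diag n m) : TopAx (seq D (wires m)) D
  -- strict monoidal structure
  | par_assoc {n m n' m' n'' m'' : ℕ} (D : Diag n m) (E : Diag n' m') (F : Diag n'' m'') :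
      TopAx (par (par D E) F) (par D (par E F))
  | empty_par {n m : ℕ} (D : Diag n m) : TopAx (par (wires 0) D) D
  | par_empty {n m : ℕ} (D : Diag n m) : TopAx (par D (wires 0)) D
  | wires_par (n m : ℕ) : TopAx (par (wires n) (wires m)) (wires (n + m))
  | interchange {n m k n' m' k' : ℕ} (D : Diag n m) (E : Diag m k) (D' : Diag n' m')
      (E' : Diag m' k') : TopAx (par (seq D E) (seq D' E')) (seq (par D D') (par E E'))
  -- symmetry
  | swap_swap (n m : ℕ) : TopAx (seq (swap n m) (swap m n)) (wires (n + m))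
  | swap_natural {n m n' m' : ℕ} (D : Diag n m) (E : Diag n' m') :
      TopAx (seq (par D E) (swap m m')) (seq (swap n n') (par E D))
  | swap_empty (n : ℕ) : TopAx (swap n 0) (wires n)
  | swap_add (n m k : ℕ) :
      TopAx (seq (par (swap n m) (wires k))
          (retype (Nat.add_assoc m n k).symm (par (wires m) (swap n k))))
        (swap n (m + k))
  -- compact structure
  | snake_left : TopAx (seq (par (wires 1) cup) (par (n := 2) (n' := 1) cap (wires 1))) (wires 1)
  | snake_right : TopAx (seq (par cup (wires 1)) (par (n := 1) (n' := 2) (wires 1) cap)) (wires 1)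
  | cup_swap : TopAx (seq cup (swap 1 1)) cup
  | swap_cap : TopAx (seq (swap 1 1) cap) cap
  -- legs of spiders
  | swap_outputs (c : Colour) (n a b : ℕ) (α : Real.Angle) :
      TopAx (seq (spider c n (a + (1 + 1) + b) α) (par (par (wires a) (swap 1 1)) (wires b)))
        (spider c n (a + (1 + 1) + b) α)
  | swap_inputs (c : Colour) (a b m : ℕ) (α : Real.Angle) :
      TopAx (seq (par (par (wires a) (swap 1 1)) (wires b)) (spider c (a + (1 + 1) + b) m α))
        (spider c (a + (1 + 1) + b) m α)
  | bend_input (c : Colour) (n m : ℕ) (α : Real.Angle) :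
      TopAx (seq (par (wires n) cup) (par (n := n + 1) (n' := 1) (spider c (n + 1) m α) (wires 1)))
        (spider c n (m + 1) α)
  | bend_output (c : Colour) (n m : ℕ) (α : Real.Angle) :
      TopAx (seq (par (spider c n (m + 1) α) (wires 1)) (par (n := m) (n' := 2) (wires m) cap))
        (spider c (n + 1) m α)
  -- ends of Hadamard nodes
  | had_cup : TopAx (seq cup (par had (wires 1))) (seq cup (par (wires 1) had))
  | had_cap : TopAx (seq (par had (wires 1)) cap) (seq (par (wires 1) had) cap)

/-- Equality of diagrams up to topology (graph isomorphism). -/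
def TopEq {n m n' m' : ℕ} (D : Diag n m) (E : Diag n' m') : Prop := Cong TopAx D E

/-- The rewrite rules of the ZX-calculus. -/
inductive Rule : ∀ {n m n' m' : ℕ}, Diag n m → Diag n' m' → Prop where
  | spider (n m k l : ℕ) (α β : Real.Angle) :
      Rule (seq (par (gn n (m + 1) α) (wires k))
          (retype (Nat.add_assoc m 1 k).symm (par (wires m) (gn (1 + k) l β))))
        (gn (n + k) (m + l) (α + β))
  | loop (n m : ℕ) (α : Real.Angle) :
      Rule (seq (gn n (m + 2) α) (par (wires m) cap)) (gn n m α)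
  | cup : Rule (gn 0 2 0) cup
  | bialgebra :
      Rule (par (inner 0 0)
          (seq (seq (par (gn 1 2 0) (gn 1 2 0))
              (par (n := 1 + (1 + 1)) (n' := 1) (par (wires 1) (swap 1 1)) (wires 1)))
            (par (n := 2) (n' := 2) (rn 2 1 0) (rn 2 1 0))))
        (seq (rn 2 1 0) (gn 1 2 0))
  | copy :
      Rule (par (inner 0 0) (seq (rn 0 1 0) (gn 1 2 0))) (par (rn 0 1 0) (rn 0 1 0))
  | pi_copy (m : ℕ) :
      Rule (seq (gn 1 1 pie) (rn 1 m 0)) (seq (rn 1 m 0) (copies (gn 1 1 pie) m))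
  | pi_commutation (α : Real.Angle) :
      Rule (par (inner 0 0) (seq (gn 1 1 α) (rn 1 1 pie)))
        (par (inner α pie) (seq (rn 1 1 pie) (gn 1 1 (-α))))
  | colour_change (n m : ℕ) (α : Real.Angle) :
      Rule (seq (seq (copies had n) (gn n m α)) (copies had m)) (rn n m α)
  | euler :
      Rule (par (par (inner 0 0) (inner 0 0)) had)
        (par (inner (-halfPi) (-halfPi))
          (seq (seq (gn 1 1 halfPi) (rn 1 1 halfPi)) (gn 1 1 halfPi)))
  | star : Rule (par star (gn 0 0 0)) (wires 0)
  | zero :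
      Rule (par (gn 0 0 pie) (wires 1)) (par (gn 0 0 pie) (seq (gn 1 0 0) (rn 0 1 0)))
  | zero_scalar (α : Real.Angle) : Rule (par (gn 0 0 pie) (gn 0 0 α)) (gn 0 0 pie)
  -- any rule also holds with the colours exchanged, and upside-down
  | recolour {n m n' m' : ℕ} {D : Diag n m} {E : Diag n' m'} :
      Rule D E → Rule D.recolour E.recolour
  | flip {n m n' m' : ℕ} {D : Diag n m} {E : Diag n' m'} : Rule D E → Rule D.flip E.flip

/-- Equality in the stabilizer ZX-calculus: derivability by the topology rule and those instances of
the rewrite rules in which all phases are integer multiples of `π/2`. A derivation that starts at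
a stabilizer diagram therefore passes through stabilizer diagrams only. -/
def StabEq {n m n' m' : ℕ} (D : Diag n m) (E : Diag n' m') : Prop :=
  Cong (fun L R => TopAx L R ∨ (Rule L R ∧ L.IsStabilizer ∧ R.IsStabilizer)) D E

/-- `Pieces cin cout s D`: the diagram `D` is a juxtaposition, in any order, of one-legged phase-0
spiders of colour `cin` on the inputs, one-legged phase-0 spiders of colour `cout` on the outputs,
and exactly `s` legless green spiders of phase `π`. -/
inductive Pieces (cin cout : Colour) : ℕ → ∀ {n m : ℕ}, Diag n m → Prop where
  | empty : Pieces cin cout 0 (wires 0)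
  | onInput : Pieces cin cout 0 (spider cin 1 0 0)
  | onOutput : Pieces cin cout 0 (spider cout 0 1 0)
  | piScalar : Pieces cin cout 1 (gn 0 0 pie)
  | par {s t n m n' m' : ℕ} {D : Diag n m} {E : Diag n' m'} :
      Pieces cin cout s D → Pieces cin cout t E → Pieces cin cout (s + t) (Diag.par D E)

/-- Zero normal forms: disconnected nodes on the wires and one `π`-scalar. -/
def IsZeroNF (cin cout : Colour) {n m : ℕ} (D : Diag n m) : Prop := Pieces cin cout 1 D

end ZX

end

/-! Stabilizer diagrams are composed of Clifford gates, preparations of |0⟩ and projections onto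
⟨0|. A state built in this way is either zero or determined up to scalars by a maximal commuting set
of Pauli strings stabilising it. The proof runs this stabilizer formalism inside the calculus: every
state is either certified to be a nonzero stabilizer state (`Good`) or satisfies the derived
equation `zro ⊠ φ = φ` (`Zero`). Since a `Good` state has a nonzero interpretation, a state with
interpretation 0 must absorb the zero scalar.

Most of this takes place in `modThy`, where provably invertible scalars are identified with the
empty diagram. Signs disappear there too, although they decide whether a projection gives zero.
Pauli strings are therefore used in controlled form (`cp`): a sign becomes a phase on the control
wire, which is not a scalar. `SlideBy k D p q` says that `D` carries the controlled string `p` to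
`q` at the cost of the phase `k`. The inputs to this are the Pauli relations (`conv_act`), the
slides of the generators and `Slide.mul`, by which a slide is determined by generators of the Pauli
group.

Clifford gates preserve the dichotomy `Dich` because conjugation is symplectic. The essential case
is `decides_effect`. If Z on the measured qubit is a stabiliser, its sign singles out one outcome as
provably zero (`zero_of_phase`). Otherwise some stabiliser anticommutes with that Z and relates the
two outcomes by Pauli operators. Nonvanishing after a projection is semantic, so it relies on
soundness (`modThy_sim`).

Inputs are bent to outputs to reduce diagrams to states (`zero_of_interp`). The equation then
returns to the stabilizer calculus, because an equation modulo invertible scalars holds exactly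
after multiplication by one such scalar, which idempotence of the zero scalar eliminates
(`exists_isInv`, `zro_tens_of_zero`). Finally, beside a zero scalar every wire can be cut, so every
stabilizer diagram falls apart into a normal form (`zro_tens_mk`). Uniqueness is purely monoidal:
states, effects and scalars commute under juxtaposition (`mk_of_pieces`).

Equations are derived in quotients `Q T` of diagrams, in which ill-typed composites are formal
elements; the arities of elements are thus ordinary numbers and no transports occur. -/

noncomputable section

namespace ZX

open Diag

/-! ### Diagrams modulo a theory -/

/-- Relations between diagrams of possibly different arities. -/
abbrev DRel := ∀ {n m n' m' : ℕ}, Diag n m → Diag n' m' → Prop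

/-- A set of equations between diagrams of equal arities, containing the topological ones. -/
structure Theory where
  rel : DRel
  top_le : ∀ {n m n' m' : ℕ} {D : Diag n m} {E : Diag n' m'}, TopAx D E → rel D E
  arity : ∀ {n m n' m' : ℕ} {D : Diag n m} {E : Diag n' m'}, rel D E → n = n' ∧ m = m'

theorem TopAx.arity {n m n' m' : ℕ} {D : Diag n m} {E : Diag n' m'} (h : TopAx D E) :
    n = n' ∧ m = m' := by
  cases h <;> constructor <;> omega

theorem Rule.arity {n m n' m' : ℕ} {D : Diag n m} {E : Diag n' m'} (h : Rule D E) :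
    n = n' ∧ m = m' := by
  induction h with
  | recolour _ ih => exact ih
  | flip _ ih => exact ih.symm
  | _ => constructor <;> omega

theorem Cong.arity (T : Theory) {n m n' m' : ℕ} {D : Diag n m} {E : Diag n' m'}
    (h : Cong T.rel D E) : n = n' ∧ m = m' := by
  induction h with
  | of h => exact T.arity h
  | refl => exact ⟨rfl, rfl⟩
  | symm _ ih => exact ⟨ih.1.symm, ih.2.symm⟩
  | trans _ _ ih ih' => exact ⟨ih.1.trans ih'.1, ih.2.trans ih'.2⟩
  | seq _ _ ih ih' => exact ⟨ih.1, ih'.2⟩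
  | par _ _ ih ih' => exact ⟨by rw [ih.1, ih'.1], by rw [ih.2, ih'.2]⟩

/-- Diagrams together with formal results of ill-typed compositions. -/
inductive Raw where
  | ok {n m : ℕ} (D : Diag n m) : Raw
  | junk (n m : ℕ) : Raw

namespace Raw

def dom : Raw → ℕ
  | @ok n _ _ => n
  | junk n _ => n

def cod : Raw → ℕ
  | @ok _ m _ => m
  | junk _ m => m

/-- Formal elements are identified only by their arities and never with a diagram, so that the
number of inputs and outputs descends to the quotient and diagrams keep their meaning. -/
def Rel (T : Theory) : Raw → Raw → Prop
  | ok D, ok E => Cong T.rel D E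
  | junk n m, junk n' m' => n = n' ∧ m = m'
  | _, _ => False

/-- An ill-typed composite remembers only its outer arities. This is what makes associativity hold
without typing hypotheses. -/
def comp : Raw → Raw → Raw
  | @ok n m D, @ok m' k E => if h : m = m' then ok (seq D (h ▸ E)) else junk n k
  | a, b => junk a.dom b.cod

def tens : Raw → Raw → Raw
  | ok D, ok E => ok (par D E)
  | a, b => junk (a.dom + b.dom) (a.cod + b.cod)

theorem Rel.dom {T : Theory} {a b : Raw} (h : Rel T a b) : a.dom = b.dom := by
  cases a <;> cases b <;> first | exact (Cong.arity T h).1 | exact h.1 | exact False.elim h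

theorem Rel.cod {T : Theory} {a b : Raw} (h : Rel T a b) : a.cod = b.cod := by
  cases a <;> cases b <;> first | exact (Cong.arity T h).2 | exact h.2 | exact False.elim h

def setoid (T : Theory) : Setoid Raw where
  r := Rel T
  iseqv :=
    { refl := by
        rintro (_ | _)
        · exact Cong.refl _
        · exact ⟨rfl, rfl⟩
      symm := by
        rintro (_ | _) (_ | _) h
        · exact Cong.symm h
        · exact False.elim h
        · exact False.elim h
        · exact ⟨h.1.symm, h.2.symm⟩
      trans := by
        rintro (_ | _) (_ | _) (_ | _) h h'
        all_goals first | exact False.elim h | exact False.elim h' | skip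
        · exact Cong.trans h h'
        · exact ⟨h.1.trans h'.1, h.2.trans h'.2⟩ }

/-- Related diagrams have equal arities, so whether a composite is well typed does not depend on the
representatives. -/
theorem comp_rel {T : Theory} {a b a' b' : Raw} (ha : Rel T a a') (hb : Rel T b b') :
    Rel T (comp a b) (comp a' b') := by
  rcases a with @⟨n, m, D⟩ | ⟨n, m⟩ <;> rcases a' with @⟨n', m', D'⟩ | ⟨n', m'⟩ <;>
  rcases b with @⟨k, l, E⟩ | ⟨k, l⟩ <;> rcases b' with @⟨k', l', E'⟩ | ⟨k', l'⟩
  all_goals first | exact False.elim ha | exact False.elim hb | skip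
  · obtain ⟨rfl, rfl⟩ := Cong.arity T ha
    obtain ⟨rfl, rfl⟩ := Cong.arity T hb
    by_cases h : m = k
    · subst h
      simp only [comp, dite_true]
      exact Cong.seq ha hb
    · simp only [comp, h, dite_false]
      exact ⟨rfl, rfl⟩
  all_goals exact ⟨Rel.dom ha, Rel.cod hb⟩

theorem tens_rel {T : Theory} {a b a' b' : Raw} (ha : Rel T a a') (hb : Rel T b b') :
    Rel T (tens a b) (tens a' b') := by
  rcases a with @⟨n, m, D⟩ | ⟨n, m⟩ <;> rcases a' with @⟨n', m', D'⟩ | ⟨n', m'⟩ <;>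
  rcases b with @⟨k, l, E⟩ | ⟨k, l⟩ <;> rcases b' with @⟨k', l', E'⟩ | ⟨k', l'⟩
  all_goals first | exact False.elim ha | exact False.elim hb | skip
  · exact Cong.par ha hb
  all_goals
    exact ⟨congrArg₂ (· + ·) (Rel.dom ha) (Rel.dom hb), congrArg₂ (· + ·) (Rel.cod ha) (Rel.cod hb)⟩

end Raw

/-- Diagrams modulo a theory, with formal results of ill-typed compositions. -/
def Q (T : Theory) : Type := Quotient (Raw.setoid T)

namespace Q

variable {T : Theory}

/-- The class of a diagram. -/
def mk (T : Theory) {n m : ℕ} (D : Diag n m) : Q T := Quotient.mk _ (.ok D)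

/-- The ill-typed element of given arities. -/
def junk (T : Theory) (n m : ℕ) : Q T := Quotient.mk _ (.junk n m)

def dom (a : Q T) : ℕ := Quotient.lift Raw.dom (fun _ _ h => Raw.Rel.dom h) a

def cod (a : Q T) : ℕ := Quotient.lift Raw.cod (fun _ _ h => Raw.Rel.cod h) a

def comp (a b : Q T) : Q T :=
  Quotient.map₂ Raw.comp (fun _ _ h _ _ h' => Raw.comp_rel h h') a b

def tens (a b : Q T) : Q T :=
  Quotient.map₂ Raw.tens (fun _ _ h _ _ h' => Raw.tens_rel h h') a b

end Q

infixr:70 " ⨾ " => Q.comp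
infixr:80 " ⊠ " => Q.tens

namespace Q

variable {T : Theory}

/-- Parallel wires. -/
def id (n : ℕ) : Q T := mk T (wires n)

def sw (n m : ℕ) : Q T := mk T (swap n m)

theorem mk_eq_iff {n m n' m' : ℕ} {D : Diag n m} {E : Diag n' m'} :
    mk T D = mk T E ↔ Cong T.rel D E :=
  ⟨fun h => Quotient.exact h, fun h => Quotient.sound h⟩

@[elab_as_elim]
theorem ind {p : Q T → Prop} (hok : ∀ {n m : ℕ} (D : Diag n m), p (mk T D))
    (hjunk : ∀ n m, p (junk T n m)) (a : Q T) : p a := by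
  induction a using Quotient.inductionOn with
  | h a => cases a with
    | ok D => exact hok D
    | junk n m => exact hjunk n m

@[simp] theorem dom_mk {n m : ℕ} (D : Diag n m) : (mk T D).dom = n := (rfl)
@[simp] theorem cod_mk {n m : ℕ} (D : Diag n m) : (mk T D).cod = m := (rfl)
@[simp] theorem dom_junk (n m : ℕ) : (junk T n m).dom = n := (rfl)
@[simp] theorem cod_junk (n m : ℕ) : (junk T n m).cod = m := (rfl)
@[simp] theorem dom_id (n : ℕ) : (id n : Q T).dom = n := (rfl)
@[simp] theorem cod_id (n : ℕ) : (id n : Q T).cod = n := (rfl)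
@[simp] theorem dom_sw (n m : ℕ) : (sw n m : Q T).dom = n + m := (rfl)
@[simp] theorem cod_sw (n m : ℕ) : (sw n m : Q T).cod = m + n := (rfl)

theorem mk_seq {n m k : ℕ} (D : Diag n m) (E : Diag m k) :
    mk T (seq D E) = mk T D ⨾ mk T E := by
  have h : Raw.comp (.ok D) (.ok E) = .ok (seq D E) := by simp [Raw.comp]
  exact congrArg (Quotient.mk _) h.symm

theorem mk_par {n m k l : ℕ} (D : Diag n m) (E : Diag k l) :
    mk T (par D E) = mk T D ⊠ mk T E := rfl

theorem comp_mismatch {n m m' k : ℕ} (D : Diag n m) (E : Diag m' k) (h : m ≠ m') :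
    mk T D ⨾ mk T E = junk T n k := by
  have h : Raw.comp (.ok D) (.ok E) = .junk n k := by simp [Raw.comp, h]
  exact congrArg (Quotient.mk _) h

@[simp] theorem junk_comp (n m : ℕ) (a : Q T) : junk T n m ⨾ a = junk T n a.cod := by
  refine ind (fun D => ?_) (fun n m => ?_) a <;> rfl

@[simp] theorem comp_junk (n m : ℕ) (a : Q T) : a ⨾ junk T n m = junk T a.dom m := by
  refine ind (fun D => ?_) (fun n m => ?_) a <;> rfl

@[simp] theorem junk_tens (n m : ℕ) (a : Q T) :
    junk T n m ⊠ a = junk T (n + a.dom) (m + a.cod) := by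
  refine ind (fun D => ?_) (fun n m => ?_) a <;> rfl

@[simp] theorem tens_junk (n m : ℕ) (a : Q T) :
    a ⊠ junk T n m = junk T (a.dom + n) (a.cod + m) := by
  refine ind (fun D => ?_) (fun n m => ?_) a <;> rfl

@[simp] theorem dom_comp (a b : Q T) : (a ⨾ b).dom = a.dom := by
  refine ind (fun {n m} D => ?_) (fun n m => ?_) a
  · refine ind (fun {n' m'} E => ?_) (fun n m => ?_) b
    · by_cases h : m = n'
      · subst h; rw [← mk_seq]; rfl
      · rw [comp_mismatch _ _ h]; rfl
    · simp
  · simp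

@[simp] theorem cod_comp (a b : Q T) : (a ⨾ b).cod = b.cod := by
  refine ind (fun {n m} D => ?_) (fun n m => ?_) a
  · refine ind (fun {n' m'} E => ?_) (fun n m => ?_) b
    · by_cases h : m = n'
      · subst h; rw [← mk_seq]; rfl
      · rw [comp_mismatch _ _ h]; rfl
    · simp
  · simp

@[simp] theorem dom_tens (a b : Q T) : (a ⊠ b).dom = a.dom + b.dom := by
  refine ind (fun {n m} D => ?_) (fun n m => ?_) a
  · refine ind (fun {n' m'} E => rfl) (fun n m => ?_) b
    simp
  · simp

@[simp] theorem cod_tens (a b : Q T) : (a ⊠ b).cod = a.cod + b.cod := by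
  refine ind (fun {n m} D => ?_) (fun n m => ?_) a
  · refine ind (fun {n' m'} E => rfl) (fun n m => ?_) b
    simp
  · simp

theorem of_top {n m n' m' : ℕ} {D : Diag n m} {E : Diag n' m'} (h : TopAx D E) :
    mk T D = mk T E := mk_eq_iff.2 (.of (T.top_le h))

theorem comp_assoc (a b c : Q T) : (a ⨾ b) ⨾ c = a ⨾ b ⨾ c := by
  refine ind (fun {n m} D => ?_) (fun n m => by simp) a
  refine ind (fun {n' m'} E => ?_) (fun n m => by simp) b
  refine ind (fun {n'' m''} F => ?_) (fun n m => by simp) c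
  by_cases h : m = n'
  · subst h
    by_cases h' : m' = n''
    · subst h'
      simp only [← mk_seq]
      exact of_top (.seq_assoc D E F)
    · rw [comp_mismatch E F h', ← mk_seq, comp_mismatch _ _ h']; rfl
  · rw [comp_mismatch D E h]
    by_cases h' : m' = n''
    · subst h'
      rw [← mk_seq, comp_mismatch _ _ h]; rfl
    · rw [comp_mismatch E F h']; rfl

theorem tens_assoc (a b c : Q T) : (a ⊠ b) ⊠ c = a ⊠ b ⊠ c := by
  refine ind (fun {n m} D => ?_) (fun n m => by simp [add_assoc]) a
  refine ind (fun {n' m'} E => ?_) (fun n m => by simp [add_assoc]) b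
  refine ind (fun {n'' m''} F => ?_) (fun n m => by simp [add_assoc]) c
  exact of_top (.par_assoc D E F)

theorem id_comp {n : ℕ} {a : Q T} (h : a.dom = n) : id n ⨾ a = a := by
  subst h
  refine ind (fun {n m} D => ?_) (fun n m => by simp) a
  rw [dom_mk, id, ← mk_seq]
  exact of_top (.wires_seq D)

theorem comp_id {n : ℕ} {a : Q T} (h : a.cod = n) : a ⨾ id n = a := by
  subst h
  refine ind (fun {n m} D => ?_) (fun n m => by simp) a
  rw [cod_mk, id, ← mk_seq]
  exact of_top (.seq_wires D)

@[simp] theorem id_zero_tens (a : Q T) : id 0 ⊠ a = a := by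
  refine ind (fun {n m} D => ?_) (fun n m => by simp) a
  exact of_top (.empty_par D)

@[simp] theorem tens_id_zero (a : Q T) : a ⊠ id 0 = a := by
  refine ind (fun {n m} D => ?_) (fun n m => by simp) a
  exact of_top (.par_empty D)

@[simp] theorem id_tens_id (n m : ℕ) : (id n ⊠ id m : Q T) = id (n + m) :=
  of_top (.wires_par n m)

@[simp] theorem id_tens_id_tens (n m : ℕ) (a : Q T) : id n ⊠ id m ⊠ a = id (n + m) ⊠ a := by
  rw [← tens_assoc, id_tens_id]

/-- Unlike associativity, interchange needs typing hypotheses: two mismatches on the left may cancel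
in the sums of arities on the right. -/
theorem comp_tens_comp {a b c d : Q T} (h : a.cod = b.dom) (h' : c.cod = d.dom) :
    (a ⨾ b) ⊠ (c ⨾ d) = (a ⊠ c) ⨾ (b ⊠ d) := by
  revert h h'
  refine ind (fun {n m} D => ?_) (fun n m => by intros; simp) a
  refine ind (fun {n' m'} E => ?_) (fun n m => by intros; simp) b
  refine ind (fun {k l} F => ?_) (fun n m => by intros; simp) c
  refine ind (fun {k' l'} G => ?_) (fun n m => by intros; simp) d
  intro h h'
  simp only [dom_mk, cod_mk] at h h'
  subst h h'
  simp only [← mk_seq, ← mk_par]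
  exact of_top (.interchange D E F G)

@[simp] theorem sw_sw (n m : ℕ) : (sw n m ⨾ sw m n : Q T) = id (n + m) := by
  rw [sw, sw, ← mk_seq]
  exact of_top (.swap_swap n m)

theorem tens_sw {a b : Q T} {n m n' m' : ℕ} (h : a.dom = n) (h' : a.cod = m) (k : b.dom = n')
    (k' : b.cod = m') : (a ⊠ b) ⨾ sw m m' = sw n n' ⨾ (b ⊠ a) := by
  subst h h' k k'
  refine ind (fun {n m} D => ?_) (fun n m => by simp [sw]) a
  refine ind (fun {n' m'} E => ?_) (fun n m => by simp [sw]) b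
  change mk T (par D E) ⨾ mk T (swap m m') = mk T (swap n n') ⨾ mk T (par E D)
  rw [← mk_seq, ← mk_seq]
  exact of_top (.swap_natural D E)

@[simp] theorem sw_zero (n : ℕ) : (sw n 0 : Q T) = id n := of_top (.swap_empty n)

@[simp] theorem zero_sw (n : ℕ) : (sw 0 n : Q T) = id n := by
  have h := sw_sw (T := T) n 0
  rwa [sw_zero, id_comp (by simp)] at h

theorem mk_retype {n n' m : ℕ} (h : n = n') (D : Diag n m) : mk T (retype h D) = mk T D := by
  subst h; rfl

theorem sw_add (n m k : ℕ) : (sw n (m + k) : Q T) = (sw n m ⊠ id k) ⨾ (id m ⊠ sw n k) := by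
  have h := of_top (T := T) (.swap_add n m k)
  rw [mk_seq, mk_retype] at h
  exact h.symm

/-- Only the other hexagon is an axiom. Here the right-hand side is shown to be inverse to `sw k (n
+ m)`, hence equal to `sw (n + m) k`. -/
theorem add_sw (n m k : ℕ) : (sw (n + m) k : Q T) = (id n ⊠ sw m k) ⨾ (sw n k ⊠ id m) := by
  have h1 : (sw k (n + m) ⨾ (id n ⊠ sw m k) ⨾ (sw n k ⊠ id m) : Q T) = id (k + (n + m)) := by
    rw [sw_add, comp_assoc, ← comp_assoc (id n ⊠ sw k m), ← comp_tens_comp (by simp) (by simp),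
      sw_sw, id_comp (by simp), id_tens_id, id_comp (by simp; omega),
      ← comp_tens_comp (by simp) (by simp), sw_sw, id_comp (by simp), id_tens_id, add_assoc]
  calc (sw (n + m) k : Q T)
      = sw (n + m) k ⨾ sw k (n + m) ⨾ (id n ⊠ sw m k) ⨾ (sw n k ⊠ id m) := by
        rw [h1, comp_id (by simp)]
    _ = _ := by
        rw [← comp_assoc, sw_sw, id_comp (by simp; omega)]

/-! ### Sliding boxes past each other -/

theorem comp_tens_id {a b : Q T} (h : a.cod = b.dom) (k : ℕ) :
    (a ⨾ b) ⊠ id k = (a ⊠ id k) ⨾ (b ⊠ id k) := by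
  rw [← comp_tens_comp h (by simp), id_comp (by simp)]

theorem id_tens_comp {a b : Q T} (h : a.cod = b.dom) (k : ℕ) :
    id k ⊠ (a ⨾ b) = (id k ⊠ a) ⨾ (id k ⊠ b) := by
  rw [← comp_tens_comp (by simp) h, id_comp (by simp)]

theorem left_right {a b : Q T} {m n : ℕ} (h : a.cod = m) (h' : b.dom = n) :
    (a ⊠ id n) ⨾ (id m ⊠ b) = a ⊠ b := by
  rw [← comp_tens_comp (by simp [h]) (by simp [h']), comp_id h, id_comp h']

theorem right_left {a b : Q T} {m n : ℕ} (h : a.dom = m) (h' : b.cod = n) :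
    (id m ⊠ b) ⨾ (a ⊠ id n) = a ⊠ b := by
  rw [← comp_tens_comp (by simp [h]) (by simp [h']), comp_id h', id_comp h]

/-- Scalars move to the front. -/
theorem tens_scalar {s : Q T} (h : s.dom = 0) (h' : s.cod = 0) (a : Q T) : a ⊠ s = s ⊠ a := by
  have := tens_sw (a := a) (b := s) rfl rfl h h'
  rwa [sw_zero, sw_zero, comp_id (by simp [h']), id_comp (by simp [h])] at this

theorem scalar_tens_comp {s a : Q T} (h' : s.cod = 0) (b : Q T)
    (hab : a.cod = b.dom) : s ⊠ (a ⨾ b) = (s ⊠ a) ⨾ b := by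
  have : (s ⨾ id 0) ⊠ (a ⨾ b) = (s ⊠ a) ⨾ (id 0 ⊠ b) := comp_tens_comp (by simp [h']) hab
  rwa [comp_id h', id_zero_tens] at this

theorem comp_scalar_tens {s b : Q T} (h : s.dom = 0) (a : Q T)
    (hab : a.cod = b.dom) : a ⨾ (s ⊠ b) = s ⊠ (a ⨾ b) := by
  have : (id 0 ⨾ s) ⊠ (a ⨾ b) = (id 0 ⊠ a) ⨾ (s ⊠ b) := comp_tens_comp (by simp [h]) hab
  rwa [id_comp h, id_zero_tens, eq_comm] at this

theorem scalar_comp {s t : Q T} (h' : s.cod = 0) (k : t.dom = 0) : s ⨾ t = s ⊠ t := by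
  have := left_right (a := s) (b := t) h' k
  simpa using this

end Q

end ZX

end

/-! ### Stabilizer phases, generators, and the rules as equations of classes -/

noncomputable section

namespace ZX

open Diag

/-! ### Stabilizer phases and the theories used -/

theorem four_zsmul_halfPi : (4 : ℤ) • halfPi = 0 := by
  rw [halfPi, ← Real.Angle.coe_zsmul, ← Real.Angle.coe_two_pi]
  congr 1
  simp; ring

/-- Multiples of `π/2`. -/
def phase : ZMod 4 →+ Real.Angle :=
  ZMod.lift 4 ⟨zmultiplesHom Real.Angle halfPi, by simpa using four_zsmul_halfPi⟩

theorem phase_intCast (k : ℤ) : phase (k : ZMod 4) = k • halfPi := by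
  simp [phase]

theorem exists_phase_eq (a : ZMod 4) : ∃ k : ℤ, phase a = k • halfPi := by
  obtain ⟨k, rfl⟩ := ZMod.intCast_surjective a
  exact ⟨k, phase_intCast k⟩

theorem phase_one : phase 1 = halfPi := by simpa using phase_intCast 1

theorem phase_two : phase 2 = pie := by
  have h := phase_intCast 2
  rw [halfPi, ← Real.Angle.coe_zsmul] at h
  push_cast at h
  rw [h]
  congr 1
  simp; ring

/-- Topological equality as a theory. -/
def topThy : Theory where
  rel := TopAx
  top_le h := h
  arity h := h.arity

/-- The stabilizer ZX-calculus as a theory. -/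
def stabThy : Theory where
  rel L R := TopAx L R ∨ (Rule L R ∧ L.IsStabilizer ∧ R.IsStabilizer)
  top_le h := .inl h
  arity h := h.elim (fun h => h.arity) (fun h => h.1.arity)

/-- The equations of the stabilizer ZX-calculus, with all invertible scalars identified with the
empty diagram. -/
inductive ModAx : ∀ {n m n' m' : ℕ}, Diag n m → Diag n' m' → Prop where
  | stab {n m n' m' : ℕ} {D : Diag n m} {E : Diag n' m'} :
      TopAx D E ∨ (Rule D E ∧ D.IsStabilizer ∧ E.IsStabilizer) → ModAx D E
  | unit (s t : Diag 0 0) : StabEq (par s t) (wires 0) → ModAx s (wires 0)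

/-- The stabilizer ZX-calculus modulo invertible scalars. -/
def modThy : Theory where
  rel := ModAx
  top_le h := .stab (.inl h)
  arity h := by
    cases h with
    | stab h => exact stabThy.arity h
    | unit => exact ⟨rfl, rfl⟩

/-- Theories that contain the stabilizer rules. -/
class StabTheory (T : Theory) : Prop where
  rule {n m n' m' : ℕ} {D : Diag n m} {E : Diag n' m'} : Rule D E → D.IsStabilizer →
    E.IsStabilizer → T.rel D E

instance : StabTheory stabThy := ⟨fun h h' h'' => .inr ⟨h, h', h''⟩⟩

instance : StabTheory modThy := ⟨fun h h' h'' => .stab (.inr ⟨h, h', h''⟩)⟩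

@[simp] theorem Colour.other_other (c : Colour) : c.other.other = c := by cases c <;> rfl

namespace Q

variable {T : Theory}

/-! ### Generators -/

/-- The phase is counted in units of π/2, so that phase arithmetic is decidable. -/
def sp (c : Colour) (n m : ℕ) (a : ZMod 4) : Q T := mk T (spider c n m (phase a))

def had : Q T := mk T Diag.had

def cup : Q T := mk T Diag.cup

def cap : Q T := mk T Diag.cap

def star : Q T := mk T Diag.star

/-- Juxtaposition of copies. -/
def pw (a : Q T) : ℕ → Q T
  | 0 => id 0
  | n + 1 => pw a n ⊠ a

@[simp] theorem dom_sp (c : Colour) (n m : ℕ) (a : ZMod 4) : (sp c n m a : Q T).dom = n := (rfl)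
@[simp] theorem cod_sp (c : Colour) (n m : ℕ) (a : ZMod 4) : (sp c n m a : Q T).cod = m := (rfl)
@[simp] theorem dom_had : (had : Q T).dom = 1 := (rfl)
@[simp] theorem cod_had : (had : Q T).cod = 1 := (rfl)
@[simp] theorem dom_cup : (cup : Q T).dom = 0 := (rfl)
@[simp] theorem cod_cup : (cup : Q T).cod = 2 := (rfl)
@[simp] theorem dom_cap : (cap : Q T).dom = 2 := (rfl)
@[simp] theorem cod_cap : (cap : Q T).cod = 0 := (rfl)
@[simp] theorem dom_star : (star : Q T).dom = 0 := (rfl)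
@[simp] theorem cod_star : (star : Q T).cod = 0 := (rfl)

@[simp] theorem dom_pw (a : Q T) (n : ℕ) : (pw a n).dom = n * a.dom := by
  induction n with
  | zero => simp [pw]
  | succ n ih => simp [pw, ih, add_mul]

@[simp] theorem cod_pw (a : Q T) (n : ℕ) : (pw a n).cod = n * a.cod := by
  induction n with
  | zero => simp [pw]
  | succ n ih => simp [pw, ih, add_mul]

@[simp] theorem pw_zero (a : Q T) : pw a 0 = id 0 := rfl
@[simp] theorem pw_one (a : Q T) : pw a 1 = a := by simp [pw]
theorem pw_two (a : Q T) : pw a 2 = a ⊠ a := by simp [pw]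
theorem mk_copies (D : Diag 1 1) (n : ℕ) : mk T (copies D n) = pw (mk T D) n := by
  induction n with
  | zero => rfl
  | succ n ih => rw [copies, mk_par, ih]; rfl

/-! ### Topological equations of generators -/

theorem sp_swap (c : Colour) (n a b : ℕ) (k : ZMod 4) :
    (sp c n (a + 2 + b) k ⨾ id a ⊠ sw 1 1 ⊠ id b : Q T) = sp c n (a + 2 + b) k := by
  have h := of_top (T := T) (.swap_outputs c n a b (phase k))
  rw [mk_seq, mk_par, mk_par, tens_assoc] at h
  exact h

theorem swap_sp (c : Colour) (a b m : ℕ) (k : ZMod 4) :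
    (id a ⊠ sw 1 1 ⊠ id b ⨾ sp c (a + 2 + b) m k : Q T) = sp c (a + 2 + b) m k := by
  have h := of_top (T := T) (.swap_inputs c a b m (phase k))
  rw [mk_seq, mk_par, mk_par, tens_assoc] at h
  exact h

theorem bend_output (c : Colour) (n m : ℕ) (k : ZMod 4) :
    (sp c n (m + 1) k ⊠ id 1 ⨾ id m ⊠ cap : Q T) = sp c (n + 1) m k :=
  (mk_seq _ _).symm.trans (of_top (T := T) (.bend_output c n m (phase k)))

theorem snake_left : (id 1 ⊠ cup ⨾ cap ⊠ id 1 : Q T) = id 1 :=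
  (mk_seq _ _).symm.trans (of_top (T := T) .snake_left)

theorem snake_right : (cup ⊠ id 1 ⨾ id 1 ⊠ cap : Q T) = id 1 :=
  (mk_seq _ _).symm.trans (of_top (T := T) .snake_right)

theorem had_cap : (had ⊠ id 1 ⨾ cap : Q T) = id 1 ⊠ had ⨾ cap := by
  have h := of_top (T := T) .had_cap
  rw [mk_seq, mk_seq] at h
  exact h

/-! ### Rules -/

set_option linter.unusedSimpArgs false

theorem mk_wires (n : ℕ) : mk T (wires n) = id n := rfl
theorem mk_swap (n m : ℕ) : mk T (swap n m) = sw n m := rfl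
theorem mk_had : mk T Diag.had = had := rfl
theorem mk_cup : mk T Diag.cup = cup := rfl
theorem mk_cap : mk T Diag.cap = cap := rfl
theorem mk_star : mk T Diag.star = star := rfl

theorem recolour_retype {n n' m : ℕ} (h : n = n') (D : Diag n m) :
    (retype h D).recolour = retype h D.recolour := by
  subst h; rfl

theorem mk_flip_retype {n n' m : ℕ} (h : n = n') (D : Diag n m) :
    mk T (retype h D).flip = mk T D.flip := by
  subst h; rfl

@[simp] theorem isStabilizer_retype {n n' m : ℕ} (h : n = n') (D : Diag n m) :
    (retype h D).IsStabilizer ↔ D.IsStabilizer := by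
  subst h; rfl

@[simp] theorem isStabilizer_copies {D : Diag 1 1} (hD : D.IsStabilizer) (n : ℕ) :
    (copies D n).IsStabilizer := by
  induction n with
  | zero => trivial
  | succ n ih => exact ⟨ih, hD⟩

theorem recolour_copies (D : Diag 1 1) (n : ℕ) :
    (copies D n).recolour = copies D.recolour n := by
  induction n with
  | zero => rfl
  | succ n ih => simp [copies, recolour, ih]

@[simp] theorem isStabilizer_seq {n m k : ℕ} (D : Diag n m) (E : Diag m k) :
    (seq D E).IsStabilizer ↔ D.IsStabilizer ∧ E.IsStabilizer := Iff.rfl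

@[simp] theorem isStabilizer_par {n m k l : ℕ} (D : Diag n m) (E : Diag k l) :
    (par D E).IsStabilizer ↔ D.IsStabilizer ∧ E.IsStabilizer := Iff.rfl

@[simp] theorem isStabilizer_wires (n : ℕ) : (wires n).IsStabilizer := trivial
@[simp] theorem isStabilizer_swap (n m : ℕ) : (swap n m).IsStabilizer := trivial
@[simp] theorem isStabilizer_had : Diag.had.IsStabilizer := trivial
@[simp] theorem isStabilizer_cup : Diag.cup.IsStabilizer := trivial
@[simp] theorem isStabilizer_cap : Diag.cap.IsStabilizer := trivial
@[simp] theorem isStabilizer_star : Diag.star.IsStabilizer := trivial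

theorem isStabilizer_recolour {n m : ℕ} {D : Diag n m} (h : D.IsStabilizer) :
    D.recolour.IsStabilizer := by
  induction D with
  | seq D E ih ih' => exact ⟨ih h.1, ih' h.2⟩
  | par D E ih ih' => exact ⟨ih h.1, ih' h.2⟩
  | _ => exact h

theorem isStabilizer_flip {n m : ℕ} {D : Diag n m} (h : D.IsStabilizer) :
    D.flip.IsStabilizer := by
  induction D with
  | seq D E ih ih' => exact ⟨ih' h.2, ih h.1⟩
  | par D E ih ih' => exact ⟨ih h.1, ih' h.2⟩
  | _ => exact h

@[simp] theorem isStabilizer_sp (c : Colour) (n m : ℕ) (a : ZMod 4) :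
    (spider c n m (phase a)).IsStabilizer := exists_phase_eq a

@[simp] theorem isStabilizer_sp_zero (c : Colour) (n m : ℕ) : (spider c n m 0).IsStabilizer :=
  ⟨0, by simp⟩

@[simp] theorem isStabilizer_sp_pie (c : Colour) (n m : ℕ) :
    (spider c n m pie).IsStabilizer := by
  rw [← phase_two]; exact exists_phase_eq 2

@[simp] theorem isStabilizer_sp_halfPi (c : Colour) (n m : ℕ) : (spider c n m halfPi).IsStabilizer :=
  ⟨1, by simp⟩

@[simp] theorem isStabilizer_sp_neg_halfPi (c : Colour) (n m : ℕ) :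
    (spider c n m (-halfPi)).IsStabilizer := ⟨-1, by simp⟩

@[simp] theorem isStabilizer_sp_neg (c : Colour) (n m : ℕ) (a : ZMod 4) :
    (spider c n m (-phase a)).IsStabilizer := by
  rw [← map_neg]; exact exists_phase_eq _

@[simp] theorem isStabilizer_sp_add (c : Colour) (n m : ℕ) (a b : ZMod 4) :
    (spider c n m (phase a + phase b)).IsStabilizer := by
  rw [← map_add]; exact exists_phase_eq _

/-- The scalar in which a state of colour `c.other` meets an effect of colour `c`. -/
def inn (c : Colour) (a b : ZMod 4) : Q T := sp c.other 0 1 b ⨾ sp c 1 0 a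

@[simp] theorem dom_inn (c : Colour) (a b : ZMod 4) : (inn c a b : Q T).dom = 0 := by simp [inn]
@[simp] theorem cod_inn (c : Colour) (a b : ZMod 4) : (inn c a b : Q T).cod = 0 := by simp [inn]

/-- The zero scalar. -/
def zro : Q T := sp .green 0 0 2

@[simp] theorem dom_zro : (zro : Q T).dom = 0 := (rfl)
@[simp] theorem cod_zro : (zro : Q T).cod = 0 := (rfl)

variable [StabTheory T]

theorem of_rule {n m n' m' : ℕ} {D : Diag n m} {E : Diag n' m'} (h : Rule D E)
    (hD : D.IsStabilizer) (hE : E.IsStabilizer) : mk T D = mk T E :=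
  mk_eq_iff.2 (.of (StabTheory.rule h hD hE))

/-- Instances of a rule with either choice of colours. -/
theorem of_rule_colour {n m n' m' : ℕ} {D : Diag n m} {E : Diag n' m'} (h : Rule D E)
    (hD : D.IsStabilizer) (hE : E.IsStabilizer) :
    mk T D = mk T E ∧ mk T D.recolour = mk T E.recolour :=
  ⟨of_rule h hD hE, of_rule h.recolour (isStabilizer_recolour hD) (isStabilizer_recolour hE)⟩

theorem of_rule_flip {n m n' m' : ℕ} {D : Diag n m} {E : Diag n' m'} (h : Rule D E)
    (hD : D.IsStabilizer) (hE : E.IsStabilizer) :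
    mk T D.flip = mk T E.flip ∧ mk T D.recolour.flip = mk T E.recolour.flip :=
  ⟨of_rule h.flip (isStabilizer_flip hD) (isStabilizer_flip hE),
    of_rule h.recolour.flip (isStabilizer_flip (isStabilizer_recolour hD))
      (isStabilizer_flip (isStabilizer_recolour hE))⟩

/-- As for all rules below, the green case is the rule itself and the red case is its recolouring.
-/
theorem sp_fuse (c : Colour) (n m k l : ℕ) (a b : ZMod 4) :
    (sp c n (m + 1) a ⊠ id k ⨾ id m ⊠ sp c (1 + k) l b : Q T) = sp c (n + k) (m + l) (a + b) := by
  have h := of_rule_colour (T := T) (.spider n m k l (phase a) (phase b))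
    (by simp) (by simp)
  simp only [recolour, recolour_copies, recolour_retype, Diag.flip, mk_flip_retype, mk_seq,
    mk_par, mk_retype, mk_copies, mk_wires, mk_swap, mk_had, mk_cup, mk_cap, mk_star, tens_assoc,
    comp_assoc, Colour.other] at h
  cases c
  · simpa only [inn, sp, map_zero, map_neg, map_add, phase_one, phase_two, Colour.other]  using h.1
  · simpa only [inn, sp, map_zero, map_neg, map_add, phase_one, phase_two, Colour.other]  using h.2

theorem sp_fuse' (c : Colour) (n m k l : ℕ) (a b : ZMod 4) :
    (id m ⊠ sp c l (1 + k) b ⨾ sp c (m + 1) n a ⊠ id k : Q T) = sp c (m + l) (n + k) (a + b) := by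
  have h := of_rule_flip (T := T) (.spider n m k l (phase a) (phase b))
    (by simp) (by simp)
  simp only [recolour, recolour_copies, recolour_retype, Diag.flip, mk_flip_retype, mk_seq,
    mk_par, mk_retype, mk_copies, mk_wires, mk_swap, mk_had, mk_cup, mk_cap, mk_star, tens_assoc,
    comp_assoc, Colour.other] at h
  cases c
  · simpa only [inn, sp, map_zero, map_neg, map_add, phase_one, phase_two, Colour.other]  using h.1
  · simpa only [inn, sp, map_zero, map_neg, map_add, phase_one, phase_two, Colour.other]  using h.2

theorem sp_loop (c : Colour) (n m : ℕ) (a : ZMod 4) :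
    (sp c n (m + 2) a ⨾ id m ⊠ cap : Q T) = sp c n m a := by
  have h := of_rule_colour (T := T) (.loop n m (phase a))
    (by simp) (by simp)
  simp only [recolour, recolour_copies, recolour_retype, Diag.flip, mk_flip_retype, mk_seq,
    mk_par, mk_retype, mk_copies, mk_wires, mk_swap, mk_had, mk_cup, mk_cap, mk_star, tens_assoc,
    comp_assoc, Colour.other] at h
  cases c
  · simpa only [inn, sp, map_zero, map_neg, map_add, phase_one, phase_two, Colour.other]  using h.1
  · simpa only [inn, sp, map_zero, map_neg, map_add, phase_one, phase_two, Colour.other]  using h.2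

theorem sp_cup (c : Colour) : (sp c 0 2 0 : Q T) = cup := by
  have h := of_rule_colour (T := T) (.cup)
    (by simp) (by simp)
  simp only [recolour, recolour_copies, recolour_retype, Diag.flip, mk_flip_retype, mk_seq,
    mk_par, mk_retype, mk_copies, mk_wires, mk_swap, mk_had, mk_cup, mk_cap, mk_star, tens_assoc,
    comp_assoc, Colour.other] at h
  cases c
  · simpa only [inn, sp, map_zero, map_neg, map_add, phase_one, phase_two, Colour.other]  using h.1
  · simpa only [inn, sp, map_zero, map_neg, map_add, phase_one, phase_two, Colour.other]  using h.2

theorem sp_cap (c : Colour) : (sp c 2 0 0 : Q T) = cap := by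
  have h := of_rule_flip (T := T) (.cup)
    (by simp) (by simp)
  simp only [recolour, recolour_copies, recolour_retype, Diag.flip, mk_flip_retype, mk_seq,
    mk_par, mk_retype, mk_copies, mk_wires, mk_swap, mk_had, mk_cup, mk_cap, mk_star, tens_assoc,
    comp_assoc, Colour.other] at h
  cases c
  · simpa only [inn, sp, map_zero, map_neg, map_add, phase_one, phase_two, Colour.other]  using h.1
  · simpa only [inn, sp, map_zero, map_neg, map_add, phase_one, phase_two, Colour.other]  using h.2

theorem bialgebra (c : Colour) :
    (inn c 0 0 ⊠ (sp c 1 2 0 ⊠ sp c 1 2 0 ⨾ id 1 ⊠ sw 1 1 ⊠ id 1 ⨾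
      sp c.other 2 1 0 ⊠ sp c.other 2 1 0) : Q T) = sp c.other 2 1 0 ⨾ sp c 1 2 0 := by
  have h := of_rule_colour (T := T) (.bialgebra)
    (by simp) (by simp)
  simp only [recolour, recolour_copies, recolour_retype, Diag.flip, mk_flip_retype, mk_seq,
    mk_par, mk_retype, mk_copies, mk_wires, mk_swap, mk_had, mk_cup, mk_cap, mk_star, tens_assoc,
    comp_assoc, Colour.other] at h
  cases c
  · simpa only [inn, sp, map_zero, map_neg, map_add, phase_one, phase_two, Colour.other]  using h.1
  · simpa only [inn, sp, map_zero, map_neg, map_add, phase_one, phase_two, Colour.other]  using h.2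

theorem copy (c : Colour) :
    (inn c 0 0 ⊠ (sp c.other 0 1 0 ⨾ sp c 1 2 0) : Q T) = sp c.other 0 1 0 ⊠ sp c.other 0 1 0 := by
  have h := of_rule_colour (T := T) (.copy)
    (by simp) (by simp)
  simp only [recolour, recolour_copies, recolour_retype, Diag.flip, mk_flip_retype, mk_seq,
    mk_par, mk_retype, mk_copies, mk_wires, mk_swap, mk_had, mk_cup, mk_cap, mk_star, tens_assoc,
    comp_assoc, Colour.other] at h
  cases c
  · simpa only [inn, sp, map_zero, map_neg, map_add, phase_one, phase_two, Colour.other]  using h.1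
  · simpa only [inn, sp, map_zero, map_neg, map_add, phase_one, phase_two, Colour.other]  using h.2

theorem copy_flip (c : Colour) :
    ((sp c 0 1 0 ⨾ sp c.other 1 0 0) ⊠ (sp c 2 1 0 ⨾ sp c.other 1 0 0) : Q T) =
      sp c.other 1 0 0 ⊠ sp c.other 1 0 0 := by
  have h := of_rule_flip (T := T) (.copy)
    (by simp) (by simp)
  simp only [recolour, recolour_copies, recolour_retype, Diag.flip, mk_flip_retype, mk_seq,
    mk_par, mk_retype, mk_copies, mk_wires, mk_swap, mk_had, mk_cup, mk_cap, mk_star, tens_assoc,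
    comp_assoc, Colour.other] at h
  cases c
  · simpa only [inn, sp, map_zero, map_neg, map_add, phase_one, phase_two, Colour.other]  using h.1
  · simpa only [inn, sp, map_zero, map_neg, map_add, phase_one, phase_two, Colour.other]  using h.2

theorem pi_copy (c : Colour) (m : ℕ) :
    (sp c 1 1 2 ⨾ sp c.other 1 m 0 : Q T) = sp c.other 1 m 0 ⨾ pw (sp c 1 1 2) m := by
  have h := of_rule_colour (T := T) (.pi_copy m)
    (by simp) (by simp)
  simp only [recolour, recolour_copies, recolour_retype, Diag.flip, mk_flip_retype, mk_seq,
    mk_par, mk_retype, mk_copies, mk_wires, mk_swap, mk_had, mk_cup, mk_cap, mk_star, tens_assoc,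
    comp_assoc, Colour.other] at h
  cases c
  · simpa only [inn, sp, map_zero, map_neg, map_add, phase_one, phase_two, Colour.other]  using h.1
  · simpa only [inn, sp, map_zero, map_neg, map_add, phase_one, phase_two, Colour.other]  using h.2

theorem pi_copy_flip (c : Colour) :
    (sp c.other 2 1 0 ⨾ sp c 1 1 2 : Q T) = sp c 1 1 2 ⊠ sp c 1 1 2 ⨾ sp c.other 2 1 0 := by
  have h := of_rule_flip (T := T) (.pi_copy 2)
    (by simp) (by simp)
  simp only [recolour, copies, Diag.flip, mk_seq, mk_par, mk_wires, id_zero_tens, Colour.other]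
    at h
  cases c
  · simpa only [inn, sp, map_zero, map_neg, map_add, phase_one, phase_two, Colour.other] using h.1
  · simpa only [inn, sp, map_zero, map_neg, map_add, phase_one, phase_two, Colour.other] using h.2

theorem pi_commutation (c : Colour) (a : ZMod 4) :
    (inn c 0 0 ⊠ (sp c 1 1 a ⨾ sp c.other 1 1 2) : Q T) =
      inn c a 2 ⊠ (sp c.other 1 1 2 ⨾ sp c 1 1 (-a)) := by
  have h := of_rule_colour (T := T) (.pi_commutation (phase a))
    (by simp) (by simp)
  simp only [recolour, recolour_copies, recolour_retype, Diag.flip, mk_flip_retype, mk_seq,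
    mk_par, mk_retype, mk_copies, mk_wires, mk_swap, mk_had, mk_cup, mk_cap, mk_star, tens_assoc,
    comp_assoc, Colour.other] at h
  cases c
  · simpa only [inn, sp, map_zero, map_neg, map_add, phase_one, phase_two, Colour.other]  using h.1
  · simpa only [inn, sp, map_zero, map_neg, map_add, phase_one, phase_two, Colour.other]  using h.2

theorem colour_change (c : Colour) (n m : ℕ) (a : ZMod 4) :
    (pw had n ⨾ sp c n m a ⨾ pw had m : Q T) = sp c.other n m a := by
  have h := of_rule_colour (T := T) (.colour_change n m (phase a))
    (by simp) (by simp)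
  simp only [recolour, recolour_copies, recolour_retype, Diag.flip, mk_flip_retype, mk_seq,
    mk_par, mk_retype, mk_copies, mk_wires, mk_swap, mk_had, mk_cup, mk_cap, mk_star, tens_assoc,
    comp_assoc, Colour.other] at h
  cases c
  · simpa only [inn, sp, map_zero, map_neg, map_add, phase_one, phase_two, Colour.other]  using h.1
  · simpa only [inn, sp, map_zero, map_neg, map_add, phase_one, phase_two, Colour.other]  using h.2

theorem euler (c : Colour) :
    (inn c 0 0 ⊠ inn c 0 0 ⊠ had : Q T) =
      inn c (-1) (-1) ⊠ (sp c 1 1 1 ⨾ sp c.other 1 1 1 ⨾ sp c 1 1 1) := by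
  have h := of_rule_colour (T := T) (.euler)
    (by simp) (by simp)
  simp only [recolour, recolour_copies, recolour_retype, Diag.flip, mk_flip_retype, mk_seq,
    mk_par, mk_retype, mk_copies, mk_wires, mk_swap, mk_had, mk_cup, mk_cap, mk_star, tens_assoc,
    comp_assoc, Colour.other] at h
  cases c
  · simpa only [inn, sp, map_zero, map_neg, map_add, phase_one, phase_two, Colour.other]  using h.1
  · simpa only [inn, sp, map_zero, map_neg, map_add, phase_one, phase_two, Colour.other]  using h.2

theorem star_sp : (star ⊠ sp .green 0 0 0 : Q T) = id 0 := by
  have h := of_rule_colour (T := T) (.star)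
    (by simp) (by simp)
  simp only [recolour, recolour_copies, recolour_retype, Diag.flip, mk_flip_retype, mk_seq,
    mk_par, mk_retype, mk_copies, mk_wires, mk_swap, mk_had, mk_cup, mk_cap, mk_star, tens_assoc,
    comp_assoc, Colour.other] at h
  simpa only [inn, sp, map_zero, map_neg, map_add, phase_one, phase_two, Colour.other]  using h.1

/-- Colour change on a spider without legs involves no Hadamard nodes at all. -/
theorem sp_zero_zero (c d : Colour) (a : ZMod 4) : (sp c 0 0 a : Q T) = sp d 0 0 a := by
  have h (c : Colour) := colour_change (T := T) c 0 0 a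
  simp only [pw_zero, id_comp, dom_sp, comp_id, cod_sp, dom_comp] at h
  have h' := h .green
  cases c <;> cases d <;> first | rfl | exact h' | exact h'.symm

theorem zro_eq_sp (c : Colour) : (zro : Q T) = sp c 0 0 2 := sp_zero_zero _ _ _

theorem zro_cut (c : Colour) : (zro ⊠ id 1 : Q T) = zro ⊠ (sp c 1 0 0 ⨾ sp c.other 0 1 0) := by
  have h := of_rule_colour (T := T) .zero (by simp) (by simp)
  simp only [recolour, recolour_copies, recolour_retype, Diag.flip, mk_flip_retype, mk_seq,
    mk_par, mk_retype, mk_copies, mk_wires, mk_swap, mk_had, mk_cup, mk_cap, mk_star, tens_assoc,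
    comp_assoc, Colour.other] at h
  rw [zro_eq_sp c]
  cases c
  · simpa only [inn, sp, map_zero, map_neg, map_add, phase_one, phase_two, Colour.other]  using h.1
  · simpa only [inn, sp, map_zero, map_neg, map_add, phase_one, phase_two, Colour.other]  using h.2

theorem zro_sp (c : Colour) (a : ZMod 4) : (zro ⊠ sp c 0 0 a : Q T) = zro := by
  have h := of_rule_colour (T := T) (.zero_scalar (phase a)) (by simp)
    (by simp)
  simp only [recolour, recolour_copies, recolour_retype, Diag.flip, mk_flip_retype, mk_seq,
    mk_par, mk_retype, mk_copies, mk_wires, mk_swap, mk_had, mk_cup, mk_cap, mk_star, tens_assoc,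
    comp_assoc, Colour.other] at h
  rw [zro_eq_sp c]
  cases c
  · simpa only [inn, sp, map_zero, map_neg, map_add, phase_one, phase_two, Colour.other]  using h.1
  · simpa only [inn, sp, map_zero, map_neg, map_add, phase_one, phase_two, Colour.other]  using h.2

end Q

end ZX

end

/-! ### Spider fusion, transposes and invertible scalars -/

noncomputable section

namespace ZX

open Diag

namespace Q

variable {T : Theory}

theorem pw_comp {a b : Q T} (h : a.cod = b.dom) (n : ℕ) : pw a n ⨾ pw b n = pw (a ⨾ b) n := by
  induction n with
  | zero => simp [pw, id_comp]
  | succ n ih => rw [pw, pw, pw, ← comp_tens_comp (by simp [h]) h, ih]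

theorem pw_id (n : ℕ) : pw (id 1 : Q T) n = id n := by
  induction n with
  | zero => rfl
  | succ n ih => rw [pw, ih, id_tens_id]

/-- Scalars with an inverse. -/
def IsInv (s : Q T) : Prop := ∃ t, s ⊠ t = id 0

theorem IsInv.left {s t : Q T} (h : IsInv (s ⊠ t)) : IsInv s := by
  obtain ⟨u, hu⟩ := h
  exact ⟨t ⊠ u, by rw [← tens_assoc, hu]⟩

theorem IsInv.dom_cod {s : Q T} (h : IsInv s) : s.dom = 0 ∧ s.cod = 0 := by
  obtain ⟨u, hu⟩ := h
  have h1 := congrArg dom hu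
  have h2 := congrArg cod hu
  simp at h1 h2
  exact ⟨h1.1, h2.1⟩

theorem IsInv.tens {s t : Q T} (h : IsInv s) (h' : IsInv t) : IsInv (s ⊠ t) := by
  have hs := h.dom_cod
  have ht := h'.dom_cod
  obtain ⟨u, hu⟩ := h
  obtain ⟨v, hv⟩ := h'
  refine ⟨v ⊠ u, ?_⟩
  rw [tens_assoc, ← tens_assoc t, hv, id_zero_tens, hu]

variable [StabTheory T]

/-! ### Spider fusion -/

theorem fuse_right (c : Colour) (n m l : ℕ) (a b : ZMod 4) :
    (sp c n (m + 1) a ⨾ id m ⊠ sp c 1 l b : Q T) = sp c n (m + l) (a + b) := by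
  simpa using sp_fuse (T := T) c n m 0 l a b

theorem fuse_left (c : Colour) (n k l : ℕ) (a b : ZMod 4) :
    (sp c n (1 + k) a ⨾ sp c 1 l b ⊠ id k : Q T) = sp c n (l + k) (a + b) := by
  simpa [add_comm a b] using sp_fuse' (T := T) c l 0 k n b a

theorem fuse_in_right (c : Colour) (n m l : ℕ) (a b : ZMod 4) :
    (id m ⊠ sp c l 1 b ⨾ sp c (m + 1) n a : Q T) = sp c (m + l) n (a + b) := by
  simpa using sp_fuse' (T := T) c n m 0 l a b

theorem fuse_in_left (c : Colour) (n k l : ℕ) (a b : ZMod 4) :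
    (sp c l 1 b ⊠ id k ⨾ sp c (1 + k) n a : Q T) = sp c (l + k) n (a + b) := by
  simpa [add_comm a b] using sp_fuse (T := T) c l 0 k n b a

theorem sp_comp (c : Colour) (n l : ℕ) (a b : ZMod 4) :
    (sp c n 1 a ⨾ sp c 1 l b : Q T) = sp c n l (a + b) := by
  simpa using fuse_right (T := T) c n 0 l a b

theorem sp_comp_assoc (c : Colour) (n l : ℕ) (a b : ZMod 4) (x : Q T) :
    (sp c n 1 a ⨾ sp c 1 l b ⨾ x : Q T) = sp c n l (a + b) ⨾ x := by
  rw [← comp_assoc, sp_comp]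

-- Bending one leg of the spider that equals a cup produces a snake, which straightens to a wire.
@[simp] theorem sp_one (c : Colour) : (sp c 1 1 0 : Q T) = id 1 := by
  have h := bend_output (T := T) c 0 1 0
  rw [zero_add] at h
  have h' := snake_right (T := T)
  rw [← sp_cup c] at h'
  exact h.symm.trans h'

/-- Colour change for the trivial phase shift, which is a wire in both colours. -/
theorem had_had : (had ⨾ had : Q T) = id 1 := by
  have h := colour_change (T := T) .green 1 1 0
  simpa [id_comp] using h

theorem had_had_assoc (a : Q T) (h : a.dom = 1) : had ⨾ had ⨾ a = a := by
  rw [← comp_assoc, had_had, id_comp h]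

theorem pw_had_pw_had (n : ℕ) : (pw had n ⨾ pw had n : Q T) = id n := by
  rw [pw_comp rfl, had_had, pw_id]

theorem had_sp (c : Colour) (n m : ℕ) (a : ZMod 4) :
    (pw had n ⨾ sp c n m a : Q T) = sp c.other n m a ⨾ pw had m := by
  rw [← colour_change, comp_assoc, comp_assoc, pw_had_pw_had, comp_id (by simp)]

/-! ### Transposes -/

theorem sp_state_cap (c : Colour) (a : ZMod 4) : (id 1 ⊠ sp c 0 1 a ⨾ cap : Q T) = sp c 1 0 a := by
  rw [← sp_cap c]
  simpa using fuse_in_right (T := T) c 0 1 0 0 a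

theorem state_sp_cap (c : Colour) (a : ZMod 4) : (sp c 0 1 a ⊠ id 1 ⨾ cap : Q T) = sp c 1 0 a := by
  rw [← sp_cap c]
  simpa using fuse_in_left (T := T) c 0 1 0 0 a

theorem cup_effect_sp (c : Colour) (a : ZMod 4) : (cup ⨾ sp c 1 0 a ⊠ id 1 : Q T) = sp c 0 1 a := by
  rw [← sp_cup c]
  simpa using fuse_left (T := T) c 0 1 0 0 a

/-- Both sides are the same pair of states joined by a cap, one of the two being read as an effect.
-/
theorem inn_symm (c : Colour) (a b : ZMod 4) : (inn c a b : Q T) = inn c.other b a := by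
  have h : (sp c.other 0 1 b ⊠ sp c 0 1 a ⨾ cap : Q T) = inn c a b := by
    rw [← left_right (m := 1) (n := 0) rfl rfl, comp_assoc, sp_state_cap, tens_id_zero, inn]
  rw [← h, ← right_left (m := 0) (n := 1) rfl rfl, comp_assoc, state_sp_cap, id_zero_tens, inn,
    Colour.other_other]

/-! ### Invertible scalars -/

theorem state_tens_state_cap (c : Colour) : (sp c 0 1 0 ⊠ sp c 0 1 0 ⨾ cap : Q T) = sp c 0 0 0 := by
  rw [← left_right (m := 1) (n := 0) rfl rfl, comp_assoc, sp_state_cap, tens_id_zero, sp_comp,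
    add_zero]

/-- Close both sides of the copy rule with a cap: on the left the cap is a self-loop and leaves a
second inner product, on the right the two states fuse. -/
theorem inn_tens_inn (c : Colour) : (inn c 0 0 ⊠ inn c 0 0 : Q T) = sp c.other 0 0 0 := by
  have h := congrArg (· ⨾ cap) (copy (T := T) c)
  have h' := sp_loop (T := T) c 1 0 0
  simp only [zero_add, id_zero_tens] at h'
  rwa [state_tens_state_cap, ← scalar_tens_comp (by simp) _ (by simp), comp_assoc, h', ← inn] at h

theorem isInv_sp (c : Colour) : IsInv (sp c 0 0 0 : Q T) := by
  refine ⟨star, ?_⟩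
  rw [sp_zero_zero c .green, tens_scalar rfl rfl, star_sp]

theorem isInv_star : IsInv (star : Q T) := ⟨_, star_sp⟩

theorem isInv_inn_zero_zero (c : Colour) : IsInv (inn c 0 0 : Q T) :=
  IsInv.left (t := inn c 0 0) (by rw [inn_tens_inn]; exact isInv_sp _)

theorem sp_effects (c : Colour) (a b : ZMod 4) :
    (sp c 1 2 0 ⨾ sp c 1 0 a ⊠ sp c 1 0 b : Q T) = sp c 1 0 (a + b) := by
  rw [← right_left (m := 1) (n := 0) rfl rfl, ← comp_assoc]
  have := fuse_right (T := T) c 1 1 0 0 b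
  simp only [Nat.reduceAdd, zero_add, add_zero] at this
  rw [this, tens_id_zero, sp_comp, add_comm]

/-- Applying effects of opposite phases `a` and `-a` to the copy rule shows that the product of the
two inner products is the invertible `inn c 0 0 ⊠ inn c 0 0`. -/
theorem isInv_inn_zero (c : Colour) (a : ZMod 4) : IsInv (inn c a 0 : Q T) := by
  have h := congrArg (· ⨾ sp c 1 0 a ⊠ sp c 1 0 (-a)) (copy (T := T) c)
  rw [← scalar_tens_comp (by simp) _ (by simp), comp_assoc, sp_effects, add_neg_cancel, ← inn,
    ← comp_tens_comp (a := sp c.other 0 1 0) (by simp) (by simp), ← inn, ← inn] at h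
  exact IsInv.left (h ▸ (isInv_inn_zero_zero c).tens (isInv_inn_zero_zero c))

/-- Close the π-commutation rule with a state and an effect, undoing the π shift by a second one.
The left side becomes a product of scalars already known to be invertible, and `inn c a 2` is a
factor of the right side. -/
theorem isInv_inn_two (c : Colour) (a : ZMod 4) : IsInv (inn c a 2 : Q T) := by
  have h := congrArg (fun x => sp c.other 0 1 0 ⨾ x ⨾ sp c.other 1 1 2 ⨾ sp c 1 0 0)
    (pi_commutation (T := T) c a)
  have h4 : (2 + 2 : ZMod 4) = 0 := by decide
  rw [← scalar_tens_comp (by simp) _ (by simp), ← scalar_tens_comp (by simp) _ (by simp),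
    comp_scalar_tens (by simp) _ (by simp), comp_scalar_tens (by simp) _ (by simp), comp_assoc,
    sp_comp_assoc, h4, sp_one, id_comp (by simp), sp_comp, add_zero, ← inn] at h
  exact IsInv.left (h ▸ (isInv_inn_zero_zero c).tens (isInv_inn_zero c a))

theorem had_state (c : Colour) (a : ZMod 4) : (sp c 0 1 a ⨾ had : Q T) = sp c.other 0 1 a := by
  have h := had_sp (T := T) c.other 0 1 a
  rw [pw_zero, id_comp (by simp), Colour.other_other, pw_one] at h
  exact h.symm

theorem had_effect (c : Colour) (a : ZMod 4) : (had ⨾ sp c 1 0 a : Q T) = sp c.other 1 0 a := by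
  have h := had_sp (T := T) c 1 0 a
  rwa [pw_zero, comp_id (by simp), pw_one] at h

/-- Between a state and an effect of colour `c`, the Hadamard side of the Euler rule becomes a
product of three copies of `inn c 0 0`. -/
theorem isInv_inn_neg (c : Colour) : IsInv (inn c (-1) (-1) : Q T) := by
  have h := congrArg (fun x => sp c 0 1 0 ⨾ x ⨾ sp c 1 0 0) (euler (T := T) c)
  rw [← tens_assoc, ← scalar_tens_comp (by simp) _ (by simp), ← scalar_tens_comp (by simp) _ (by simp),
    comp_scalar_tens (by simp) _ (by simp), comp_scalar_tens (by simp) _ (by simp), ← comp_assoc _ had,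
    had_state, ← inn] at h
  exact IsInv.left (h ▸ ((isInv_inn_zero_zero c).tens (isInv_inn_zero_zero c)).tens
    (isInv_inn_zero_zero c))

end Q

end ZX

end

/-! ### Crossings, and the calculus modulo invertible scalars: Hopf law and Euler decompositions -/

noncomputable section

namespace ZX

open Diag

namespace Q

section General

variable {T : Theory}

theorem reassoc {a b c : Q T} (h : a ⨾ b = c) (x : Q T) : a ⨾ b ⨾ x = c ⨾ x := by
  rw [← comp_assoc, h]

theorem exch {a b : Q T} {m m' n n' : ℕ} (h1 : a.dom = m) (h2 : a.cod = m') (h3 : b.dom = n)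
    (h4 : b.cod = n') : (id m ⊠ b) ⨾ (a ⊠ id n') = (a ⊠ id n) ⨾ (id m' ⊠ b) := by
  rw [left_right h2 h3, right_left h1 h4]

theorem sw_two_one : (sw 2 1 : Q T) = id 1 ⊠ sw 1 1 ⨾ sw 1 1 ⊠ id 1 := add_sw 1 1 1

theorem sw_one_two : (sw 1 2 : Q T) = sw 1 1 ⊠ id 1 ⨾ id 1 ⊠ sw 1 1 := sw_add 1 1 1

/-- A cap slides through a crossing. -/
theorem sw_cap_left : (id 1 ⊠ sw 1 1 ⨾ cap ⊠ id 1 : Q T) = sw 1 1 ⊠ id 1 ⨾ id 1 ⊠ cap := by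
  have h := tens_sw (a := (cap : Q T)) (b := id 1) (n := 2) (m := 0) (n' := 1) (m' := 1)
    (by simp) (by simp) (by simp) (by simp)
  rw [zero_sw, comp_id (by simp), sw_two_one, comp_assoc] at h
  rw [h, ← comp_assoc, ← comp_assoc, ← id_tens_comp (by simp), sw_sw, id_tens_id, id_comp (by simp)]

theorem sw_cup_left : (id 1 ⊠ cup ⨾ sw 1 1 ⊠ id 1 : Q T) = cup ⊠ id 1 ⨾ id 1 ⊠ sw 1 1 := by
  have h := tens_sw (a := id 1) (b := (cup : Q T)) (n := 1) (m := 1) (n' := 0) (m' := 2)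
    (by simp) (by simp) (by simp) (by simp)
  rw [sw_zero, id_comp (by simp), sw_one_two, ← comp_assoc] at h
  rw [← h, comp_assoc, ← id_tens_comp (by simp), sw_sw, id_tens_id, comp_id (by simp)]

/-- A crossed zigzag is a crossing. -/
theorem cup_sw_cap : (id 2 ⊠ cup ⨾ id 1 ⊠ sw 1 1 ⊠ id 1 ⨾ cap ⊠ id 2 : Q T) = sw 1 1 := by
  have h := congrArg (fun x => id 1 ⊠ x) (sw_cup_left (T := T))
  rw [id_tens_comp (by simp), id_tens_comp (by simp), id_tens_id_tens, id_tens_id_tens] at h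
  rw [reassoc h, comp_assoc]
  have h2 := exch (a := (cap : Q T)) (b := sw 1 1) (m := 2) (m' := 0) (n := 2) (n' := 2)
    (by simp) (by simp) (by simp) (by simp)
  rw [id_zero_tens] at h2
  rw [h2]
  have h3 := congrArg (fun x => x ⊠ id 1) (snake_left (T := T))
  rw [comp_tens_id (by simp), tens_assoc, tens_assoc, id_tens_id] at h3
  rw [reassoc h3, id_comp (by simp)]

end General

section Spiders

variable {T : Theory}

theorem sp_sw (c : Colour) (n : ℕ) (a : ZMod 4) : (sp c n 2 a ⨾ sw 1 1 : Q T) = sp c n 2 a := by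
  simpa using sp_swap (T := T) c n 0 0 a

theorem sw_sp (c : Colour) (n : ℕ) (a : ZMod 4) : (sw 1 1 ⨾ sp c 2 n a : Q T) = sp c 2 n a := by
  simpa using swap_sp (T := T) c 0 0 n a

theorem sp_two_one' (c : Colour) (a : ZMod 4) :
    (sp c 1 2 a ⊠ id 1 ⨾ id 1 ⊠ cap : Q T) = sp c 2 1 a := bend_output c 1 1 a

variable [StabTheory T]

/-- Bending the first input of a spider. -/
theorem sp_two_one (c : Colour) (a : ZMod 4) :
    (id 1 ⊠ sp c 1 2 a ⨾ cap ⊠ id 1 : Q T) = sp c 2 1 a := by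
  rw [← sp_cap c]
  simpa using sp_fuse' (T := T) c 0 1 1 1 0 a

theorem had_sp_two (c : Colour) (a : ZMod 4) :
    (had ⨾ sp c 1 2 a : Q T) = sp c.other 1 2 a ⨾ had ⊠ had := by
  simpa [pw_two] using had_sp (T := T) c 1 2 a

theorem two_had_sp (c : Colour) (a : ZMod 4) :
    (had ⊠ had ⨾ sp c 2 1 a : Q T) = sp c.other 2 1 a ⨾ had := by
  simpa [pw_two] using had_sp (T := T) c 2 1 a

end Spiders

/-! ### Calculus modulo invertible scalars -/

local notation "M" => Q modThy

/-- The inverse is a priori any element of the quotient. It is the class of an actual scalar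
diagram, because a product with a formal element is never a diagram. -/
theorem mk_eq_id_of_isInv {D : Diag 0 0} (h : IsInv (mk stabThy D)) : mk modThy D = id 0 := by
  obtain ⟨t, ht⟩ := h
  have h1 := congrArg dom ht
  have h2 := congrArg cod ht
  simp only [dom_tens, cod_tens, dom_mk, cod_mk, dom_id, cod_id, zero_add] at h1 h2
  revert ht h1 h2
  refine ind (fun {n m} E => ?_) (fun n m => ?_) t
  · intro ht h1 h2
    simp only [dom_mk, cod_mk] at h1 h2
    subst h1 h2
    exact mk_eq_iff.2 (.of (ModAx.unit D E (mk_eq_iff.1 ht)))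
  · intro ht
    rw [tens_junk] at ht
    exact (Quotient.exact ht : Raw.Rel _ _ _).elim

theorem inn_eq_id {c : Colour} {a b : ZMod 4} (h : IsInv (inn c a b : Q stabThy)) :
    (inn c a b : M) = id 0 := by
  rw [inn, sp, sp, ← mk_seq] at h ⊢
  exact mk_eq_id_of_isInv h

theorem inn_zero (c : Colour) (a : ZMod 4) : (inn c a 0 : M) = id 0 := inn_eq_id (isInv_inn_zero c a)

theorem inn_two (c : Colour) (a : ZMod 4) : (inn c a 2 : M) = id 0 := inn_eq_id (isInv_inn_two c a)

theorem star_eq_id : (star : M) = id 0 := mk_eq_id_of_isInv isInv_star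

theorem sp_zero_eq_id (c : Colour) : (sp c 0 0 0 : M) = id 0 := mk_eq_id_of_isInv (isInv_sp c)

theorem state_effect (c : Colour) (a : ZMod 4) : (sp c.other 0 1 0 ⨾ sp c 1 0 a : M) = id 0 :=
  inn_zero c a

theorem state_two_effect (c : Colour) (a : ZMod 4) : (sp c.other 0 1 2 ⨾ sp c 1 0 a : M) = id 0 :=
  inn_two c a

theorem state_copy (c : Colour) :
    (sp c.other 0 1 0 ⨾ sp c 1 2 0 : M) = sp c.other 0 1 0 ⊠ sp c.other 0 1 0 := by
  have h := copy (T := modThy) c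
  rwa [inn_zero, id_zero_tens] at h

theorem effect_copy (c : Colour) :
    (sp c 2 1 0 ⨾ sp c.other 1 0 0 : M) = sp c.other 1 0 0 ⊠ sp c.other 1 0 0 := by
  have h := copy_flip (T := modThy) c
  have h' := inn_zero c.other 0
  rw [inn, Colour.other_other] at h'
  rwa [h', id_zero_tens] at h

/-- The π state is a π shift applied to the phase-0 state, and the shift passes through the copy. -/
theorem state_copy_two (c : Colour) :
    (sp c.other 0 1 2 ⨾ sp c 1 2 0 : M) = sp c.other 0 1 2 ⊠ sp c.other 0 1 2 := by
  have h : (sp c.other 0 1 2 : M) = sp c.other 0 1 0 ⨾ sp c.other 1 1 2 := by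
    rw [sp_comp, zero_add]
  have h2 := pi_copy (T := modThy) c.other 2
  rw [Colour.other_other, pw_two] at h2
  rw [h, comp_assoc, h2, ← comp_assoc, state_copy, comp_tens_comp (by simp) (by simp)]

theorem effect_copy_two (c : Colour) :
    (sp c 2 1 0 ⨾ sp c.other 1 0 2 : M) = sp c.other 1 0 2 ⊠ sp c.other 1 0 2 := by
  have h : (sp c.other 1 0 2 : M) = sp c.other 1 1 2 ⨾ sp c.other 1 0 0 := by
    rw [sp_comp, add_zero]
  have h2 := pi_copy_flip (T := modThy) c.other
  rw [Colour.other_other] at h2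
  rw [h, ← comp_assoc, h2, comp_assoc, effect_copy, comp_tens_comp (by simp) (by simp)]

/-- View the phase shift as a phase effect on a spare leg of a copy. The state is copied, and the
part meeting the effect is an invertible scalar. -/
theorem state_phase (c : Colour) (a : ZMod 4) :
    (sp c.other 0 1 0 ⨾ sp c 1 1 a : M) = sp c.other 0 1 0 := by
  have h := fuse_right (T := modThy) c 1 1 0 0 a
  norm_num at h
  rw [← h, ← comp_assoc, state_copy, ← left_right (m := 1) (n := 0) (by simp) (by simp), comp_assoc,
    ← id_tens_comp (by simp), state_effect]
  simp [comp_id]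

theorem phase_effect (c : Colour) (a : ZMod 4) :
    (sp c 1 1 a ⨾ sp c.other 1 0 0 : M) = sp c.other 1 0 0 := by
  have h := fuse_in_right (T := modThy) c 1 1 0 0 a
  norm_num at h
  have h' := inn_zero c a
  rw [inn_symm, inn, Colour.other_other] at h'
  rw [← h, comp_assoc, effect_copy, ← comp_tens_comp (by simp) (by simp), h', id_comp (by simp),
    tens_id_zero]

/-- A state of the other colour at one input of a spider cuts it. -/
theorem sp_state_cut (c : Colour) :
    (id 1 ⊠ sp c 0 1 0 ⨾ sp c.other 2 1 0 : M) = sp c 1 0 0 ⊠ sp c 0 1 0 := by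
  have h := state_copy c.other
  rw [Colour.other_other] at h
  rw [← sp_two_one, ← comp_assoc, ← id_tens_comp (by simp), h, ← tens_assoc,
    ← comp_tens_comp (by simp) (by simp), sp_state_cap, comp_id (by simp)]

theorem bialg (c : Colour) :
    (sp c 1 2 0 ⊠ sp c 1 2 0 ⨾ id 1 ⊠ sw 1 1 ⊠ id 1 ⨾ sp c.other 2 1 0 ⊠ sp c.other 2 1 0 : M) =
      sp c.other 2 1 0 ⨾ sp c 1 2 0 := by
  have h := bialgebra (T := modThy) c
  rwa [inn_zero, id_zero_tens] at h

/-- The Hopf law. -/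
theorem hopf (c : Colour) :
    (sp c 1 2 0 ⨾ sp c.other 2 1 0 : M) = sp c 1 0 0 ⊠ sp c.other 0 1 0 := by
  -- The state turns one copy into a cup and the effect turns one merge into a cap. These straighten
  -- to a double connection on one side, while the other side falls apart.
  have h := congrArg (fun x => id 1 ⊠ sp c 0 1 0 ⨾ x ⨾ sp c.other 1 0 0 ⊠ id 1) (bialg c)
  have h1 : (sp c 0 1 0 ⨾ sp c 1 2 0 : M) = cup := by rw [sp_comp, add_zero, sp_cup]
  have h2 : (sp c.other 2 1 0 ⨾ sp c.other 1 0 0 : M) = cap := by rw [sp_comp, add_zero, sp_cap]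
  have h3 : (id 1 ⊠ sp c 0 1 0 ⨾ sp c 1 2 0 ⊠ sp c 1 2 0 : M) = sp c 1 2 0 ⨾ id 2 ⊠ cup := by
    rw [← comp_tens_comp (by simp) (by simp), h1, id_comp (by simp),
      ← left_right (a := sp c 1 2 0) (b := cup) (m := 2) (n := 0) (by simp) (by simp),
      tens_id_zero]
  have h4 : (sp c.other 2 1 0 ⊠ sp c.other 2 1 0 ⨾ sp c.other 1 0 0 ⊠ id 1 : M) =
      cap ⊠ id 2 ⨾ sp c.other 2 1 0 := by
    rw [← comp_tens_comp (by simp) (by simp), h2, comp_id (by simp),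
      ← left_right (a := cap) (b := sp c.other 2 1 0) (m := 0) (n := 2) (by simp) (by simp),
      id_zero_tens]
  simp only [comp_assoc] at h
  rw [h4, reassoc h3, comp_assoc, reassoc (sp_state_cut c)] at h
  have h5 : (id 2 ⊠ cup ⨾ id 1 ⊠ sw 1 1 ⊠ id 1 ⨾ cap ⊠ id 2 ⨾ sp c.other 2 1 0 : M) =
      sp c.other 2 1 0 := by
    have := reassoc (cup_sw_cap (T := modThy)) (sp c.other 2 1 0)
    rw [comp_assoc, sw_sp] at this
    simpa only [comp_assoc] using this
  rw [h5] at h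
  rw [h, ← left_right (a := sp c 1 0 0) (b := sp c 0 1 0) (m := 0) (n := 0) (by simp) (by simp),
    tens_id_zero, id_zero_tens, comp_assoc, reassoc h1, cup_effect_sp, 
    ← left_right (a := sp c 1 0 0) (b := sp c.other 0 1 0) (m := 0) (n := 0) (by simp) (by simp),
    tens_id_zero, id_zero_tens]

/-! ### Euler decompositions -/

theorem had_eq (c : Colour) : (had : M) = sp c 1 1 1 ⨾ sp c.other 1 1 1 ⨾ sp c 1 1 1 := by
  have h := euler (T := modThy) c
  rwa [inn_eq_id (isInv_inn_neg c), inn_zero, id_zero_tens, id_zero_tens, id_zero_tens] at h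

/-- The Hadamard node is its own inverse, and inverting its Euler decomposition negates all phases.
-/
theorem had_eq_neg (c : Colour) :
    (had : M) = sp c 1 1 (-1) ⨾ sp c.other 1 1 (-1) ⨾ sp c 1 1 (-1) := by
  have h : (had ⨾ sp c 1 1 (-1) ⨾ sp c.other 1 1 (-1) ⨾ sp c 1 1 (-1) : M) = id 1 := by
    rw [had_eq c, comp_assoc, comp_assoc, sp_comp_assoc, add_neg_cancel, sp_one, id_comp (by simp),
      sp_comp_assoc, add_neg_cancel, sp_one, id_comp (by simp), sp_comp, add_neg_cancel, sp_one]
  rw [← had_had_assoc (sp c 1 1 (-1) ⨾ _) (by simp), h, comp_id (by simp)]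

/-- Apply the Euler decomposition beginning with the other colour to a state of colour `c`: the
first phase is absorbed and the last one can be moved to the other side. -/
theorem state_one (c : Colour) : (sp c 0 1 1 : M) = sp c.other 0 1 (-1) := by
  have h := had_state (T := modThy) c 0
  have h' := state_phase c.other 1
  rw [Colour.other_other] at h'
  rw [had_eq c.other, Colour.other_other, reassoc h', sp_comp_assoc, zero_add] at h
  have h2 := congrArg (· ⨾ sp c.other 1 1 (-1)) h
  rwa [comp_assoc, sp_comp, sp_comp, add_neg_cancel, sp_one, comp_id (by simp), zero_add] at h2

theorem effect_one (c : Colour) : (sp c 1 0 1 : M) = sp c.other 1 0 (-1) := by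
  rw [← sp_state_cap, ← sp_state_cap, state_one]

/-- The scalar has value 1 + i. An Euler decomposition inserted in it turns it into an inner product
with one phase π, which is invertible. -/
theorem effect_two (c : Colour) : (sp c 0 0 1 : M) = id 0 := by
  have h : (sp c.other 0 0 1 : M) = sp c 0 1 0 ⨾ had ⨾ sp c.other 1 0 1 := by
    rw [← comp_assoc, had_state, sp_comp, zero_add]
  rw [sp_zero_zero c c.other, h, had_eq c.other, Colour.other_other]
  have h' := state_phase c.other 1
  rw [Colour.other_other] at h'
  rw [comp_assoc, comp_assoc, reassoc h', sp_comp, sp_comp_assoc, zero_add]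
  have h2 := inn_two c 1
  rw [inn_symm, inn, Colour.other_other] at h2
  exact h2

end Q

end ZX

end

/-! ### Controlled Pauli operators and the Clifford action on Pauli strings -/

noncomputable section

namespace ZX

open Diag

namespace Q

local notation "M" => Q modThy

set_option linter.unusedSimpArgs false

/-! ### Self-loops -/

theorem hopf_green :
    (sp .green 1 2 0 ⨾ sp .red 2 1 0 : M) = sp .green 1 0 0 ⊠ sp .red 0 1 0 := hopf .green

theorem hopf_red :
    (sp .red 1 2 0 ⨾ sp .green 2 1 0 : M) = sp .red 1 0 0 ⊠ sp .green 0 1 0 := hopf .red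

theorem had_eq_green :
    (had : M) = sp .green 1 1 1 ⨾ sp .red 1 1 1 ⨾ sp .green 1 1 1 := had_eq .green

/-- In the Euler decomposition of the Hadamard edge, the two green phases fuse into the spider and
contribute π/2 each. The Hopf law disconnects the red phase in between, which leaves the invertible
scalar 1 + i. -/
theorem had_loop : (sp .green 1 2 0 ⨾ id 1 ⊠ had ⨾ sp .green 2 1 0 : M) = sp .green 1 1 2 := by
  have h1 := fuse_right (T := modThy) .green 1 1 1 0 1
  have h2 := fuse_in_right (T := modThy) .green 1 1 1 0 1
  have h3 := fuse_left (T := modThy) .green 1 1 2 1 1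
  have h4 := fuse_right (T := modThy) .green 1 1 2 2 0
  have h5 := fuse_in_right (T := modThy) .red 0 1 1 0 1
  have h6 := fuse_right (T := modThy) .green 1 1 0 2 0
  have h7 := exch (T := modThy) (a := sp .green 1 2 1) (b := sp .red 1 1 1) (m := 1) (m' := 2)
    (n := 1) (n' := 1) (by simp) (by simp) (by simp) (by simp)
  norm_num [sp_cap] at h1 h2 h3 h4 h5 h6
  have h8 : (sp .green 1 2 0 ⨾ sp .red 2 0 1 : M) = sp .green 1 0 0 := by
    have h := sp_comp (T := modThy) .red 2 0 0 1
    rw [zero_add] at h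
    rw [← h, reassoc hopf_green,
      ← left_right (a := sp .green 1 0 0) (b := sp .red 0 1 0) (m := 0) (n := 0) (by simp) (by simp),
      tens_id_zero, id_zero_tens, comp_assoc]
    have h' := sp_comp (T := modThy) .red 0 0 0 1
    rw [zero_add] at h'
    rw [h', effect_two, comp_id (by simp)]
  rw [had_eq_green, id_tens_comp (by simp), id_tens_comp (by simp), comp_assoc, comp_assoc,
    reassoc h1, h2, ← sp_two_one', reassoc h7, comp_assoc,
    reassoc h3]
  have h9 : (id 2 ⊠ sp .red 1 1 1 ⨾ id 1 ⊠ cap : M) = id 1 ⊠ sp .red 2 0 1 := by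
    rw [← h5, id_tens_comp (by simp), id_tens_id_tens]
  rw [h9, ← h4, comp_assoc, ← id_tens_comp (by simp), h8, h6]

theorem sw_had_right : (sw 1 1 ⨾ had ⊠ id 1 : M) = id 1 ⊠ had ⨾ sw 1 1 :=
  (tens_sw (a := id 1) (b := had) (by simp) (by simp) (by simp) (by simp)).symm

theorem had_triangle : (sp .green 1 2 0 ⨾ id 1 ⊠ had ⨾ sp .red 2 1 0 : M) = sp .green 1 1 2 ⨾ had := by
  have h := two_had_sp (T := modThy) .green 0
  have h' : (sp .red 2 1 0 : M) = had ⊠ had ⨾ sp .green 2 1 0 ⨾ had := by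
    rw [reassoc h, comp_assoc, had_had, comp_id (by simp)]; rfl
  have h2 : (id 1 ⊠ had ⨾ had ⊠ had : M) = had ⊠ id 1 := by
    rw [← comp_tens_comp (by simp) (by simp), had_had, id_comp (by simp)]
  have h3 : (sp .green 1 2 0 ⨾ had ⊠ id 1 : M) = sp .green 1 2 0 ⨾ id 1 ⊠ had ⨾ sw 1 1 := by
    rw [← sw_had_right, reassoc (sp_sw _ _ _)]
  rw [h', reassoc h2, reassoc h3, comp_assoc, comp_assoc, reassoc (sw_sp _ _ _), ← had_loop,
    comp_assoc, comp_assoc]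

/-! ### Actions of a control wire on a qubit -/

/-- A control wire acts on two qubits, first through `a` and then through `b`. -/
def act₂ (a b : M) : M :=
  sp .green 1 2 0 ⊠ id 2 ⨾ id 1 ⊠ a ⊠ id 1 ⨾ sw 1 1 ⊠ id 1 ⨾ id 1 ⊠ b

/-- A control wire acts twice on a qubit. -/
def conv (a b : M) : M := sp .green 1 2 0 ⊠ id 1 ⨾ id 1 ⊠ a ⨾ b

/-- The controlled action, with the control wire passing from the left to the right. -/
def weave (a : M) : M := sp .green 1 2 0 ⊠ id 1 ⨾ id 1 ⊠ a ⨾ sw 1 1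

/-- The left input is the control: in the state |1⟩ it applies X to the qubit, in the state |0⟩
nothing. -/
def actX : M := sp .red 2 1 0

/-- The left input is again the control. The Hadamard node makes a control in the state |1⟩ act by
Z. -/
def actZ : M := had ⊠ id 1 ⨾ sp .green 2 1 0

@[simp] theorem dom_act₂ (a b : M) : (act₂ a b).dom = 3 := by simp [act₂]
@[simp] theorem cod_act₂ (a b : M) : (act₂ a b).cod = 1 + b.cod := by simp [act₂]
@[simp] theorem dom_conv (a b : M) : (conv a b).dom = 2 := by simp [conv]
@[simp] theorem cod_conv (a b : M) : (conv a b).cod = b.cod := by simp [conv]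
@[simp] theorem dom_weave (a : M) : (weave a).dom = 2 := by simp [weave]
@[simp] theorem cod_weave (a : M) : (weave a).cod = 2 := by simp [weave]
@[simp] theorem dom_actX : actX.dom = 2 := by simp [actX]
@[simp] theorem cod_actX : actX.cod = 1 := by simp [actX]
@[simp] theorem dom_actZ : actZ.dom = 2 := by simp [actZ]
@[simp] theorem cod_actZ : actZ.cod = 1 := by simp [actZ]

/-- Moving a box past a crossing. -/
theorem box_sw {a : M} (h : a.dom = 2) (h' : a.cod = 1) :
    id 1 ⊠ a ⨾ sw 1 1 = sw 1 1 ⊠ id 1 ⨾ id 1 ⊠ sw 1 1 ⨾ a ⊠ id 1 := by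
  have e := tens_sw (a := id 1) (b := a) (n := 1) (m := 1) (n' := 2) (m' := 1)
    (by simp) (by simp) h h'
  rw [e, sw_one_two, comp_assoc]

/-- The crossing created by moving `a` across the control is absorbed by the symmetric copy. The
result has the shape of the bialgebra law. -/
theorem act₂_eq {a b : M} (ha : a.dom = 2) (ha' : a.cod = 1) (hb : b.dom = 2) :
    act₂ a b = sp .green 1 2 0 ⊠ id 2 ⨾ id 1 ⊠ sw 1 1 ⊠ id 1 ⨾ a ⊠ b := by
  have h := congrArg (fun x => x ⊠ id 1) (box_sw ha ha')
  simp only [comp_tens_id, dom_tens, cod_tens, dom_id, cod_id, dom_sw, cod_sw, ha, ha', dom_comp,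
    tens_assoc, id_tens_id, Nat.reduceAdd] at h
  have h2 : (sp .green 1 2 0 ⊠ id 2 ⨾ sw 1 1 ⊠ id 2 : M) = sp .green 1 2 0 ⊠ id 2 := by
    rw [← comp_tens_id (by simp), sp_sw]
  rw [act₂, reassoc h, comp_assoc, comp_assoc, reassoc h2, left_right ha' hb]

theorem two_effects : (sp .green 3 0 0 : M) = sp .green 1 2 0 ⊠ id 2 ⨾ id 1 ⊠ cap ⊠ id 1 ⨾ cap := by
  have h1 := fuse_in_left (T := modThy) .green 0 1 2 0 0
  have h2 := bend_output (T := modThy) .green 1 1 0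
  norm_num [sp_cap] at h1 h2
  rw [← h1, ← h2, comp_tens_id (by simp), tens_assoc, tens_assoc, id_tens_id, comp_assoc]

/-- The bialgebra law with a leg bent: controlled X passes a green merge by acting on both of its
inputs. The red merge is opened into a red copy and a cap, the bialgebra law is applied, and the
caps are slid back until they close red merges again. -/
theorem bent_bialg :
    (id 1 ⊠ sp .green 2 1 0 ⨾ sp .red 2 1 0 : M) = act₂ actX actX ⨾ sp .green 2 1 0 := by
  have hb := bialg .red
  rw [Colour.other] at hb
  have h2 : (id 1 ⊠ sp .green 2 1 0 ⊠ sp .green 2 1 0 ⨾ cap ⊠ id 1 : M) =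
      sp .green 1 2 0 ⊠ id 4 ⨾ id 1 ⊠ cap ⊠ id 3 ⨾ cap ⊠ id 2 ⨾ sp .green 2 1 0 := by
    have f := fuse_in_right (T := modThy) .green 0 1 2 0 0
    norm_num [sp_cap] at f
    rw [← tens_assoc, ← comp_tens_comp (by simp) (by simp), f, comp_id (by simp),
      ← left_right (a := sp .green 3 0 0) (b := sp .green 2 1 0) (m := 0) (n := 2) (by simp)
      (by simp), id_zero_tens, two_effects]
    simp only [comp_tens_id, dom_tens, cod_tens, dom_id, cod_id, dom_sp, cod_sp, dom_cap, cod_cap,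
      dom_comp, tens_assoc, id_tens_id, Nat.reduceAdd, comp_assoc]
  have e1 : (id 2 ⊠ sw 1 1 ⊠ id 1 ⨾ sp .green 1 2 0 ⊠ id 4 : M) =
      sp .green 1 2 0 ⊠ id 4 ⨾ id 3 ⊠ sw 1 1 ⊠ id 1 := by
    have := exch (T := modThy) (a := sp .green 1 2 0) (b := id 1 ⊠ sw 1 1 ⊠ id 1) (m := 1) (m' := 2)
      (n := 4) (n' := 4) (by simp) (by simp) (by simp) (by simp)
    simpa only [id_tens_id_tens, Nat.reduceAdd] using this
  have e2 := exch (T := modThy) (a := sp .green 1 2 0) (b := sp .red 1 2 0 ⊠ sp .red 1 2 0) (m := 1)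
    (m' := 2) (n := 2) (n' := 4) (by simp) (by simp) (by simp) (by simp)
  have e3 : (id 3 ⊠ sw 1 1 ⊠ id 1 ⨾ id 1 ⊠ cap ⊠ id 3 : M) =
      id 1 ⊠ cap ⊠ id 3 ⨾ id 1 ⊠ sw 1 1 ⊠ id 1 := by
    have := exch (T := modThy) (a := id 1 ⊠ cap) (b := sw 1 1 ⊠ id 1) (m := 3) (m' := 1)
      (n := 3) (n' := 3) (by simp) (by simp) (by simp) (by simp)
    simpa only [tens_assoc] using this
  have e4 : (id 2 ⊠ sp .red 1 2 0 ⊠ sp .red 1 2 0 ⨾ id 1 ⊠ cap ⊠ id 3 : M) =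
      id 1 ⊠ sp .red 2 1 0 ⊠ id 1 ⨾ id 2 ⊠ sp .red 1 2 0 := by
    have h : (id 2 ⊠ sp .red 1 2 0 ⊠ sp .red 1 2 0 : M) =
        (id 1 ⊠ id 1 ⊠ sp .red 1 2 0) ⊠ sp .red 1 2 0 := by
      simp only [id_tens_id_tens, tens_assoc, Nat.reduceAdd]
    have h' : (id 1 ⊠ cap ⊠ id 3 : M) = (id 1 ⊠ cap ⊠ id 1) ⊠ id 2 := by
      simp only [id_tens_id, tens_assoc, Nat.reduceAdd]
    rw [h, h', ← comp_tens_comp (by simp) (by simp), ← id_tens_comp (by simp), sp_two_one,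
      comp_id (by simp), ← left_right (a := id 1 ⊠ sp .red 2 1 0) (b := sp .red 1 2 0) (m := 2)
      (n := 1) (by simp) (by simp), tens_assoc]
  have e5 : (id 1 ⊠ sw 1 1 ⊠ id 1 ⨾ cap ⊠ id 2 : M) = sw 1 1 ⊠ id 2 ⨾ id 1 ⊠ cap ⊠ id 1 := by
    have := congrArg (fun x => x ⊠ id 1) (sw_cap_left (T := modThy))
    simpa only [comp_tens_id, dom_tens, cod_tens, dom_id, cod_id, dom_sw, cod_sw, dom_cap, cod_cap,
      tens_assoc, id_tens_id, Nat.reduceAdd] using this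
  have e6 := exch (T := modThy) (a := sw 1 1) (b := sp .red 1 2 0) (m := 2) (m' := 2)
    (n := 1) (n' := 2) (by simp) (by simp) (by simp) (by simp)
  have e7 : (id 2 ⊠ sp .red 1 2 0 ⨾ id 1 ⊠ cap ⊠ id 1 : M) = id 1 ⊠ sp .red 2 1 0 := by
    rw [← sp_two_one, id_tens_comp (by simp), id_tens_id_tens]
  rw [← sp_two_one .red, ← comp_assoc, ← id_tens_comp (by simp), ← hb, id_tens_comp (by simp),
    id_tens_comp (by simp), id_tens_id_tens, comp_assoc, comp_assoc, h2, reassoc e1, comp_assoc,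
    reassoc e2, comp_assoc, reassoc e3, comp_assoc, reassoc e4, comp_assoc, reassoc e5, comp_assoc,
    reassoc e6, comp_assoc, reassoc e7, act₂, actX]
  simp only [comp_assoc]

theorem bialg_act₂ :
    (actX ⨾ sp .green 1 2 0 : M) = id 1 ⊠ sp .green 1 2 0 ⨾ act₂ actX actX := by
  rw [act₂_eq (by simp) (by simp) (by simp), ← comp_assoc, 
    right_left (a := sp .green 1 2 0) (b := sp .green 1 2 0) (by simp) (by simp), actX]
  exact (bialg .green).symm

/-! ### Composing actions -/

/-- X² = 1: the two red spiders fuse, so that the control is doubly connected to a spider of the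
other colour, and the Hopf law disconnects it. -/
theorem conv_actX_actX : conv actX actX = sp .green 1 0 0 ⊠ id 1 := by
  have f1 := fuse_in_right (T := modThy) .red 1 1 2 0 0
  have f2 := fuse_in_left (T := modThy) .red 1 1 2 0 0
  have f3 := fuse_in_left (T := modThy) .red 1 1 0 0 0
  norm_num at f1 f2 f3
  rw [conv, actX, f1, ← f2, ← comp_assoc, ← comp_tens_id (by simp), hopf_green,
    ← left_right (a := sp .green 1 0 0) (b := sp .red 0 1 0) (m := 0) (n := 0) (by simp) (by simp),
    tens_id_zero, id_zero_tens, comp_tens_id (by simp), comp_assoc, f3, comp_id (by simp)]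

theorem conv_actZ_actZ : conv actZ actZ = sp .green 1 0 0 ⊠ id 1 := by
  have f1 := fuse_in_right (T := modThy) .green 1 1 2 0 0
  have f2 := fuse_in_left (T := modThy) .green 1 1 2 0 0
  have f3 := fuse_in_left (T := modThy) .green 1 1 0 0 0
  norm_num at f1 f2 f3
  have h1 : (id 1 ⊠ sp .green 2 1 0 ⨾ had ⊠ id 1 : M) = had ⊠ id 2 ⨾ id 1 ⊠ sp .green 2 1 0 :=
    exch (by simp) (by simp) (by simp) (by simp)
  have h2 : (id 1 ⊠ had ⊠ id 1 ⨾ had ⊠ id 2 : M) = (had ⊠ had) ⊠ id 1 := by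
    rw [← right_left (a := had) (b := had) (m := 1) (n := 1) (by simp) (by simp),
      comp_tens_id (by simp), tens_assoc, tens_assoc, id_tens_id]
  have h3 : (sp .green 1 2 0 ⨾ had ⊠ had : M) = had ⨾ sp .red 1 2 0 := (had_sp_two .red 0).symm
  have h4 := had_effect (T := modThy) .red 0
  rw [conv, actZ, id_tens_comp (by simp), comp_assoc, reassoc h1, comp_assoc, reassoc h2, f1, ← f2,
    ← comp_assoc, ← comp_assoc, ← comp_tens_id (by simp), ← comp_tens_id (by simp), h3, comp_assoc,
    hopf_red,
    ← left_right (a := sp .red 1 0 0) (b := sp .green 0 1 0) (m := 0) (n := 0) (by simp) (by simp),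
    tens_id_zero, id_zero_tens, ← comp_assoc, h4, comp_tens_id (by simp), comp_assoc, f3,
    comp_id (by simp)]
  rfl

/-- Anticommutation of X and Z, the sign being a phase π on the control. Moving X through the merge
that performs Z connects the control to itself by a Hadamard edge, and `had_triangle` turns this
edge into π. -/
theorem conv_actZ_actX :
    conv actZ actX = sp .green 1 1 2 ⊠ id 1 ⨾ conv actX actZ := by
  have e1 : (id 1 ⊠ had ⊠ id 1 ⨾ sp .green 1 2 0 ⊠ id 2 : M) =
      sp .green 1 2 0 ⊠ id 2 ⨾ id 2 ⊠ had ⊠ id 1 :=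
    exch (by simp) (by simp) (by simp) (by simp)
  have f1 := fuse_left (T := modThy) .green 1 1 2 0 0
  have f2 := fuse_right (T := modThy) .green 1 1 2 0 0
  have f3 := fuse_right (T := modThy) .green 1 1 1 0 2
  have f4 := fuse_left (T := modThy) .green 1 1 1 0 2
  norm_num at f1 f2 f3 f4
  have h1 : (sp .green 1 3 0 ⨾ id 2 ⊠ had ⨾ id 1 ⊠ sp .red 2 1 0 ⨾ sw 1 1 : M) =
      sp .green 1 1 2 ⨾ sp .green 1 2 0 ⨾ had ⊠ id 1 := by
    have t := congrArg (fun x => id 1 ⊠ x) had_triangle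
    simp only [id_tens_comp, dom_id, cod_id, dom_sp, cod_sp, dom_had, cod_had, dom_comp, dom_tens,
      cod_tens, id_tens_id_tens, Nat.reduceAdd] at t
    have t' := reassoc t (sw 1 1)
    rw [comp_assoc, comp_assoc] at t'
    rw [← f2, comp_assoc, t', reassoc f3, ← sw_had_right, reassoc (sp_sw _ _ _),
      sp_comp_assoc, add_zero]
  have h1' := congrArg (fun x => x ⊠ id 1) h1
  simp only [comp_tens_id, dom_tens, cod_tens, dom_id, cod_id, dom_sp, cod_sp, dom_sw, cod_sw,
    dom_had, cod_had, dom_comp, tens_assoc, id_tens_id, Nat.reduceAdd] at h1'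
  have h2 : (sp .green 1 2 0 ⊠ id 1 ⨾ sp .green 1 2 0 ⊠ id 2 : M) = sp .green 1 3 0 ⊠ id 1 := by
    rw [← f1, comp_tens_id (by simp), tens_assoc, id_tens_id]
  have e2 : (had ⊠ id 2 ⨾ id 1 ⊠ sp .red 2 1 0 : M) = id 1 ⊠ sp .red 2 1 0 ⨾ had ⊠ id 1 :=
    (exch (by simp) (by simp) (by simp) (by simp)).symm
  have h3 : conv actZ actX = (sp .green 1 3 0 ⊠ id 1 ⨾ id 2 ⊠ had ⊠ id 1 ⨾
      id 1 ⊠ sp .red 2 1 0 ⊠ id 1 ⨾ sw 1 1 ⊠ id 1) ⨾ id 1 ⊠ sp .red 2 1 0 ⨾ sp .green 2 1 0 := by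
    have := bent_bialg
    rw [act₂, actX] at this
    rw [conv, actZ, actX, id_tens_comp (by simp), comp_assoc, this]
    simp only [comp_assoc]
    rw [reassoc e1, comp_assoc, reassoc h2]
  rw [h3, h1', conv, actX, actZ]
  simp only [comp_assoc]
  rw [reassoc e2, comp_assoc]

/-! ### The phase gate and actions -/

theorem red_neg_one : (sp .red 1 1 (-1) : M) = sp .green 1 1 1 ⨾ had ⨾ sp .green 1 1 1 := by
  have h : (had : M) = sp .green 1 1 (-1) ⨾ sp .red 1 1 (-1) ⨾ sp .green 1 1 (-1) :=
    had_eq_neg .green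
  rw [h, comp_assoc, comp_assoc, sp_comp_assoc, add_neg_cancel, sp_one, id_comp (by simp), sp_comp,
    neg_add_cancel, sp_one, comp_id (by simp)]

/-- In terms of bits, i^(x ⊕ y) = i^x i^y (-1)^(xy), up to scalars. The green effect is also a red
one, which fuses with the merge; the red phase then expands into two green phases and a Hadamard
edge. -/
theorem gadget : (sp .red 2 1 0 ⨾ sp .green 1 0 1 : M) =
    sp .green 1 1 1 ⊠ sp .green 1 1 1 ⨾ had ⊠ id 1 ⨾ cap := by
  have f1 := fuse_in_right (T := modThy) .red 0 1 1 0 (-1)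
  have f2 := fuse_in_right (T := modThy) .green 0 1 1 0 1
  have f3 := fuse_in_left (T := modThy) .green 0 1 1 0 1
  norm_num [sp_cap] at f1 f2 f3
  have f4 : (sp .green 1 0 1 : M) = sp .red 1 0 (-1) := effect_one .green
  have e1 : (id 1 ⊠ had ⨾ sp .green 1 1 1 ⊠ id 1 : M) = sp .green 1 1 1 ⊠ id 1 ⨾ id 1 ⊠ had :=
    exch (by simp) (by simp) (by simp) (by simp)
  rw [f4, sp_comp, zero_add, ← f1, red_neg_one, id_tens_comp (by simp), id_tens_comp (by simp),
    comp_assoc, comp_assoc, f2, ← f3, reassoc e1, ← comp_assoc, ← comp_assoc,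
    right_left (a := sp .green 1 1 1) (b := sp .green 1 1 1) (by simp) (by simp), comp_assoc,
    ← had_cap]

theorem sw_cap_left' :
    (id 1 ⊠ sw 1 1 ⊠ id 1 ⨾ cap ⊠ id 2 : M) = sw 1 1 ⊠ id 2 ⨾ id 1 ⊠ cap ⊠ id 1 := by
  have := congrArg (fun x => x ⊠ id 1) (sw_cap_left (T := modThy))
  simpa only [comp_tens_id, dom_tens, cod_tens, dom_id, cod_id, dom_sw, cod_sw, dom_cap, cod_cap,
    tens_assoc, id_tens_id, Nat.reduceAdd] using this

/-- Presents the action as copies of both wires, one pair joined by a Hadamard edge and the other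
merged, which is what the bialgebra law and `gadget` produce in `actX_phase`. -/
theorem conv_actZ_actX_eq : conv actZ actX =
    sp .green 1 2 0 ⊠ sp .green 1 2 0 ⨾ id 1 ⊠ sw 1 1 ⊠ id 1 ⨾ had ⊠ id 3 ⨾ cap ⊠ id 2 ⨾
      sp .red 2 1 0 := by
  have e1 : (id 1 ⊠ sw 1 1 ⊠ id 1 ⨾ had ⊠ id 3 : M) = had ⊠ id 3 ⨾ id 1 ⊠ sw 1 1 ⊠ id 1 :=
    exch (by simp) (by simp) (by simp) (by simp)
  have h1 : (sp .green 1 2 0 ⨾ had ⊠ id 1 ⨾ sw 1 1 : M) = sp .green 1 2 0 ⨾ id 1 ⊠ had := by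
    have : (had ⊠ id 1 ⨾ sw 1 1 : M) = sw 1 1 ⨾ id 1 ⊠ had :=
      tens_sw (by simp) (by simp) (by simp) (by simp)
    rw [this, reassoc (sp_sw _ _ _)]
  have h2 := congrArg (fun x => x ⊠ id 2) h1
  simp only [comp_tens_id, dom_tens, cod_tens, dom_id, cod_id, dom_sw, cod_sw, dom_had, cod_had,
    tens_assoc, id_tens_id, Nat.reduceAdd, dom_comp, dom_sp, cod_sp] at h2
  have h3 : (sp .green 1 2 0 ⊠ sp .green 1 2 0 : M) = id 1 ⊠ sp .green 1 2 0 ⨾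
      sp .green 1 2 0 ⊠ id 2 := (right_left (by simp) (by simp)).symm
  have e2 : (id 1 ⊠ sp .green 1 2 0 ⨾ sp .green 1 2 0 ⊠ id 2 : M) = sp .green 1 2 0 ⊠ id 1 ⨾
      id 2 ⊠ sp .green 1 2 0 := exch (by simp) (by simp) (by simp) (by simp)
  have e3 : (id 2 ⊠ sp .green 1 2 0 ⨾ id 1 ⊠ had ⊠ id 2 : M) = id 1 ⊠ had ⊠ id 1 ⨾
      id 2 ⊠ sp .green 1 2 0 := by
    have := exch (T := modThy) (a := id 1 ⊠ had) (b := sp .green 1 2 0) (m := 2) (m' := 2)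
      (n := 1) (n' := 2) (by simp) (by simp) (by simp) (by simp)
    simpa only [tens_assoc] using this
  have e4 : (id 2 ⊠ sp .green 1 2 0 ⨾ id 1 ⊠ cap ⊠ id 1 : M) = id 1 ⊠ sp .green 2 1 0 := by
    rw [← sp_two_one, id_tens_comp (by simp), id_tens_id_tens]
  rw [reassoc e1, comp_assoc, reassoc sw_cap_left', h3]
  simp only [comp_assoc]
  have h2' := reassoc h2 (id 1 ⊠ cap ⊠ id 1 ⨾ sp .red 2 1 0)
  simp only [comp_assoc] at h2'
  rw [h2', reassoc e2, comp_assoc, reassoc e3, comp_assoc, reassoc e4, conv, actZ, actX,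
    id_tens_comp (by simp), comp_assoc]

/-- Conjugation of X by the phase gate. The gate is written as a phase effect on a spare copy; the
bialgebra law moves the copy before the merge, and `gadget` expands the effect on the parity of
control and qubit. -/
theorem actX_phase : actX ⨾ sp .green 1 1 1 =
    sp .green 1 1 1 ⊠ sp .green 1 1 1 ⨾ conv actZ actX := by
  have f1 := fuse_left (T := modThy) .green 1 1 0 0 1
  have f2 := fuse_left (T := modThy) .green 1 1 1 0 1
  norm_num at f1 f2
  have hb : (sp .green 1 2 0 ⊠ sp .green 1 2 0 ⨾ id 1 ⊠ sw 1 1 ⊠ id 1 ⨾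
      sp .red 2 1 0 ⊠ sp .red 2 1 0 : M) = sp .red 2 1 0 ⨾ sp .green 1 2 0 := bialg .green
  have h1 : (sp .red 2 1 0 ⊠ sp .red 2 1 0 ⨾ sp .green 1 0 1 ⊠ id 1 : M) =
      (sp .green 1 1 1 ⊠ sp .green 1 1 1) ⊠ id 2 ⨾ had ⊠ id 3 ⨾ cap ⊠ id 2 ⨾ sp .red 2 1 0 := by
    rw [← comp_tens_comp (by simp) (by simp), gadget, comp_id (by simp),
      ← left_right (a := _ ⨾ _) (b := sp .red 2 1 0) (m := 0) (n := 2) (by simp) (by simp),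
      id_zero_tens, comp_tens_id (by simp), comp_tens_id (by simp), comp_assoc, comp_assoc]
    simp only [tens_assoc, id_tens_id, Nat.reduceAdd]
  have h2 : (id 1 ⊠ sw 1 1 ⊠ id 1 ⨾ (sp .green 1 1 1 ⊠ sp .green 1 1 1) ⊠ id 2 : M) =
      (sp .green 1 1 1 ⊠ id 1) ⊠ (sp .green 1 1 1 ⊠ id 1) ⨾ id 1 ⊠ sw 1 1 ⊠ id 1 := by
    have s : (sw 1 1 ⨾ sp .green 1 1 1 ⊠ id 1 : M) = id 1 ⊠ sp .green 1 1 1 ⨾ sw 1 1 :=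
      (tens_sw (by simp) (by simp) (by simp) (by simp)).symm
    have l : ((sp .green 1 1 1 ⊠ sp .green 1 1 1) ⊠ id 2 : M) =
        sp .green 1 1 1 ⊠ (sp .green 1 1 1 ⊠ id 1) ⊠ id 1 := by
      simp only [tens_assoc, id_tens_id, Nat.reduceAdd]
    have r : ((sp .green 1 1 1 ⊠ id 1) ⊠ (sp .green 1 1 1 ⊠ id 1) : M) =
        sp .green 1 1 1 ⊠ (id 1 ⊠ sp .green 1 1 1) ⊠ id 1 := by
      simp only [tens_assoc]
    rw [l, r, ← comp_tens_comp (by simp) (by simp), ← comp_tens_comp (by simp) (by simp),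
      ← comp_tens_comp (by simp) (by simp), ← comp_tens_comp (by simp) (by simp), s]
    simp [comp_id, id_comp]
  have h3 : (sp .green 1 2 0 ⊠ sp .green 1 2 0 ⨾
      (sp .green 1 1 1 ⊠ id 1) ⊠ (sp .green 1 1 1 ⊠ id 1) : M) =
      sp .green 1 1 1 ⊠ sp .green 1 1 1 ⨾ sp .green 1 2 0 ⊠ sp .green 1 2 0 := by
    rw [← comp_tens_comp (by simp) (by simp), f2, ← comp_tens_comp (by simp) (by simp), sp_comp,
      add_zero]
  rw [conv_actZ_actX_eq, actX]
  nth_rewrite 1 [← f1]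
  rw [← comp_assoc, ← hb, comp_assoc, comp_assoc, h1, reassoc h2, comp_assoc, reassoc h3, comp_assoc]

/-! ### The monoid of actions -/

/-- Precomposing the control wire with a phase. -/
def ph (k : ZMod 4) (a : M) : M := sp .green 1 1 k ⊠ id 1 ⨾ a

/-- The trivial action. -/
def eps : M := sp .green 1 0 0 ⊠ id 1

@[simp] theorem dom_eps : eps.dom = 2 := by simp [eps]
@[simp] theorem cod_eps : eps.cod = 1 := by simp [eps]

theorem ph_zero {a : M} (h : a.dom = 2) : ph 0 a = a := by
  rw [ph, sp_one, id_tens_id, id_comp (by simp [h])]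

theorem conv_ph_left (k : ZMod 4) {a b : M} (h : a.dom = 2) :
    conv (ph k a) b = ph k (conv a b) := by
  have f1 := fuse_right (T := modThy) .green 1 1 1 0 k
  norm_num at f1
  have f2 : (sp .green 1 1 k ⊠ id 1 ⨾ sp .green 1 2 0 ⊠ id 1 : M) = sp .green 1 2 k ⊠ id 1 := by
    rw [← comp_tens_id (by simp), sp_comp, add_zero]
  have f3 : (sp .green 1 2 0 ⊠ id 1 ⨾ id 1 ⊠ sp .green 1 1 k ⊠ id 1 : M) =
      sp .green 1 2 k ⊠ id 1 := by
    rw [← f1, comp_tens_id (by simp), tens_assoc]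
  rw [conv, ph, id_tens_comp (by simp [h]), comp_assoc, reassoc f3, ph, conv, reassoc f2]

theorem conv_ph_right (k : ZMod 4) {a b : M} (h : a.dom = 2) (h' : a.cod = 1) :
    conv a (ph k b) = ph k (conv a b) := by
  have f1 := fuse_left (T := modThy) .green 1 1 1 0 k
  norm_num at f1
  have e : id 1 ⊠ a ⨾ sp .green 1 1 k ⊠ id 1 = sp .green 1 1 k ⊠ id 2 ⨾ id 1 ⊠ a :=
    exch (by simp) (by simp) h h'
  have f2 : (sp .green 1 2 0 ⊠ id 1 ⨾ sp .green 1 1 k ⊠ id 2 : M) = sp .green 1 2 k ⊠ id 1 := by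
    rw [← f1, comp_tens_id (by simp), tens_assoc, id_tens_id]
  have f3 : (sp .green 1 1 k ⊠ id 1 ⨾ sp .green 1 2 0 ⊠ id 1 : M) = sp .green 1 2 k ⊠ id 1 := by
    rw [← comp_tens_id (by simp), sp_comp, add_zero]
  rw [conv, ph, reassoc e, comp_assoc, reassoc f2, ph, conv, reassoc f3]

theorem eps_conv {a : M} (h : a.dom = 2) : conv eps a = a := by
  have f1 := fuse_right (T := modThy) .green 1 1 0 0 0
  norm_num at f1
  rw [conv, eps, ← tens_assoc, ← comp_assoc, ← comp_tens_id (by simp), f1, id_tens_id,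
    id_comp (by simp [h])]

theorem conv_eps {a : M} (h : a.dom = 2) (h' : a.cod = 1) : conv a eps = a := by
  have f1 := fuse_left (T := modThy) .green 1 1 0 0 0
  norm_num at f1
  have e : id 1 ⊠ a ⨾ sp .green 1 0 0 ⊠ id 1 = sp .green 1 0 0 ⊠ id 2 ⨾ id 0 ⊠ a :=
    exch (by simp) (by simp) h h'
  have f2 : (sp .green 1 2 0 ⊠ id 1 ⨾ sp .green 1 0 0 ⊠ id 2 : M) = id 2 := by
    have := congrArg (fun x => x ⊠ id 1) f1
    simpa only [comp_tens_id, dom_tens, cod_tens, dom_id, cod_id, dom_sp, cod_sp,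
      tens_assoc, id_tens_id, Nat.reduceAdd] using this
  rw [conv, eps, e, id_zero_tens, reassoc f2, id_comp h]

theorem conv_assoc {a b c : M} (ha : a.dom = 2) (ha' : a.cod = 1) (hb : b.dom = 2) :
    conv (conv a b) c = conv a (conv b c) := by
  have f1 := fuse_left (T := modThy) .green 1 1 2 0 0
  have f2 := fuse_right (T := modThy) .green 1 1 2 0 0
  norm_num at f1 f2
  have h1 : (sp .green 1 2 0 ⊠ id 1 ⨾ id 1 ⊠ sp .green 1 2 0 ⊠ id 1 : M) =
      sp .green 1 3 0 ⊠ id 1 := by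
    rw [← f2, comp_tens_id (by simp), tens_assoc]
  have h2 : (sp .green 1 2 0 ⊠ id 1 ⨾ sp .green 1 2 0 ⊠ id 2 : M) = sp .green 1 3 0 ⊠ id 1 := by
    rw [← f1, comp_tens_id (by simp), tens_assoc, id_tens_id]
  have e : id 1 ⊠ a ⨾ sp .green 1 2 0 ⊠ id 1 = sp .green 1 2 0 ⊠ id 2 ⨾ id 2 ⊠ a :=
    exch (by simp) (by simp) ha ha'
  rw [conv, conv, conv, conv, id_tens_comp (by simp [ha]), id_tens_comp (by simp [ha', hb]),
    id_tens_id_tens, comp_assoc, comp_assoc, reassoc h1, reassoc e, comp_assoc, reassoc h2]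

/-- The action of the Pauli operator `X ^ p.1 * Z ^ p.2`. -/
def act (p : Bool × Bool) : M :=
  conv (bif p.1 then actX else eps) (bif p.2 then actZ else eps)

@[simp] theorem dom_act (p : Bool × Bool) : (act p).dom = 2 := by simp [act]
@[simp] theorem cod_act (p : Bool × Bool) : (act p).cod = 1 := by
  rcases p with ⟨_, _ | _⟩ <;> simp [act]

theorem act_false_false : act (false, false) = eps := eps_conv (by simp)
theorem act_true_false : act (true, false) = actX := conv_eps (by simp) (by simp)
theorem act_false_true : act (false, true) = actZ := eps_conv (by simp)

/-- Product of Pauli operators up to phase. -/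
def pmul (p q : Bool × Bool) : Bool × Bool := (p.1 ^^ q.1, p.2 ^^ q.2)

/-- X and Z square to the trivial action and commute up to a control phase, and control phases are
central. Reordering the product therefore costs only a phase. -/
theorem conv_act (p q : Bool × Bool) : ∃ k, conv (act p) (act q) = ph k (act (pmul p q)) := by
  have hxx : conv actX actX = eps := conv_actX_actX
  have hzz : conv actZ actZ = eps := conv_actZ_actZ
  have hX (x x' : Bool) : conv (bif x then actX else eps) (bif x' then actX else eps) =
      bif (x ^^ x') then actX else eps := by
    cases x <;> cases x' <;> simp [eps_conv, conv_eps, hxx]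
  have hZ (x x' : Bool) : conv (bif x then actZ else eps) (bif x' then actZ else eps) =
      bif (x ^^ x') then actZ else eps := by
    cases x <;> cases x' <;> simp [eps_conv, conv_eps, hzz]
  have hc (z x : Bool) : ∃ k, conv (bif z then actZ else eps) (bif x then actX else eps) =
      ph k (conv (bif x then actX else eps) (bif z then actZ else eps)) := by
    cases x <;> cases z
    · exact ⟨0, by rw [ph_zero (by simp)]; simp [eps_conv, conv_eps]⟩
    · exact ⟨0, by rw [ph_zero (by simp)]; simp [eps_conv, conv_eps]⟩
    · exact ⟨0, by rw [ph_zero (by simp)]; simp [eps_conv, conv_eps]⟩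
    · exact ⟨2, conv_actZ_actX⟩
  obtain ⟨x, z⟩ := p
  obtain ⟨x', z'⟩ := q
  obtain ⟨k, hk⟩ := hc z x'
  have d1 (x : Bool) : (bif x then actX else eps).dom = 2 := by cases x <;> simp
  have c1 (x : Bool) : (bif x then actX else eps).cod = 1 := by cases x <;> simp
  have d2 (x : Bool) : (bif x then actZ else eps).dom = 2 := by cases x <;> simp
  have c2 (x : Bool) : (bif x then actZ else eps).cod = 1 := by cases x <;> simp
  refine ⟨k, ?_⟩
  simp only [act, pmul]
  rw [conv_assoc (d1 x) (c1 x) (d2 z), ← conv_assoc (d2 z) (c2 z) (d1 x'), hk,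
    conv_ph_left k (by simp), conv_ph_right k (d1 x) (c1 x), conv_assoc (d1 x') (c1 x') (d2 z), hZ,
    ← conv_assoc (d1 x) (c1 x) (d1 x'), hX]

/-! ### Weaving a control wire through a qubit -/

theorem weave_eps : weave eps = sw 1 1 := by
  have f1 := fuse_right (T := modThy) .green 1 1 0 0 0
  norm_num at f1
  rw [weave, eps, ← tens_assoc, ← comp_assoc, ← comp_tens_id (by simp), f1, id_tens_id,
    id_comp (by simp)]

theorem weave_ph (k : ZMod 4) {a : M} (h : a.dom = 2) :
    weave (ph k a) = sp .green 1 1 k ⊠ id 1 ⨾ weave a := by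
  have f1 := fuse_right (T := modThy) .green 1 1 1 0 k
  norm_num at f1
  have f2 : (sp .green 1 1 k ⊠ id 1 ⨾ sp .green 1 2 0 ⊠ id 1 : M) = sp .green 1 2 k ⊠ id 1 := by
    rw [← comp_tens_id (by simp), sp_comp, add_zero]
  have f3 : (sp .green 1 2 0 ⊠ id 1 ⨾ id 1 ⊠ sp .green 1 1 k ⊠ id 1 : M) =
      sp .green 1 2 k ⊠ id 1 := by
    rw [← f1, comp_tens_id (by simp), tens_assoc]
  rw [weave, ph, id_tens_comp (by simp [h]), comp_assoc, reassoc f3, weave, reassoc f2]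

theorem weave_phase (k : ZMod 4) {a : M} (h : a.dom = 2) (h' : a.cod = 1) :
    weave a ⨾ id 1 ⊠ sp .green 1 1 k = sp .green 1 1 k ⊠ id 1 ⨾ weave a := by
  have f1 := fuse_left (T := modThy) .green 1 1 1 0 k
  norm_num at f1
  have e : (sw 1 1 ⨾ id 1 ⊠ sp .green 1 1 k : M) = sp .green 1 1 k ⊠ id 1 ⨾ sw 1 1 :=
    (tens_sw (by simp) (by simp) (by simp) (by simp)).symm
  have e2 : id 1 ⊠ a ⨾ sp .green 1 1 k ⊠ id 1 = sp .green 1 1 k ⊠ id 2 ⨾ id 1 ⊠ a :=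
    exch (by simp) (by simp) h h'
  have f2 : (sp .green 1 2 0 ⊠ id 1 ⨾ sp .green 1 1 k ⊠ id 2 : M) = sp .green 1 2 k ⊠ id 1 := by
    rw [← f1, comp_tens_id (by simp), tens_assoc, id_tens_id]
  have f3 : (sp .green 1 1 k ⊠ id 1 ⨾ sp .green 1 2 0 ⊠ id 1 : M) = sp .green 1 2 k ⊠ id 1 := by
    rw [← comp_tens_id (by simp), sp_comp, add_zero]
  rw [weave, comp_assoc, comp_assoc, e, reassoc e2, comp_assoc, reassoc f2, reassoc f3]

/-- On both sides all copies of the control fuse into a single green spider with four outputs. The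
two sides then differ by a crossing of its legs, which is immaterial. -/
theorem weave_merge {a b : M} (ha : a.dom = 2) (ha' : a.cod = 1) (hb : b.dom = 2) (hb' : b.cod = 1) :
    sp .green 1 2 0 ⊠ id 1 ⨾ id 1 ⊠ weave a ⨾ weave b ⊠ id 1 =
      weave (conv a b) ⨾ id 1 ⊠ sp .green 1 2 0 := by
  have f1 := fuse_left (T := modThy) .green 1 1 2 0 0
  have f2 := fuse_right (T := modThy) .green 1 1 2 0 0
  have f3 := fuse_left (T := modThy) .green 1 2 2 0 0
  norm_num at f1 f2 f3
  have h2 : (sp .green 1 2 0 ⊠ id 1 ⨾ id 1 ⊠ sp .green 1 2 0 ⊠ id 1 : M) =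
      sp .green 1 3 0 ⊠ id 1 := by
    rw [← f2, comp_tens_id (by simp), tens_assoc]
  have h3 : (sp .green 1 3 0 ⊠ id 1 ⨾ sp .green 1 2 0 ⊠ id 3 : M) = sp .green 1 4 0 ⊠ id 1 := by
    rw [← f3, comp_tens_id (by simp), tens_assoc, id_tens_id]
  have h4 : (sp .green 1 4 0 ⊠ id 1 ⨾ id 1 ⊠ sw 1 1 ⊠ id 2 : M) = sp .green 1 4 0 ⊠ id 1 := by
    have := congrArg (fun x => x ⊠ id 1) (sp_swap (T := modThy) .green 1 1 1 0)
    simpa only [comp_tens_id, dom_tens, cod_tens, dom_id, cod_id, dom_sp, cod_sp, dom_sw, cod_sw,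
      tens_assoc, id_tens_id, Nat.reduceAdd] using this
  have e1 : id 1 ⊠ sw 1 1 ⨾ sp .green 1 2 0 ⊠ id 2 = (sp .green 1 2 0 ⊠ id 2 ⨾ id 2 ⊠ sw 1 1 : M) :=
    exch (by simp) (by simp) (by simp) (by simp)
  have e2 : id 2 ⊠ a ⨾ sp .green 1 2 0 ⊠ id 2 = sp .green 1 2 0 ⊠ id 3 ⨾ id 3 ⊠ a := by
    have := exch (T := modThy) (a := sp .green 1 2 0) (b := id 1 ⊠ a) (m := 1) (m' := 2)
      (n := 3) (n' := 2) (by simp) (by simp) (by simp [ha]) (by simp [ha'])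
    simpa only [id_tens_id_tens, Nat.reduceAdd] using this
  have e3 : id 1 ⊠ b ⨾ sp .green 1 2 0 ⊠ id 1 = sp .green 1 2 0 ⊠ id 2 ⨾ id 2 ⊠ b := 
    exch (by simp) (by simp) hb hb'
  have e4 : (sw 1 1 ⨾ id 1 ⊠ sp .green 1 2 0 : M) = sp .green 1 2 0 ⊠ id 1 ⨾ sw 2 1 :=
    (tens_sw (by simp) (by simp) (by simp) (by simp)).symm
  have e5 : id 2 ⊠ b ⨾ id 1 ⊠ sw 1 1 = id 1 ⊠ sw 1 1 ⊠ id 1 ⨾ id 2 ⊠ sw 1 1 ⨾ id 1 ⊠ b ⊠ id 1 := by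
    have := congrArg (fun x => id 1 ⊠ x) (box_sw hb hb')
    simpa only [id_tens_comp, dom_tens, cod_tens, dom_id, cod_id, dom_sw, cod_sw, hb, hb', dom_comp,
      id_tens_id_tens, Nat.reduceAdd] using this
  have e6 : id 3 ⊠ a ⨾ id 1 ⊠ sw 1 1 ⊠ id 1 = id 1 ⊠ sw 1 1 ⊠ id 2 ⨾ id 3 ⊠ a := by
    have := exch (T := modThy) (a := id 1 ⊠ sw 1 1) (b := a) (m := 3) (m' := 3)
      (n := 2) (n' := 1) (by simp) (by simp) ha ha'
    simpa only [tens_assoc] using this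
  have l : sp .green 1 2 0 ⊠ id 1 ⨾ id 1 ⊠ weave a ⨾ weave b ⊠ id 1 = sp .green 1 4 0 ⊠ id 1 ⨾
      id 3 ⊠ a ⨾ id 2 ⊠ sw 1 1 ⨾ id 1 ⊠ b ⊠ id 1 ⨾ sw 1 1 ⊠ id 1 := by
    simp only [weave, id_tens_comp, comp_tens_id, dom_tens, cod_tens, dom_id, cod_id, dom_sw, cod_sw,
      ha, ha', hb, hb', dom_comp, dom_sp, cod_sp, id_tens_id_tens, id_tens_id, Nat.reduceAdd,
      comp_assoc, tens_assoc]
    rw [reassoc h2, reassoc e1, comp_assoc, reassoc e2, comp_assoc, reassoc h3]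
  rw [l]
  simp only [weave, conv, id_tens_comp, comp_tens_id, dom_tens, cod_tens, dom_id, cod_id, dom_sw,
    cod_sw, ha, ha', hb, hb', dom_comp, dom_sp, cod_sp, id_tens_id_tens, id_tens_id, Nat.reduceAdd,
    comp_assoc, tens_assoc]
  rw [reassoc h2, e4, reassoc e3, comp_assoc, reassoc e2, comp_assoc, reassoc h3, sw_two_one,
    reassoc e5, comp_assoc, comp_assoc, reassoc e6, comp_assoc, reassoc h4]

theorem weave_weave {a b : M} (ha : a.dom = 2) (ha' : a.cod = 1) (hb : b.dom = 2) (hb' : b.cod = 1) :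
    weave a ⊠ id 1 ⨾ id 1 ⊠ weave b =
      sp .green 1 2 0 ⊠ id 2 ⨾ id 1 ⊠ act₂ a b ⨾ sw 1 2 := by
  have f1 := fuse_left (T := modThy) .green 1 1 2 0 0
  have f2 := fuse_right (T := modThy) .green 1 1 2 0 0
  norm_num at f1 f2
  have h1 : (sp .green 1 2 0 ⊠ id 2 ⨾ id 1 ⊠ sp .green 1 2 0 ⊠ id 2 : M) =
      sp .green 1 3 0 ⊠ id 2 := by
    rw [← f2, comp_tens_id (by simp), tens_assoc]
  have h2 : (sp .green 1 2 0 ⊠ id 2 ⨾ sp .green 1 2 0 ⊠ id 3 : M) = sp .green 1 3 0 ⊠ id 2 := by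
    rw [← f1, comp_tens_id (by simp), tens_assoc, id_tens_id]
  have e1 : (sw 1 1 ⊠ id 1 ⨾ id 1 ⊠ sp .green 1 2 0 ⊠ id 1 : M) =
      sp .green 1 2 0 ⊠ id 2 ⨾ id 1 ⊠ sw 1 1 ⊠ id 1 ⨾ sw 1 1 ⊠ id 2 := by
    have e : (sw 1 1 ⨾ id 1 ⊠ sp .green 1 2 0 : M) = sp .green 1 2 0 ⊠ id 1 ⨾ sw 2 1 :=
      (tens_sw (by simp) (by simp) (by simp) (by simp)).symm
    rw [sw_two_one] at e
    have := congrArg (fun x => x ⊠ id 1) e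
    simpa only [comp_tens_id, dom_tens, cod_tens, dom_id, cod_id, dom_sp, cod_sp, dom_sw, cod_sw,
      dom_comp, tens_assoc, id_tens_id, Nat.reduceAdd] using this
  have e2 : id 1 ⊠ a ⊠ id 1 ⨾ sp .green 1 2 0 ⊠ id 2 =
      sp .green 1 2 0 ⊠ id 3 ⨾ id 2 ⊠ a ⊠ id 1 :=
    exch (by simp) (by simp) (by simp [ha]) (by simp [ha'])
  have e3 : sw 1 1 ⊠ id 2 ⨾ id 2 ⊠ b = id 2 ⊠ b ⨾ sw 1 1 ⊠ id 1 :=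
    (exch (by simp) (by simp) hb hb').symm
  rw [sw_one_two]
  simp only [weave, act₂, id_tens_comp, comp_tens_id, dom_tens, cod_tens, dom_id, cod_id, dom_sw,
    cod_sw, ha, ha', hb, hb', dom_comp, dom_sp, cod_sp, id_tens_id_tens, id_tens_id, Nat.reduceAdd,
    comp_assoc, tens_assoc]
  rw [reassoc e1, comp_assoc, comp_assoc, reassoc e2, comp_assoc, reassoc h2, reassoc h1,
    reassoc e3, comp_assoc]

/-! ### Controlled Pauli strings -/

/-- The controlled action of a string of Pauli operators; the control wire weaves through the
qubits from the left to the right. -/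
def cp : List (Bool × Bool) → M
  | [] => id 1
  | p :: l => weave (act p) ⊠ id l.length ⨾ id 1 ⊠ cp l

@[simp] theorem dom_cp (l : List (Bool × Bool)) : (cp l).dom = l.length + 1 := by
  cases l with
  | nil => simp [cp]
  | cons p l => simp [cp]; omega

@[simp] theorem cod_cp (l : List (Bool × Bool)) : (cp l).cod = l.length + 1 := by
  induction l with
  | nil => simp [cp]
  | cons p l ih => simp [cp, ih]; omega

theorem cp_append (l l' : List (Bool × Bool)) :
    cp (l ++ l') = cp l ⊠ id l'.length ⨾ id l.length ⊠ cp l' := by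
  induction l with
  | nil => simp [cp, id_tens_id, id_zero_tens, id_comp, Nat.add_comm]
  | cons p l ih =>
    simp only [cp, List.cons_append, ih, List.length_append, List.length_cons]
    rw [id_tens_comp (by simp; omega), comp_tens_id (by simp; omega), tens_assoc, id_tens_id,
      tens_assoc, id_tens_id_tens, comp_assoc, Nat.add_comm 1 l.length]

theorem cp_phase (k : ZMod 4) (l : List (Bool × Bool)) :
    cp l ⨾ id l.length ⊠ sp .green 1 1 k = sp .green 1 1 k ⊠ id l.length ⨾ cp l := by
  induction l with
  | nil => simp [cp, id_zero_tens, tens_id_zero, id_comp, comp_id]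
  | cons p l ih =>
    have h := congrArg (fun x => id 1 ⊠ x) ih
    have h' := congrArg (fun x => x ⊠ id l.length) (weave_phase k (dom_act p) (cod_act p))
    rw [id_tens_comp (by simp), id_tens_id_tens, id_tens_comp (by simp; omega)] at h
    rw [comp_tens_id (by simp), comp_tens_id (by simp), tens_assoc, tens_assoc, id_tens_id] at h'
    simp only [cp, List.length_cons]
    rw [comp_assoc, Nat.add_comm l.length 1, h, reassoc h', comp_assoc]

/-- Two controls obtained by copying merge at each qubit by `weave_merge`. The phases from
reordering Paulis slide along the control to the front and add up. -/
theorem cp_mul (l l' : List (Bool × Bool)) (h : l.length = l'.length) :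
    ∃ k, sp .green 1 2 0 ⊠ id l.length ⨾ id 1 ⊠ cp l ⨾ cp l' ⊠ id 1 =
      sp .green 1 1 k ⊠ id l.length ⨾ cp (l.zipWith pmul l') ⨾
        id l.length ⊠ sp .green 1 2 0 := by
  induction l generalizing l' with
  | nil =>
    obtain rfl : l' = [] := List.length_eq_zero_iff.1 h.symm
    exact ⟨0, by simp [cp, id_zero_tens, tens_id_zero, id_comp, comp_id, id_tens_id]⟩
  | cons p l ih =>
    cases l' with
    | nil => simp at h
    | cons p' l' =>
      have hl : l.length = l'.length := by simpa using h
      obtain ⟨k, hk⟩ := ih l' hl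
      obtain ⟨j, hj⟩ := conv_act p p'
      have hz : (l.zipWith pmul l').length = l.length := by simp [hl]
      refine ⟨j + k, ?_⟩
      have e : id 2 ⊠ cp l ⨾ weave (act p') ⊠ id (l.length + 1) =
          weave (act p') ⊠ id (l.length + 1) ⨾ id 2 ⊠ cp l :=
        exch (by simp) (by simp) (by simp) (by simp)
      have w := congrArg (fun x => x ⊠ id l.length)
        (weave_merge (dom_act p) (cod_act p) (dom_act p') (cod_act p'))
      rw [comp_tens_id (by simp), comp_tens_id (by simp), comp_tens_id (by simp), tens_assoc,
        tens_assoc, tens_assoc, tens_assoc, id_tens_id, hj, weave_ph j (by simp),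
        comp_tens_id (by simp), tens_assoc, id_tens_id] at w
      have hk' := congrArg (fun x => id 1 ⊠ x) hk
      rw [id_tens_comp (by simp; omega), id_tens_comp (by simp [hl]; omega), id_tens_id_tens,
        id_tens_comp (by simp [hl]; omega), id_tens_comp (by simp [hl]), id_tens_id_tens] at hk'
      have w2 := congrArg (fun x => x ⊠ id l.length) (weave_phase k (dom_act (pmul p p')) (cod_act _))
      rw [comp_tens_id (by simp), comp_tens_id (by simp), tens_assoc, tens_assoc, id_tens_id] at w2
      have f : (sp .green 1 1 j ⊠ id (1 + l.length) ⨾ sp .green 1 1 k ⊠ id (1 + l.length) : M) =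
          sp .green 1 1 (j + k) ⊠ id (1 + l.length) := by
        rw [← comp_tens_id (by simp), sp_comp]
      simp only [cp, List.zipWith_cons_cons, List.length_cons]
      rw [id_tens_comp (by simp; omega), comp_tens_id (by simp [hl]; omega), ← hl, hz, tens_assoc,
        tens_assoc, id_tens_id, id_tens_id_tens, Nat.add_comm l.length 1]
      rw [Nat.add_comm l.length 1] at e
      simp only [comp_assoc] at w ⊢
      rw [reassoc e, comp_assoc]
      have w' := reassoc (a := sp .green 1 2 0 ⊠ id (1 + l.length)) 
        (b := id 1 ⊠ weave (act p) ⊠ id l.length ⨾ weave (act p') ⊠ id (1 + l.length)) w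
      simp only [comp_assoc] at w'
      rw [w', hk', reassoc w2, comp_assoc, reassoc f]

/-! ### Sliding diagrams through controlled Pauli strings -/

/-- `D` turns the Pauli string `p` into `q`, up to the phase `k` of the control wire. -/
def SlideBy (k : ZMod 4) (D : M) (p q : List (Bool × Bool)) : Prop :=
  D.dom = p.length ∧ D.cod = q.length ∧ id 1 ⊠ D ⨾ cp q = cp p ⨾ D ⊠ sp .green 1 1 k

/-- `D` turns the Pauli string `p` into `q`, up to a phase of the control wire. -/
def Slide (D : M) (p q : List (Bool × Bool)) : Prop := ∃ k, SlideBy k D p q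

theorem SlideBy.seq {D E : M} {k k' : ZMod 4} {p q r : List (Bool × Bool)} (h : SlideBy k D p q)
    (h' : SlideBy k' E q r) : SlideBy (k + k') (D ⨾ E) p r := by
  obtain ⟨h1, h2, hk⟩ := h
  obtain ⟨h1', h2', hk'⟩ := h'
  refine ⟨by simp [h1], by simp [h2'], ?_⟩
  rw [id_tens_comp (by rw [h2, h1']), comp_assoc, hk', reassoc hk, comp_assoc,
    ← comp_tens_comp (by rw [h2, h1']) (by simp), sp_comp]

theorem Slide.seq {D E : M} {p q r : List (Bool × Bool)} (h : Slide D p q) (h' : Slide E q r) :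
    Slide (D ⨾ E) p r :=
  ⟨_, h.choose_spec.seq h'.choose_spec⟩

theorem SlideBy.ident (p : List (Bool × Bool)) : SlideBy 0 (id p.length) p p :=
  ⟨by simp, by simp, by simp [id_tens_id, id_comp, comp_id, Nat.add_comm]⟩

theorem SlideBy.par {D E : M} {k k' : ZMod 4} {p q p' q' : List (Bool × Bool)} (h : SlideBy k D p q)
    (h' : SlideBy k' E p' q') : SlideBy (k + k') (D ⊠ E) (p ++ p') (q ++ q') := by
  obtain ⟨h1, h2, hk⟩ := h
  obtain ⟨h1', h2', hk'⟩ := h'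
  refine ⟨by simp [h1, h1'], by simp [h2, h2'], ?_⟩
  have e4 : (cp p ⨾ D ⊠ sp .green 1 1 k) ⊠ E =
      cp p ⊠ id p'.length ⨾ (D ⊠ sp .green 1 1 k) ⊠ E := by
    rw [← comp_tens_comp (by simp [h1]) (by simp [h1']), id_comp h1']
  have e2 : (id 1 ⊠ D) ⊠ E ⨾ cp q ⊠ id q'.length = (id 1 ⊠ D ⨾ cp q) ⊠ E := by
    rw [← comp_tens_comp (by simp [h2, Nat.add_comm]) (by simp [h2']), comp_id h2']
  have e3 : (D ⊠ sp .green 1 1 k) ⊠ E ⨾ id q.length ⊠ cp q' =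
      id p.length ⊠ cp p' ⨾ D ⊠ E ⊠ sp .green 1 1 (k + k') := by
    have c := reassoc (cp_phase k p').symm (E ⊠ sp .green 1 1 k')
    rw [comp_assoc, ← comp_tens_comp (by simp [h1']) (by simp), id_comp h1', sp_comp] at c
    have : sp .green 1 1 k ⊠ E ⨾ cp q' = cp p' ⨾ E ⊠ sp .green 1 1 (k + k') := by
      rw [← left_right (a := sp .green 1 1 k) (b := E) (m := 1) (n := p'.length) (by simp)
        (by simp [h1']), comp_assoc, hk', c]
    rw [tens_assoc, ← comp_tens_comp (by simp [h2]) (by simp [h2']; omega), this, comp_id h2,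
      ← comp_tens_comp (by simp [h1]) (by simp [h1']), id_comp h1]
  rw [cp_append, cp_append, ← tens_assoc, reassoc e2, hk, e4, comp_assoc, e3,
    comp_assoc, tens_assoc]

theorem Slide.ident (p : List (Bool × Bool)) : Slide (id p.length) p p := ⟨_, .ident p⟩

theorem Slide.par {D E : M} {p q p' q' : List (Bool × Bool)} (h : Slide D p q)
    (h' : Slide E p' q') : Slide (D ⊠ E) (p ++ p') (q ++ q') :=
  ⟨_, h.choose_spec.par h'.choose_spec⟩

/-- Copy the control and slide `D` past one string per copy. On either side of `D` the pair of
strings merges by `cp_mul`, and a green effect discards the spare control. -/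
theorem Slide.mul {D : M} {p q p' q' : List (Bool × Bool)} (h : Slide D p q)
    (h' : Slide D p' q') : Slide D (p.zipWith pmul p') (q.zipWith pmul q') := by
  obtain ⟨k, h1, h2, hk⟩ := h
  obtain ⟨k', h1', h2', hk'⟩ := h'
  have hp : p.length = p'.length := h1.symm.trans h1'
  have hq : q.length = q'.length := h2.symm.trans h2'
  obtain ⟨a, ha⟩ := cp_mul p p' hp
  obtain ⟨b, hb⟩ := cp_mul q q' hq
  set r := p.zipWith pmul p'
  set s := q.zipWith pmul q'
  have hr : r.length = p.length := by simp [r, hp]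
  have hs : s.length = q.length := by simp [s, hq]
  -- `a` and `b` are the phases from multiplying the input and the output strings. The latter arises
  -- on the other side of the equation and is moved across with a minus sign.
  refine ⟨a + (k' + k) + -b, h1.trans hr.symm, h2.trans hs.symm, ?_⟩
  have e1 : id 1 ⊠ D ⨾ sp .green 1 2 0 ⊠ id q.length = sp .green 1 2 0 ⊠ id p.length ⨾ id 2 ⊠ D :=
    exch (by simp) (by simp) h1 h2
  have e2 : id 2 ⊠ D ⨾ id 1 ⊠ cp q = id 1 ⊠ cp p ⨾ id 1 ⊠ D ⊠ sp .green 1 1 k := by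
    have := congrArg (fun x => id 1 ⊠ x) hk
    rwa [id_tens_comp (by simp [h2, Nat.add_comm]), id_tens_comp (by simp [h1]),
      id_tens_id_tens] at this
  have e3 : id 1 ⊠ D ⊠ sp .green 1 1 k ⨾ cp q' ⊠ id 1 =
      cp p' ⊠ id 1 ⨾ D ⊠ sp .green 1 1 k' ⊠ sp .green 1 1 k := by
    rw [← tens_assoc, ← comp_tens_comp (by simp [h2']; omega) (by simp), hk', ← tens_assoc,
      ← comp_tens_comp (by simp [h1']) (by simp), id_comp (by simp), comp_id (by simp)]
  have e4 : (id q.length ⊠ sp .green 1 2 0 ⨾ id q.length ⊠ id 1 ⊠ sp .green 1 0 0 : M) =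
      id (q.length + 1) := by
    have f1 := fuse_right (T := modThy) .green 1 1 0 0 0
    norm_num at f1
    rw [← id_tens_comp (by simp), f1, id_tens_id]
  have e5 : (id p.length ⊠ sp .green 1 2 0 ⨾ D ⊠ sp .green 1 1 k' ⊠ sp .green 1 1 k ⨾
      id q.length ⊠ id 1 ⊠ sp .green 1 0 0 : M) = D ⊠ sp .green 1 1 (k' + k) := by
    have f1 := fuse_left (T := modThy) .green 1 1 1 0 k'
    have f2 := fuse_right (T := modThy) .green 1 1 0 k' k
    norm_num at f1 f2
    have g : (sp .green 1 2 0 ⨾ sp .green 1 1 k' ⊠ sp .green 1 1 k ⨾ id 1 ⊠ sp .green 1 0 0 : M) =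
        sp .green 1 1 (k' + k) := by
      rw [← comp_tens_comp (by simp) (by simp), sp_comp, comp_id (by simp), add_zero,
        ← left_right (a := sp .green 1 1 k') (m := 1) (n := 1) (by simp) (by simp), reassoc f1, f2]
    rw [← comp_tens_comp (by simp [h2]) (by simp), comp_id h2,
      ← comp_tens_comp (by simp [h1]) (by simp), id_comp h1, g]
  have e6 : id 1 ⊠ D ⨾ cp s ⨾ id q.length ⊠ sp .green 1 1 b =
      cp r ⨾ D ⊠ sp .green 1 1 (a + (k' + k)) := by
    have cs := cp_phase b s
    have cr := cp_phase a r
    rw [hs] at cs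
    rw [hr] at cr
    have l := congrArg (fun x => x ⨾ id q.length ⊠ id 1 ⊠ sp .green 1 0 0)
      (congrArg (fun x => id 1 ⊠ D ⨾ x) hb)
    simp only [comp_assoc] at l
    rw [e4, reassoc e1, comp_assoc, reassoc e2, comp_assoc, reassoc e3, comp_assoc] at l
    have ha' := reassoc ha (D ⊠ sp .green 1 1 k' ⊠ sp .green 1 1 k ⨾
      id q.length ⊠ id 1 ⊠ sp .green 1 0 0)
    simp only [comp_assoc] at ha'
    rw [ha', e5, comp_id (by simp [hs])] at l
    have cr' := reassoc cr (D ⊠ sp .green 1 1 (k' + k))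
    rw [comp_assoc, ← comp_tens_comp (by simp [h1]) (by simp), id_comp h1, sp_comp] at cr'
    rw [cs, ← l, ← cr']
  have := congrArg (fun x => x ⨾ id q.length ⊠ sp .green 1 1 (-b)) e6
  simp only [comp_assoc] at this
  rwa [← id_tens_comp (by simp), sp_comp, add_neg_cancel, sp_one, id_tens_id,
    comp_id (a := cp s) (by simp [hs]), ← comp_tens_comp (by simp [h2]) (by simp), comp_id h2,
    sp_comp] at this

/-- The controlled action of an operator on several qubits, the control wire being the leftmost
input and the rightmost output. -/
def bent (n m : ℕ) (a : M) : M := sp .green 1 2 0 ⊠ id n ⨾ id 1 ⊠ a ⨾ sw 1 m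

/-- Reduces a slide to an equation in which the control is consumed: the outgoing control is a spare
green copy that `D` passes freely. -/
theorem bent_slide {n m : ℕ} {a b D : M} {k : ZMod 4} (ha : a.dom = 1 + n) (ha' : a.cod = n)
    (hb : b.dom = 1 + m) (hD : D.dom = n) (hD' : D.cod = m)
    (h : id 1 ⊠ D ⨾ b = sp .green 1 1 k ⊠ id n ⨾ a ⨾ D) :
    id 1 ⊠ D ⨾ bent m m b = bent n n a ⨾ D ⊠ sp .green 1 1 k := by
  have f1 := fuse_right (T := modThy) .green 1 1 1 0 k
  have f2 := fuse_left (T := modThy) .green 1 1 1 0 k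
  norm_num at f1 f2
  have f3 : (sp .green 1 2 0 ⊠ id n ⨾ id 1 ⊠ sp .green 1 1 k ⊠ id n : M) =
      sp .green 1 2 0 ⊠ id n ⨾ sp .green 1 1 k ⊠ id (1 + n) := by
    rw [← tens_assoc, ← comp_tens_id (by simp), f1, ← id_tens_id, ← tens_assoc,
      ← comp_tens_id (by simp), f2]
  have e1 : id 1 ⊠ D ⨾ sp .green 1 2 0 ⊠ id m = sp .green 1 2 0 ⊠ id n ⨾ id 2 ⊠ D :=
    exch (by simp) (by simp) hD hD'
  have e2 : id 2 ⊠ D ⨾ id 1 ⊠ b = id 1 ⊠ sp .green 1 1 k ⊠ id n ⨾ id 1 ⊠ a ⨾ id 1 ⊠ D := by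
    rw [← id_tens_comp (by simp [ha', hD]), ← id_tens_comp (by simp [ha]), ← h,
      id_tens_comp (by simp [hb, hD']), id_tens_id_tens]
  have e3 : id 1 ⊠ D ⨾ sw 1 m = sw 1 n ⨾ D ⊠ id 1 := tens_sw (by simp) (by simp) hD hD'
  have e4 : sp .green 1 1 k ⊠ id (1 + n) ⨾ id 1 ⊠ a = id 1 ⊠ a ⨾ sp .green 1 1 k ⊠ id n :=
    (exch (by simp) (by simp) ha ha').symm
  have e5 : (sp .green 1 1 k ⊠ id n ⨾ sw 1 n : M) = sw 1 n ⨾ id n ⊠ sp .green 1 1 k :=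
    tens_sw (by simp) (by simp) (by simp) (by simp)
  rw [bent, reassoc e1, comp_assoc, reassoc e2]
  simp only [comp_assoc]
  rw [reassoc f3, e3, comp_assoc, reassoc e4, comp_assoc, reassoc e5, comp_assoc,
    right_left (a := D) (by simp [hD]) (by simp), bent, comp_assoc, comp_assoc]

theorem cp_nil_eq : cp [] = bent 0 0 (sp .green 1 0 0) := by
  have f1 := fuse_right (T := modThy) .green 1 1 0 0 0
  norm_num at f1
  simp only [cp, bent, sw_zero, tens_id_zero]
  rw [← comp_assoc, f1, comp_id (by simp)]

theorem cp_singleton (p : Bool × Bool) : cp [p] = bent 1 1 (act p) := by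
  simp [cp, tens_id_zero, id_tens_id, comp_id, bent, weave]

theorem cp_pair (p q : Bool × Bool) : cp [p, q] = bent 2 2 (act₂ (act p) (act q)) := by
  simp only [cp, List.length_cons, List.length_nil, Nat.reduceAdd, tens_id_zero, id_tens_id, bent]
  rw [comp_id (by simp), weave_weave (by simp) (by simp) (by simp) (by simp)]

/-- The action of a string of at most two Pauli operators. -/
def short : List (Bool × Bool) → M
  | [] => sp .green 1 0 0
  | [p] => act p
  | p :: q :: _ => act₂ (act p) (act q)

theorem slideBy_of_short {D : M} {p q : List (Bool × Bool)} (hp : p.length ≤ 2) (hq : q.length ≤ 2)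
    (h1 : D.dom = p.length) (h2 : D.cod = q.length) {k : ZMod 4}
    (h : id 1 ⊠ D ⨾ short q = sp .green 1 1 k ⊠ id p.length ⨾ short p ⨾ D) : SlideBy k D p q := by
  have key : ∀ l : List (Bool × Bool), l.length ≤ 2 → cp l = bent l.length l.length (short l) ∧
      (short l).dom = 1 + l.length ∧ (short l).cod = l.length := by
    rintro (_ | ⟨p, _ | ⟨q, _ | ⟨r, l⟩⟩⟩) hl
    · exact ⟨cp_nil_eq, by simp [short]⟩
    · exact ⟨cp_singleton p, by simp [short]⟩
    · exact ⟨cp_pair p q, by simp [short]⟩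
    · simp at hl
  obtain ⟨a1, a2, a3⟩ := key p hp
  obtain ⟨b1, b2, b3⟩ := key q hq
  refine ⟨h1, h2, ?_⟩
  rw [a1, b1]
  exact bent_slide a2 a3 b2 h1 h2 h

theorem act₂_eps {a : M} (h : a.dom = 2) (h' : a.cod = 1) : act₂ a eps = a ⊠ id 1 := by
  have f1 := fuse_left (T := modThy) .green 1 1 0 0 0
  norm_num at f1
  have e1 : (sw 1 1 ⊠ id 1 ⨾ id 1 ⊠ sp .green 1 0 0 ⊠ id 1 : M) = sp .green 1 0 0 ⊠ id 2 := by
    rw [← tens_assoc, ← comp_tens_id (by simp), ← tens_sw (n := 1) (m := 0) (n' := 1) (m' := 1)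
      (by simp) (by simp) (by simp) (by simp), zero_sw, comp_id (by simp), tens_assoc, id_tens_id]
  have e2 : id 1 ⊠ a ⊠ id 1 ⨾ sp .green 1 0 0 ⊠ id 2 = sp .green 1 0 0 ⊠ id 3 ⨾ a ⊠ id 1 := by
    rw [exch (m := 1) (m' := 0) (n := 3) (by simp) (by simp) (by simp [h]) (by simp [h']),
      id_zero_tens]
  have e3 : (sp .green 1 2 0 ⊠ id 2 ⨾ sp .green 1 0 0 ⊠ id 3 : M) = id 3 := by
    have := congrArg (fun x => x ⊠ id 2) f1
    simpa only [comp_tens_id, dom_tens, cod_tens, dom_id, cod_id, dom_sp, cod_sp,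
      tens_assoc, id_tens_id, Nat.reduceAdd] using this
  rw [act₂, eps, e1, e2, reassoc e3, id_comp (by simp [h])]

/-! ### The slides of the generators -/

theorem slide_had_x : Slide had [(true, false)] [(false, true)] := by
  refine ⟨0, slideBy_of_short (by simp) (by simp) (by simp) (by simp) ?_⟩
  simp only [short, act_true_false, act_false_true, sp_one, List.length_singleton, id_tens_id]
  have h : (had ⊠ had ⨾ sp .green 2 1 0 : M) = sp .red 2 1 0 ⨾ had := two_had_sp .green 0
  rw [id_comp (by simp), actZ, actX, ← h, ← comp_assoc,
    right_left (by simp) (by simp)]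

theorem slide_had_z : Slide had [(false, true)] [(true, false)] := by
  refine ⟨0, slideBy_of_short (by simp) (by simp) (by simp) (by simp) ?_⟩
  simp only [short, act_true_false, act_false_true, sp_one, List.length_singleton, id_tens_id]
  have h : (had ⊠ had ⨾ sp .red 2 1 0 : M) = sp .green 2 1 0 ⨾ had := two_had_sp .red 0
  rw [id_comp (by simp), actZ, actX, comp_assoc, ← h, ← comp_assoc,
    ← comp_tens_comp (by simp) (by simp), had_had, id_comp (by simp)]

theorem slide_phase_z : Slide (sp .green 1 1 1) [(false, true)] [(false, true)] := by
  refine ⟨0, slideBy_of_short (by simp) (by simp) (by simp) (by simp) ?_⟩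
  simp only [short, act_false_true, sp_one, List.length_singleton, id_tens_id]
  have e : (id 1 ⊠ sp .green 1 1 1 ⨾ had ⊠ id 1 : M) = had ⊠ id 1 ⨾ id 1 ⊠ sp .green 1 1 1 :=
    exch (by simp) (by simp) (by simp) (by simp)
  have f := fuse_in_right (T := modThy) .green 1 1 1 0 1
  norm_num at f
  rw [id_comp (by simp), actZ, reassoc e, comp_assoc, f, comp_assoc, sp_comp, zero_add]

theorem slide_phase_x : Slide (sp .green 1 1 1) [(true, false)] [(true, true)] := by
  -- The phase cancels the 1 from `actX_phase` and the 2 from anticommutation, since 1 + 1 + 2 = 0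
  -- modulo 4.
  refine ⟨1, slideBy_of_short (by simp) (by simp) (by simp) (by simp) ?_⟩
  simp only [short, act_true_false, List.length_singleton]
  have h : conv actZ actX = ph 2 (act (true, true)) := conv_actZ_actX
  have e : (sp .green 1 1 1 ⊠ id 1 ⨾ sp .green 1 1 1 ⊠ sp .green 1 1 1 ⨾ sp .green 1 1 2 ⊠ id 1 : M) =
      id 1 ⊠ sp .green 1 1 1 := by
    rw [← comp_tens_comp (by simp) (by simp), ← comp_tens_comp (by simp) (by simp), sp_comp, sp_comp,
      id_comp (by simp), comp_id (by simp), show (1 + (1 + 2) : ZMod 4) = 0 from rfl, sp_one]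
  rw [actX_phase, h, ph, ← reassoc e]
  simp only [comp_assoc]

theorem slide_copy_x : Slide (sp .green 1 2 0) [(true, false)] [(true, false), (true, false)] := by
  refine ⟨0, slideBy_of_short (by simp) (by simp) (by simp) (by simp) ?_⟩
  simp only [short, act_true_false, sp_one, List.length_singleton, id_tens_id]
  rw [id_comp (by simp), bialg_act₂]


theorem slide_copy_z : Slide (sp .green 1 2 0) [(false, true)] [(false, true), (false, false)] := by
  refine ⟨0, slideBy_of_short (by simp) (by simp) (by simp) (by simp) ?_⟩
  simp only [short, act_false_true, act_false_false, sp_one, List.length_singleton, id_tens_id]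
  have e : (id 1 ⊠ sp .green 1 2 0 ⨾ had ⊠ id 2 : M) = had ⊠ id 1 ⨾ id 1 ⊠ sp .green 1 2 0 :=
    exch (by simp) (by simp) (by simp) (by simp)
  have f1 := sp_fuse' (T := modThy) .green 1 1 1 1 0 0
  have f2 := sp_comp (T := modThy) .green 2 2 0 0
  norm_num at f1 f2
  rw [act₂_eps (by simp) (by simp), id_comp (by simp), actZ, comp_tens_id (by simp), tens_assoc,
    id_tens_id, reassoc e, comp_assoc, f1, comp_assoc, f2]

/-- Through the cap, Z on the first qubit can be transferred to the second, where it meets another Z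
and cancels. -/
theorem slide_cap_z : Slide cap [(false, true), (false, true)] [] := by
  refine ⟨0, slideBy_of_short (by simp) (by simp) (by simp) (by simp) ?_⟩
  simp only [short, act_false_true, sp_one, List.length_cons, List.length_nil, Nat.reduceAdd,
    id_tens_id]
  have t : (actZ ⊠ id 1 ⨾ cap : M) = sw 1 1 ⊠ id 1 ⨾ id 1 ⊠ actZ ⨾ cap := by
    have f1 := fuse_in_left (T := modThy) .green 0 1 2 0 0
    have f2 := fuse_in_right (T := modThy) .green 0 1 2 0 0
    have f3 := swap_sp (T := modThy) .green 0 1 0 0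
    norm_num [id_zero_tens, tens_id_zero] at f1 f2 f3
    have e1 : (sw 1 1 ⊠ id 1 ⨾ id 1 ⊠ had ⊠ id 1 : M) = had ⊠ id 2 ⨾ sw 1 1 ⊠ id 1 := by
      rw [← tens_assoc, ← comp_tens_id (by simp), ← tens_sw (n := 1) (m := 1) (n' := 1) (m' := 1)
        (by simp) (by simp) (by simp) (by simp), comp_tens_id (by simp), tens_assoc, id_tens_id]
    rw [← sp_cap .green, actZ, comp_tens_id (by simp), tens_assoc, id_tens_id, comp_assoc, f1,
      id_tens_comp (by simp), comp_assoc, f2, reassoc e1, comp_assoc, f3]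
  have c : conv actZ actZ = sp .green 1 0 0 ⊠ id 1 := conv_actZ_actZ
  have c' := congrArg (fun x => x ⊠ id 1) c
  rw [conv, comp_tens_id (by simp), comp_tens_id (by simp), tens_assoc, tens_assoc, tens_assoc,
    id_tens_id] at c'
  have c'' := reassoc c' cap
  simp only [comp_assoc] at c''
  rw [t] at c''
  rw [id_comp (by simp), act₂]
  simp only [comp_assoc]
  have e := exch (T := modThy) (a := sp .green 1 0 0) (b := cap) (m := 1) (m' := 0) (n := 2)
    (n' := 0) (by simp) (by simp) (by simp) (by simp)
  rw [tens_id_zero, id_zero_tens] at e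
  rw [c'', e]

theorem slide_state : Slide (sp .red 0 1 0) [] [(false, true)] := by
  refine ⟨0, slideBy_of_short (by simp) (by simp) (by simp) (by simp) ?_⟩
  simp only [short, act_false_true, sp_one, List.length_nil, id_tens_id]
  have h : (id 1 ⊠ sp .red 0 1 0 ⨾ sp .green 2 1 0 : M) = sp .red 1 0 0 ⊠ sp .red 0 1 0 :=
    sp_state_cut .red
  have h2 : (had ⨾ sp .red 1 0 0 : M) = sp .green 1 0 0 := had_effect .red 0
  have e : (id 1 ⊠ sp .red 0 1 0 ⨾ had ⊠ id 1 : M) = had ⨾ id 1 ⊠ sp .red 0 1 0 := by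
    rw [exch (m := 1) (m' := 1) (n := 0) (n' := 1) (by simp) (by simp) (by simp) (by simp), tens_id_zero]
  rw [id_comp (by simp), actZ, reassoc e, comp_assoc, h,
    ← left_right (a := sp .red 1 0 0) (m := 0) (n := 0) (by simp) (by simp), tens_id_zero,
    id_zero_tens, reassoc h2]

theorem slideBy_effect : SlideBy 0 (sp .red 1 0 0) [(false, true)] [] := by
  refine slideBy_of_short (by simp) (by simp) (by simp) (by simp) ?_
  simp only [short, act_false_true, sp_one, List.length_singleton, id_tens_id]
  have h : (sp .green 2 1 0 ⨾ sp .red 1 0 0 : M) = sp .red 1 0 0 ⊠ sp .red 1 0 0 := effect_copy .green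
  have h2 : (had ⨾ sp .red 1 0 0 : M) = sp .green 1 0 0 := had_effect .red 0
  rw [id_comp (by simp), actZ, comp_assoc, h, ← comp_tens_comp (by simp) (by simp), h2,
    id_comp (by simp),
    ← right_left (a := sp .green 1 0 0) (m := 1) (n := 0) (by simp) (by simp), tens_id_zero]

/-- ⟨1| is an eigenvector of Z for the eigenvalue -1. The exact phase is needed here, since it
distinguishes the two measurement outcomes. -/
theorem slideBy_effect_two : SlideBy 2 (sp .red 1 0 2) [(false, true)] [] := by
  refine slideBy_of_short (by simp) (by simp) (by simp) (by simp) ?_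
  simp only [short, act_false_true, List.length_singleton]
  have h : (sp .green 2 1 0 ⨾ sp .red 1 0 2 : M) = sp .red 1 0 2 ⊠ sp .red 1 0 2 :=
    effect_copy_two .green
  have h2 : (had ⨾ sp .red 1 0 2 : M) = sp .green 1 0 2 := had_effect .red 2
  have h3 : (sp .green 1 1 2 ⨾ sp .green 1 0 2 : M) = sp .green 1 0 0 := sp_comp _ _ _ _ _
  rw [actZ, comp_assoc, h, ← comp_tens_comp (by simp) (by simp), h2, id_comp (by simp),
    ← comp_tens_comp (by simp) (by simp), h3, id_comp (by simp),
    ← right_left (a := sp .green 1 0 0) (m := 1) (n := 0) (by simp) (by simp), tens_id_zero]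

/-! ### Composite slides -/

theorem Slide.cod_eq {D : M} {p q : List (Bool × Bool)} (h : Slide D p q) : D.cod = q.length :=
  h.choose_spec.2.1

theorem cp_replicate (n : ℕ) : cp (List.replicate n (false, false)) = sw 1 n := by
  induction n with
  | zero => rw [sw_zero]; rfl
  | succ n ih =>
    rw [List.replicate_succ, cp, ih, act_false_false, weave_eps, List.length_replicate, ← sw_add,
      Nat.add_comm]

/-- The control of a trivial string merely crosses the qubits, and crossings are natural. -/
theorem Slide.trivial {D : M} {n m : ℕ} (h : D.dom = n) (h' : D.cod = m) :
    Slide D (List.replicate n (false, false)) (List.replicate m (false, false)) := by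
  refine ⟨0, by simpa using h, by simpa using h', ?_⟩
  rw [cp_replicate, cp_replicate, sp_one]
  exact tens_sw (by simp) (by simp) h h'

theorem slide_sw_left (p : Bool × Bool) : Slide (sw 1 1) [p, (false, false)] [(false, false), p] := by
  refine ⟨0, by simp, by simp, ?_⟩
  have e : weave (act p) ⊠ id 1 ⨾ sw 2 1 = sw 2 1 ⨾ id 1 ⊠ weave (act p) :=
    tens_sw (by simp) (by simp) (by simp) (by simp)
  rw [sw_two_one, comp_assoc] at e
  simp only [cp, act_false_false, weave_eps, List.length_cons, List.length_nil, Nat.reduceAdd,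
    tens_id_zero, id_tens_id, sp_one]
  rw [comp_id (by simp), comp_id (by simp), ← e, comp_assoc]

theorem slide_sw_right (p : Bool × Bool) :
    Slide (sw 1 1) [(false, false), p] [p, (false, false)] := by
  refine ⟨0, by simp, by simp, ?_⟩
  have e : id 1 ⊠ weave (act p) ⨾ sw 1 2 = sw 1 2 ⨾ weave (act p) ⊠ id 1 :=
    tens_sw (by simp) (by simp) (by simp) (by simp)
  rw [sw_one_two, comp_assoc] at e
  have s : (id 1 ⊠ sw 1 1 ⨾ id 1 ⊠ sw 1 1 : M) = id 3 := by
    rw [← id_tens_comp (by simp), sw_sw, id_tens_id]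
  have s' : (sw 1 1 ⊠ id 1 ⨾ sw 1 1 ⊠ id 1 : M) = id 3 := by
    rw [← comp_tens_id (by simp), sw_sw, id_tens_id]
  have e' := congrArg (fun x => sw 1 1 ⊠ id 1 ⨾ x ⨾ id 1 ⊠ sw 1 1) e
  simp only [comp_assoc] at e'
  rw [s, comp_id (by simp), reassoc s', id_comp (by simp)] at e'
  simp only [cp, act_false_false, weave_eps, List.length_cons, List.length_nil, Nat.reduceAdd,
    tens_id_zero, id_tens_id, sp_one]
  rw [comp_id (by simp), comp_id (by simp), comp_assoc, e']

theorem slide_sw (p q : Bool × Bool) : Slide (sw 1 1) [p, q] [q, p] := by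
  simpa [pmul] using (slide_sw_left p).mul (slide_sw_right q)

theorem slide_copy_z' : Slide (sp .green 1 2 0) [(false, true)] [(false, false), (false, true)] := by
  rw [← sp_sw]
  exact slide_copy_z.seq (slide_sw_left _)

theorem slide_cap_x : Slide cap [(true, false), (true, false)] [] := by
  have h : (cap : M) = had ⊠ had ⨾ cap := by
    rw [← left_right (a := had) (b := had) (m := 1) (n := 1) (by simp) (by simp), comp_assoc,
      ← had_cap, ← comp_assoc, ← comp_tens_id (by simp), had_had, id_tens_id, id_comp (by simp)]
  rw [h]
  exact (slide_had_x.par slide_had_x).seq slide_cap_z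

theorem red_copy_eq : (sp .red 1 2 0 : M) = had ⨾ sp .green 1 2 0 ⨾ had ⊠ had := by
  have h : (had ⨾ sp .green 1 2 0 : M) = sp .red 1 2 0 ⨾ had ⊠ had := had_sp_two .green 0
  rw [reassoc h, comp_assoc, ← comp_tens_comp (by simp) (by simp), had_had, id_tens_id,
    comp_id (by simp)]

theorem slide_red_copy_z : Slide (sp .red 1 2 0) [(false, true)] [(false, true), (false, true)] := by
  rw [red_copy_eq]
  exact slide_had_z.seq (slide_copy_x.seq (slide_had_x.par slide_had_x))

theorem slide_had_one : Slide had [(false, false)] [(false, false)] :=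
  Slide.trivial (n := 1) (m := 1) (by simp) (by simp)

theorem slide_red_copy_x : Slide (sp .red 1 2 0) [(true, false)] [(true, false), (false, false)] := by
  rw [red_copy_eq]
  exact slide_had_x.seq (slide_copy_z.seq (slide_had_z.par slide_had_one))

theorem slide_red_copy_x' :
    Slide (sp .red 1 2 0) [(true, false)] [(false, false), (true, false)] := by
  rw [red_copy_eq]
  exact slide_had_x.seq (slide_copy_z'.seq (slide_had_one.par slide_had_z))

/-- The red merge is a red copy with a cap on one leg, so its slides follow from those of the copy
and the cap. -/
theorem slide_merge_z : Slide (sp .red 2 1 0) [(false, true), (false, true)] [(false, true)] := by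
  rw [← sp_two_one]
  exact ((Slide.ident [(false, true)]).par slide_red_copy_z).seq
    (slide_cap_z.par (Slide.ident [(false, true)]))

theorem slide_merge_x : Slide (sp .red 2 1 0) [(true, false), (false, false)] [(true, false)] := by
  rw [← sp_two_one]
  have h : Slide (sp .red 1 2 0) [(false, false)] [(true, false), (true, false)] :=
    slide_red_copy_x.mul slide_red_copy_x'
  exact ((Slide.ident [(true, false)]).par h).seq (slide_cap_x.par (Slide.ident [(true, false)]))

theorem slide_merge_x' : Slide (sp .red 2 1 0) [(false, false), (true, false)] [(true, false)] := by
  rw [← sp_two_one]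
  have h : Slide cap [(false, false), (false, false)] [] :=
    Slide.trivial (n := 2) (m := 0) (by simp) (by simp)
  exact ((Slide.ident [(false, false)]).par slide_red_copy_x').seq
    (h.par (Slide.ident [(true, false)]))

/-- The controlled-not gate. -/
def cnot : M := sp .green 1 2 0 ⊠ id 1 ⨾ id 1 ⊠ sp .red 2 1 0

@[simp] theorem dom_cnot : cnot.dom = 2 := by simp [cnot]
@[simp] theorem cod_cnot : cnot.cod = 2 := by simp [cnot]

/-- By `Slide.mul` only X and Z on each of the two qubits need to be followed through the copy and
the merge. -/
theorem slide_cnot (x z x' z' : Bool) :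
    Slide cnot [(x, z), (x', z')] [(x, z ^^ z'), (x ^^ x', z')] := by
  have t : Slide cnot [(false, false), (false, false)] [(false, false), (false, false)] :=
    Slide.trivial (n := 2) (m := 2) (by simp) (by simp)
  have t' : Slide (sp .red 2 1 0) [(false, false), (false, false)] [(false, false)] :=
    Slide.trivial (n := 2) (m := 1) (by simp) (by simp)
  have t'' : Slide (sp .green 1 2 0) [(false, false)] [(false, false), (false, false)] :=
    Slide.trivial (n := 1) (m := 2) (by simp) (by simp)
  have h1 : Slide cnot [(x, false), (false, false)] [(x, false), (x, false)] := by
    cases x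
    · exact t
    · exact (slide_copy_x.par (Slide.ident [(false, false)])).seq
        ((Slide.ident [(true, false)]).par slide_merge_x)
  have h2 : Slide cnot [(false, z), (false, false)] [(false, z), (false, false)] := by
    cases z
    · exact t
    · exact (slide_copy_z.par (Slide.ident [(false, false)])).seq
        ((Slide.ident [(false, true)]).par t')
  have h3 : Slide cnot [(false, false), (x', false)] [(false, false), (x', false)] := by
    cases x'
    · exact t
    · exact (t''.par (Slide.ident [(true, false)])).seq
        ((Slide.ident [(false, false)]).par slide_merge_x')
  have h4 : Slide cnot [(false, false), (false, z')] [(false, z'), (false, z')] := by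
    cases z'
    · exact t
    · have : Slide (sp .green 1 2 0) [(false, false)] [(false, true), (false, true)] :=
        slide_copy_z.mul slide_copy_z'
      exact (this.par (Slide.ident [(false, true)])).seq
        ((Slide.ident [(false, true)]).par slide_merge_z)
  simpa [pmul] using (h1.mul h2).mul (h3.mul h4)

theorem slide_had (x z : Bool) : Slide had [(x, z)] [(z, x)] := by
  have h1 : Slide had [(x, false)] [(false, x)] := by
    cases x
    · exact slide_had_one
    · exact slide_had_x
  have h2 : Slide had [(false, z)] [(z, false)] := by
    cases z
    · exact slide_had_one
    · exact slide_had_z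
  simpa [pmul] using h1.mul h2

theorem slide_phase (x z : Bool) : Slide (sp .green 1 1 1) [(x, z)] [(x, z ^^ x)] := by
  have t : Slide (sp .green 1 1 1) [(false, false)] [(false, false)] :=
    Slide.trivial (n := 1) (m := 1) (by simp) (by simp)
  have h1 : Slide (sp .green 1 1 1) [(x, false)] [(x, x)] := by
    cases x
    · exact t
    · exact slide_phase_x
  have h2 : Slide (sp .green 1 1 1) [(false, z)] [(false, z)] := by
    cases z
    · exact t
    · exact slide_phase_z
  simpa [pmul, Bool.xor_comm] using h1.mul h2

theorem cnot_cnot : cnot ⨾ cnot = id 2 := by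
  have f1 := fuse_left (T := modThy) .green 1 1 2 0 0
  have f2 := fuse_right (T := modThy) .green 1 1 2 0 0
  have f3 := fuse_right (T := modThy) .green 1 1 0 0 0
  norm_num at f1 f2 f3
  have e : id 1 ⊠ actX ⨾ sp .green 1 2 0 ⊠ id 1 = sp .green 1 2 0 ⊠ id 2 ⨾ id 2 ⊠ actX :=
    exch (by simp) (by simp) (by simp) (by simp)
  have h1 : (sp .green 1 2 0 ⊠ id 1 ⨾ id 1 ⊠ sp .green 1 2 0 ⊠ id 1 : M) =
      sp .green 1 3 0 ⊠ id 1 := by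
    rw [← f2, comp_tens_id (by simp), tens_assoc]
  have h2 : (sp .green 1 2 0 ⊠ id 1 ⨾ sp .green 1 2 0 ⊠ id 2 : M) = sp .green 1 3 0 ⊠ id 1 := by
    rw [← f1, comp_tens_id (by simp), tens_assoc, id_tens_id]
  have c := congrArg (fun x => sp .green 1 2 0 ⊠ id 1 ⨾ id 1 ⊠ x) conv_actX_actX
  simp only [conv] at c
  rw [id_tens_comp (by simp), id_tens_comp (by simp), id_tens_id_tens, reassoc h1, ← tens_assoc,
    ← comp_tens_id (by simp), f3, id_tens_id] at c
  change (sp .green 1 2 0 ⊠ id 1 ⨾ id 1 ⊠ actX) ⨾ sp .green 1 2 0 ⊠ id 1 ⨾ id 1 ⊠ actX = id 2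
  rw [comp_assoc, reassoc e, comp_assoc, reassoc h2, c]

/-! ### Symplectic form -/

/-- Whether two strings of Pauli operators anticommute. -/
def symp : List (Bool × Bool) → List (Bool × Bool) → Bool
  | p :: l, q :: l' => ((p.1 && q.2) ^^ (p.2 && q.1)) ^^ symp l l'
  | _, _ => false

/-- The form ignores what exceeds the shorter string, so additivity requires aligned first parts. -/
theorem symp_append {a b a' b' : List (Bool × Bool)} (h : a.length = a'.length) :
    symp (a ++ b) (a' ++ b') = (symp a a' ^^ symp b b') := by
  induction a generalizing a' with
  | nil =>
    obtain rfl : a' = [] := List.length_eq_zero_iff.1 h.symm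
    simp [symp]
  | cons p a ih =>
    cases a' with
    | nil => simp at h
    | cons p' a' => simp [symp, ih (a' := a') (by simpa using h)]

theorem symp_mul (v a b : List (Bool × Bool)) (h : v.length = a.length) (h' : v.length = b.length) :
    symp v (a.zipWith pmul b) = (symp v a ^^ symp v b) := by
  induction v generalizing a b with
  | nil => simp [symp]
  | cons p v ih =>
    rcases a with _ | ⟨q, a⟩
    · simp at h
    rcases b with _ | ⟨r, b⟩
    · simp at h'
    simp only [symp, List.zipWith_cons_cons, ih a b (by simpa using h) (by simpa using h'), pmul]
    generalize symp v a = s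
    generalize symp v b = t
    clear ih h h'
    revert p q r s t
    decide

theorem symp_comm (a b : List (Bool × Bool)) : symp a b = symp b a := by
  induction a generalizing b with
  | nil => cases b <;> simp [symp]
  | cons p a ih => 
    cases b with
    | nil => simp [symp]
    | cons q b => simp only [symp, ih b]; grind

theorem symp_replicate (n : ℕ) (v : List (Bool × Bool)) :
    symp (List.replicate n (false, false)) v = false := by
  induction n generalizing v with
  | zero => simp [symp]
  | succ n ih => cases v <;> simp [symp, List.replicate_succ, ih]

theorem exists_split {v : List (Bool × Bool)} {i n j : ℕ} (h : v.length = i + (n + j)) :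
    ∃ a p b, v = a ++ (p ++ b) ∧ a.length = i ∧ p.length = n ∧ b.length = j :=
  ⟨v.take i, (v.drop i).take n, (v.drop i).drop n, by simp, by simp; omega, by simp; omega,
    by simp; omega⟩

theorem Slide.pad {U : M} {p q a b : List (Bool × Bool)} {i j : ℕ} (h : Slide U p q)
    (ha : a.length = i) (hb : b.length = j) :
    Slide (id i ⊠ U ⊠ id j) (a ++ (p ++ b)) (a ++ (q ++ b)) := by
  subst ha hb
  exact (Slide.ident a).par (h.par (Slide.ident b))

/-- Every Pauli string on the outputs of a state stabilises it, or anticommutes with one that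
does. -/
def Dich (φ : M) : Prop :=
  ∀ v : List (Bool × Bool), v.length = φ.cod →
    Slide φ [] v ∨ ∃ w, Slide φ [] w ∧ symp v w = true

/-- Conjugation by `U` is a symplectic bijection of Pauli strings. -/
def Clifford (n : ℕ) (U : M) : Prop :=
  U.dom = n ∧ U.cod = n ∧ ∀ v : List (Bool × Bool), v.length = n → ∃ p, p.length = n ∧ Slide U p v ∧
    ∀ w : List (Bool × Bool), w.length = n → ∃ w', Slide U w w' ∧ symp v w' = symp p w

/-- Pull the string back through `U` and use the dichotomy of `φ`. An anticommuting stabiliser is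
pushed forward again, which preserves the symplectic form. -/
theorem Dich.clifford {φ U : M} {i n j : ℕ} (h : Dich φ) (hc : φ.cod = i + (n + j))
    (hU : Clifford n U) : Dich (φ ⨾ id i ⊠ U ⊠ id j) := by
  obtain ⟨h1, h2, hU⟩ := hU
  intro v hv
  obtain ⟨a, v, b, rfl, ha, hv', hb⟩ := exists_split (i := i) (n := n) (j := j) (by simpa [h2] using hv)
  obtain ⟨p, hp, hpv, hw⟩ := hU v hv'
  rcases h (a ++ (p ++ b)) (by simp [ha, hp, hb, hc]) with h | ⟨w, h, hs⟩
  · exact .inl (h.seq (hpv.pad ha hb))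
  · obtain ⟨a', w, b', rfl, ha', hw', hb'⟩ := exists_split (v := w) (h.cod_eq.symm.trans hc)
    obtain ⟨w', hww', hs'⟩ := hw w hw'
    refine .inr ⟨_, h.seq (hww'.pad ha' hb'), ?_⟩
    have l : v.length = w'.length := by rw [hv', ← h2, hww'.cod_eq]
    rw [symp_append (by rw [ha, ha']), symp_append (by rw [hp, hw'])] at hs
    rw [symp_append (by rw [ha, ha']), symp_append l, hs', hs]

/-- Modulo signs, conjugation by the Hadamard or the phase gate is an involution, so one table `f`
serves both to push forward and to pull back. -/
theorem clifford_one {U : M} (h : U.dom = 1) (h' : U.cod = 1) (f : Bool → Bool → Bool × Bool)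
    (hs : ∀ x z, Slide U [(x, z)] [f x z]) (hf : ∀ x z, f (f x z).1 (f x z).2 = (x, z))
    (hω : ∀ x z x' z', symp [f x z] [f x' z'] = symp [(x, z)] [(x', z')]) : Clifford 1 U := by
  refine ⟨h, h', fun v hv => ?_⟩
  obtain ⟨⟨x, z⟩, rfl⟩ := List.length_eq_one_iff.1 hv
  refine ⟨[f x z], rfl, ?_, fun w hw => ?_⟩
  · have := hs (f x z).1 (f x z).2
    rwa [hf] at this
  · obtain ⟨⟨x', z'⟩, rfl⟩ := List.length_eq_one_iff.1 hw
    refine ⟨_, hs x' z', ?_⟩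
    have := hω (f x z).1 (f x z).2 x' z'
    rwa [hf] at this

theorem clifford_had : Clifford 1 had :=
  clifford_one (by simp) (by simp) (fun x z => (z, x)) slide_had (by simp) (by simp [symp])

theorem clifford_phase : Clifford 1 (sp .green 1 1 1) :=
  clifford_one (by simp) (by simp) (fun x z => (x, z ^^ x)) slide_phase (by simp)
    (by simp [symp])

theorem clifford_sw : Clifford 2 (sw 1 1) := by
  refine ⟨by simp, by simp, fun v hv => ?_⟩
  obtain ⟨p, q, rfl⟩ := List.length_eq_two.1 hv
  refine ⟨[q, p], rfl, slide_sw q p, fun w hw => ?_⟩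
  obtain ⟨p', q', rfl⟩ := List.length_eq_two.1 hw
  exact ⟨_, slide_sw p' q', by simp only [symp]; grind⟩

theorem clifford_cnot : Clifford 2 cnot := by
  refine ⟨by simp, by simp, fun v hv => ?_⟩
  obtain ⟨⟨x, z⟩, ⟨x', z'⟩, rfl⟩ := List.length_eq_two.1 hv
  refine ⟨[(x, z ^^ z'), (x ^^ x', z')], rfl, ?_, fun w hw => ?_⟩
  · simpa using slide_cnot x (z ^^ z') (x ^^ x') z'
  · obtain ⟨⟨a, b⟩, ⟨a', b'⟩, rfl⟩ := List.length_eq_two.1 hw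
    refine ⟨_, slide_cnot a b a' b', ?_⟩
    simp only [symp]
    revert x z x' z' a b a' b'
    decide

end Q

end ZX

end

/-! ### Entrywise evaluation, and soundness of topological equality -/

noncomputable section

namespace ZX

open Diag

set_option linter.unusedSimpArgs false

/-! ### Evaluation of the standard interpretation on bit sequences -/

namespace Diag

/-- The entry of the interpretation at the initial parts of two bit sequences. -/
def ev {n m : ℕ} (D : Diag n m) (y x : ℕ → Fin 2) : ℂ :=
  D.interp (fun i => y i) (fun i => x i)

/-- Extension of a bit string by zeros. -/
def ext {n : ℕ} (z : Fin n → Fin 2) (i : ℕ) : Fin 2 := if h : i < n then z ⟨i, h⟩ else 0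

theorem ext_restrict {n : ℕ} (z : Fin n → Fin 2) : (fun i : Fin n => ext z i) = z := by
  funext i
  simp [ext]

theorem ev_congr {n m : ℕ} (D : Diag n m) {y y' x x' : ℕ → Fin 2} (h : ∀ i < m, y i = y' i)
    (h' : ∀ i < n, x i = x' i) : ev D y x = ev D y' x' := by
  have e : (fun i : Fin m => y i) = fun i : Fin m => y' i := funext fun i => h i i.2
  have e' : (fun i : Fin n => x i) = fun i : Fin n => x' i := funext fun i => h' i i.2
  rw [ev, ev, e, e']

theorem interp_eq_ev {n m : ℕ} (D : Diag n m) (y : Fin m → Fin 2) (x : Fin n → Fin 2) :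
    D.interp y x = ev D (ext y) (ext x) := by
  rw [ev, ext_restrict, ext_restrict]

theorem interp_eq_zero_iff {n m : ℕ} (D : Diag n m) : D.interp = 0 ↔ ∀ y x, ev D y x = 0 := by
  refine ⟨fun h y x => by rw [ev, h]; rfl, fun h => ?_⟩
  ext y x
  rw [interp_eq_ev, h]
  rfl

/-- The sequence without its first `k` entries. -/
def drop (k : ℕ) (y : ℕ → Fin 2) (i : ℕ) : Fin 2 := y (k + i)

/-- The product of the entries of a basis vector selected by `n` bits. -/
def bprod (c : Colour) (b : Fin 2) (n : ℕ) (y : ℕ → Fin 2) : ℂ :=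
  ∏ i ∈ Finset.range n, basisVec c b (y i)

theorem tensorPow_eq (c : Colour) (b : Fin 2) (n : ℕ) (y : ℕ → Fin 2) :
    tensorPow (basisVec c b) (fun i : Fin n => y i) = bprod c b n y :=
  Fin.prod_univ_eq_prod_range (fun i => basisVec c b (y i)) n

theorem ev_wires (n : ℕ) (y x : ℕ → Fin 2) :
    ev (wires n) y x = if ∀ i < n, y i = x i then 1 else 0 := by
  simp [ev, interp, Matrix.one_apply, funext_iff, Fin.forall_iff]

theorem ev_swap (n m : ℕ) (y x : ℕ → Fin 2) : ev (swap n m) y x =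
    if (∀ i < n, y (m + i) = x i) ∧ ∀ i < m, y i = x (n + i) then 1 else 0 := by
  simp [ev, interp, Fin.forall_iff]

theorem ev_cup (y x : ℕ → Fin 2) : ev cup y x = if y 0 = y 1 then 1 else 0 := rfl

theorem ev_cap (y x : ℕ → Fin 2) : ev cap y x = if x 0 = x 1 then 1 else 0 := rfl

theorem ev_spider (c : Colour) (n m : ℕ) (α : Real.Angle) (y x : ℕ → Fin 2) :
    ev (spider c n m α) y x = bprod c 0 m y * bprod c 0 n x +
      (Real.Angle.toCircle α : ℂ) * (bprod c 1 m y * bprod c 1 n x) := by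
  simp only [ev, interp, tensorPow_eq]

theorem ev_had (y x : ℕ → Fin 2) : ev had y x = basisVec .red (x 0) (y 0) := rfl

theorem ev_star (y x : ℕ → Fin 2) : ev star y x = 1 / 2 := rfl

theorem ev_par {n m n' m' : ℕ} (D : Diag n m) (E : Diag n' m') (y x : ℕ → Fin 2) :
    ev (par D E) y x = ev D y x * ev E (drop m y) (drop n x) := rfl

theorem ev_retype {n n' m : ℕ} (h : n = n') (D : Diag n m) : ev (retype h D) = ev D := by
  subst h
  rfl

theorem ev_seq {n m k : ℕ} (D : Diag n m) (E : Diag m k) (y x : ℕ → Fin 2) :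
    ev (seq D E) y x = ∑ z : Fin m → Fin 2, ev E y (ext z) * ev D (ext z) x := by
  simp only [ev, interp, Matrix.mul_apply, ext_restrict]

/-- A composite to which only one intermediate bit string contributes. -/
theorem ev_seq_single {n m k : ℕ} (D : Diag n m) (E : Diag m k) (y x z₀ : ℕ → Fin 2)
    (h : ∀ z : ℕ → Fin 2, ev E y z * ev D z x ≠ 0 → ∀ i < m, z i = z₀ i) :
    ev (seq D E) y x = ev E y z₀ * ev D z₀ x := by
  rw [ev_seq, Fintype.sum_eq_single (fun i : Fin m => z₀ i)]
  · rw [ev_congr E (fun _ _ => rfl) (fun i hi => _), ev_congr D (fun i hi => _) (fun _ _ => rfl)]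
    all_goals intro i hi; simp [ext, hi]
  · intro z hz
    by_contra h'
    refine hz (funext fun i => ?_)
    rw [← h _ h' i i.2]
    simp [ext]

/-- A composite to which only the intermediate bit strings contribute that differ from a given one
at most at the position `j`. -/
theorem ev_seq_update {n m k : ℕ} (D : Diag n m) (E : Diag m k) (y x z₀ : ℕ → Fin 2) (j : ℕ)
    (hj : j < m)
    (h : ∀ z : ℕ → Fin 2, ev E y z * ev D z x ≠ 0 → ∀ i < m, i ≠ j → z i = z₀ i) :
    ev (seq D E) y x = ∑ b : Fin 2, ev E y (Function.update z₀ j b) *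
      ev D (Function.update z₀ j b) x := by
  rw [ev_seq]
  symm
  refine Finset.sum_of_injOn (fun b => fun i : Fin m => Function.update z₀ j b i) ?_ (by simp) ?_ ?_
  · intro b _ b' _ hb
    simpa using congrFun hb ⟨j, hj⟩
  · intro z _ hz
    by_contra h'
    refine hz ⟨z ⟨j, hj⟩, by simp, funext fun i => ?_⟩
    by_cases hi : (i : ℕ) = j
    · subst hi
      simp
    · have := h _ h' i i.2 hi
      simp [Function.update_of_ne hi, ← this, ext]
  · intro b _
    rw [ev_congr E (fun _ _ => rfl) (fun i hi => _), ev_congr D (fun i hi => _) (fun _ _ => rfl)]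
    all_goals intro i hi; simp [ext, hi]

end Diag

/-! ### Proportional diagrams -/

/-- The interpretations agree up to a nonzero factor. -/
def Sim {n m n' m' : ℕ} (D : Diag n m) (E : Diag n' m') : Prop :=
  n = n' ∧ m = m' ∧ ∃ c : ℂ, c ≠ 0 ∧ ∀ y x, ev D y x = c * ev E y x

theorem Sim.of_eq {n m n' m' : ℕ} {D : Diag n m} {E : Diag n' m'} (h : n = n') (h' : m = m')
    (he : ∀ y x, ev D y x = ev E y x) : Sim D E :=
  ⟨h, h', 1, one_ne_zero, fun y x => by rw [he, one_mul]⟩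

/-- The factor does not depend on the entries, so it can be taken out of the sums in matrix
products. -/
theorem Sim.of_cong {R : DRel} (hR : ∀ {n m n' m' : ℕ} {D : Diag n m} {E : Diag n' m'},
    R D E → Sim D E) {n m n' m' : ℕ} {D : Diag n m} {E : Diag n' m'} (h : Cong R D E) :
    Sim D E := by
  induction h with
  | of h => exact hR h
  | refl D => exact .of_eq rfl rfl fun _ _ => rfl
  | symm _ ih =>
    obtain ⟨h, h', c, hc, ih⟩ := ih
    exact ⟨h.symm, h'.symm, c⁻¹, inv_ne_zero hc, fun y x => by rw [ih, inv_mul_cancel_left₀ hc]⟩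
  | trans _ _ ih ih' =>
    obtain ⟨h1, h2, c, hc, ih⟩ := ih
    obtain ⟨h1', h2', c', hc', ih'⟩ := ih'
    exact ⟨h1.trans h1', h2.trans h2', c * c', mul_ne_zero hc hc', fun y x => by
      rw [ih, ih', mul_assoc]⟩
  | seq _ _ ih ih' =>
    obtain ⟨h1, rfl, c, hc, ih⟩ := ih
    obtain ⟨-, h2', c', hc', ih'⟩ := ih'
    refine ⟨h1, h2', c * c', mul_ne_zero hc hc', fun y x => ?_⟩
    rw [ev_seq, ev_seq, Finset.mul_sum]
    refine Finset.sum_congr rfl fun z _ => ?_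
    rw [ih, ih']
    ring
  | par _ _ ih ih' =>
    obtain ⟨rfl, rfl, c, hc, ih⟩ := ih
    obtain ⟨rfl, rfl, c', hc', ih'⟩ := ih'
    refine ⟨rfl, rfl, c * c', mul_ne_zero hc hc', fun y x => ?_⟩
    rw [ev_par, ev_par, ih, ih']
    ring

theorem Sim.interp_eq_zero {n m n' m' : ℕ} {D : Diag n m} {E : Diag n' m'} (h : Sim D E) :
    D.interp = 0 ↔ E.interp = 0 := by
  obtain ⟨-, -, c, hc, h⟩ := h
  simp [interp_eq_zero_iff, h, hc]

/-! ### Soundness of the topological equalities -/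

theorem bprod_drop (c : Colour) (b : Fin 2) (m n : ℕ) (y : ℕ → Fin 2) :
    bprod c b (m + n) y = bprod c b m y * bprod c b n (drop m y) := by
  simp [bprod, Finset.prod_range_add, drop]

theorem bprod_swap (c : Colour) (b : Fin 2) {n i : ℕ} (hi : i + 1 < n) (y : ℕ → Fin 2) :
    bprod c b n (y ∘ Equiv.swap i (i + 1)) = bprod c b n y := by
  refine Finset.prod_bij (fun j _ => Equiv.swap i (i + 1) j) ?_ ?_ ?_ ?_
  · intro j hj
    simp only [Finset.mem_range] at *
    rcases eq_or_ne j i with rfl | h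
    · simpa using hi
    rcases eq_or_ne j (i + 1) with rfl | h'
    · simp; omega
    · rwa [Equiv.swap_apply_of_ne_of_ne h h']
  · intro a _ b _ h
    exact (Equiv.swap i (i + 1)).injective h
  · intro j hj
    refine ⟨Equiv.swap i (i + 1) j, ?_, by simp⟩
    simp only [Finset.mem_range] at *
    rcases eq_or_ne j i with rfl | h
    · simpa using hi
    rcases eq_or_ne j (i + 1) with rfl | h'
    · simp; omega
    · rwa [Equiv.swap_apply_of_ne_of_ne h h']
  · intro j _
    rfl

theorem basisVec_red_comm (i j : Fin 2) : basisVec .red i j = basisVec .red j i := by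
  simp [basisVec, mul_comm]

theorem bprod_congr (c : Colour) (b : Fin 2) {n : ℕ} {y y' : ℕ → Fin 2} (h : ∀ i < n, y i = y' i) :
    bprod c b n y = bprod c b n y' :=
  Finset.prod_congr rfl fun i hi => by rw [h i (Finset.mem_range.1 hi)]

/-- The intermediate bit strings of a composite of juxtapositions are concatenations of independent
ones. -/
theorem ev_seq_par {n m k n' m' k' : ℕ} (D : Diag n m) (E : Diag m k) (D' : Diag n' m')
    (E' : Diag m' k') (y x : ℕ → Fin 2) :
    ev (par (seq D E) (seq D' E')) y x = ev (seq (par D D') (par E E')) y x := by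
  rw [ev_par, ev_seq, ev_seq, ev_seq, Finset.sum_mul_sum, ← Fintype.sum_prod_type']
  refine Fintype.sum_equiv (Fin.appendEquiv m m') _ _ fun z => ?_
  obtain ⟨z, z'⟩ := z
  have h : ∀ i < m, ext (Fin.append z z') i = ext z i := fun i hi => by
    have := Fin.append_left z z' ⟨i, hi⟩
    simp only [ext, hi, show i < m + m' by omega, dite_true]
    exact this
  have h' : ∀ i < m', drop m (ext (Fin.append z z')) i = ext z' i := fun i hi => by
    have := Fin.append_right z z' ⟨i, hi⟩
    simp only [drop, ext, hi, show m + i < m + m' by omega, dite_true]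
    exact this
  change _ = ev (par E E') y (ext (Fin.append z z')) * ev (par D D') (ext (Fin.append z z')) x
  rw [ev_par, ev_par, ev_congr E (fun _ _ => rfl) h, ev_congr E' (fun _ _ => rfl) h',
    ev_congr D h (fun _ _ => rfl), ev_congr D' h' (fun _ _ => rfl)]
  ring

theorem ev_seq_wires {n m : ℕ} (D : Diag n m) (y x : ℕ → Fin 2) :
    ev (seq D (wires m)) y x = ev D y x := by
  simp only [ev, interp, Matrix.one_mul]

theorem ev_wires_seq {n m : ℕ} (D : Diag n m) (y x : ℕ → Fin 2) :
    ev (seq (wires n) D) y x = ev D y x := by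
  simp only [ev, interp, Matrix.mul_one]

theorem ev_seq_swap {n a b : ℕ} (D : Diag n (a + b)) (y x : ℕ → Fin 2) :
    ev (seq D (swap a b)) y x = ev D (fun i => if i < a then y (b + i) else y (i - a)) x := by
  rw [ev_seq_single (z₀ := fun i => if i < a then y (b + i) else y (i - a)), ev_swap, if_pos,
    one_mul]
  · exact ⟨fun i hi => by simp [hi], fun i hi => by simp⟩
  · intro z hz i hi
    rw [ev_swap] at hz
    split_ifs at hz with h
    · by_cases hi' : i < a
      · simp [hi', h.1 i hi']
      · simp [hi', h.2 (i - a) (by omega), show a + (i - a) = i by omega]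
    · simp at hz

theorem ev_swap_seq {m a b : ℕ} (E : Diag (b + a) m) (y x : ℕ → Fin 2) :
    ev (seq (swap a b) E) y x = ev E y (fun i => if i < b then x (a + i) else x (i - b)) := by
  rw [ev_seq_single (z₀ := fun i => if i < b then x (a + i) else x (i - b)), ev_swap, if_pos,
    mul_one]
  · exact ⟨fun i hi => by simp, fun i hi => by simp [hi]⟩
  · intro z hz i hi
    rw [ev_swap] at hz
    split_ifs at hz with h
    · by_cases hi' : i < b
      · simp [hi', h.2 i hi']
      · simp [hi', ← h.1 (i - b) (by omega), show b + (i - b) = i by omega]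
    · simp at hz

theorem forall_lt_add {m n : ℕ} {P : ℕ → Prop} :
    (∀ i < m + n, P i) ↔ (∀ i < m, P i) ∧ ∀ i < n, P (m + i) := by
  refine ⟨fun h => ⟨fun i hi => h i (by omega), fun i hi => h _ (by omega)⟩, fun h i hi => ?_⟩
  by_cases hm : i < m
  · exact h.1 i hm
  · have := h.2 (i - m) (by omega)
    rwa [show m + (i - m) = i by omega] at this

theorem ev_transposition (a b : ℕ) (y x : ℕ → Fin 2) :
    ev (par (par (wires a) (swap 1 1)) (wires b)) y x =
      if ∀ i < a + (1 + 1) + b, y i = x (Equiv.swap a (a + 1) i) then 1 else 0 := by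
  have h1 : ∀ i < a, Equiv.swap a (a + 1) i = i := fun i hi =>
    Equiv.swap_apply_of_ne_of_ne (by omega) (by omega)
  have h2 : ∀ i, Equiv.swap a (a + 1) (a + (1 + 1) + i) = a + (1 + 1) + i := fun i =>
    Equiv.swap_apply_of_ne_of_ne (by omega) (by omega)
  rw [ev_par, ev_par, ev_wires, ev_wires, ev_swap, ite_zero_mul_ite_zero, ite_zero_mul_ite_zero,
    one_mul, one_mul]
  refine if_congr ?_ rfl rfl
  simp only [forall_lt_add, Nat.lt_one_iff, forall_eq, drop, h2, add_zero, Equiv.swap_apply_left,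
    Equiv.swap_apply_right]
  refine and_congr_left fun _ => ?_
  rw [and_comm (a := y (a + 1) = _)]
  exact and_congr_left fun _ => forall₂_congr fun i hi => by rw [h1 i hi]

theorem ev_seq_transposition {n a b : ℕ} (D : Diag n (a + (1 + 1) + b)) (y x : ℕ → Fin 2) :
    ev (seq D (par (par (wires a) (swap 1 1)) (wires b))) y x =
      ev D (y ∘ Equiv.swap a (a + 1)) x := by
  rw [ev_seq_single (z₀ := y ∘ Equiv.swap a (a + 1)), ev_transposition, if_pos, one_mul]
  · simp
  · intro z hz i hi
    rw [ev_transposition] at hz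
    split_ifs at hz with h
    · have := h (Equiv.swap a (a + 1) i) ?_
      · simpa using this.symm
      · rw [Equiv.swap_apply_def]
        split_ifs <;> omega
    · simp at hz

theorem bprod_succ (c : Colour) (b : Fin 2) (n : ℕ) (y : ℕ → Fin 2) :
    bprod c b (n + 1) y = bprod c b n y * basisVec c b (y n) :=
  Finset.prod_range_succ _ _

theorem ev_bend_input (c : Colour) (n m : ℕ) (α : Real.Angle) (y x : ℕ → Fin 2) :
    ev (seq (par (wires n) cup) (par (n := n + 1) (n' := 1) (spider c (n + 1) m α) (wires 1))) y x =
      ev (spider c n (m + 1) α) y x := by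
  rw [ev_seq_single (z₀ := fun i => if i < n then x i else y m)]
  · simp only [ev_par, ev_wires, ev_cup, ev_spider, drop, Nat.lt_one_iff, forall_eq, bprod_succ,
      lt_irrefl, if_false, add_zero, Nat.not_lt.2 (Nat.le_add_right n _), if_true, mul_one]
    rw [if_pos (fun i hi => by simp [hi])]
    have e : ∀ b, bprod c b n (fun i => if i < n then x i else y m) = bprod c b n x :=
      fun b => bprod_congr c b (fun i hi => by simp [hi])
    rw [e, e]
    ring
  · intro z hz i hi
    simp only [ev_par, ev_wires, ev_cup, drop, Nat.lt_one_iff, forall_eq, add_zero] at hz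
    by_cases h1 : ∀ i < n, z i = x i
    · by_cases h2 : z n = z (n + 1)
      · by_cases h3 : y m = z (n + 1)
        · by_cases hn : i < n
          · simp [hn, h1 i hn]
          · have : i = n ∨ i = n + 1 := by omega
            rcases this with e | e <;> simp [e, h2, h3]
        · simp [h3] at hz
      · simp [h2] at hz
    · simp [h1] at hz

theorem ev_bend_output (c : Colour) (n m : ℕ) (α : Real.Angle) (y x : ℕ → Fin 2) :
    ev (seq (par (spider c n (m + 1) α) (wires 1)) (par (n := m) (n' := 2) (wires m) cap)) y x =
      ev (spider c (n + 1) m α) y x := by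
  rw [ev_seq_single (z₀ := fun i => if i < m then y i else x n)]
  · simp only [ev_par, ev_wires, ev_cap, ev_spider, drop, Nat.lt_one_iff, forall_eq, bprod_succ,
      lt_irrefl, if_false, add_zero, Nat.not_lt.2 (Nat.le_add_right m _), if_true, mul_one]
    rw [if_pos (fun i hi => by simp [hi])]
    have e : ∀ b, bprod c b m (fun i => if i < m then y i else x n) = bprod c b m y :=
      fun b => bprod_congr c b (fun i hi => by simp [hi])
    rw [e, e]
    ring
  · intro z hz i hi
    simp only [ev_par, ev_wires, ev_cap, drop, Nat.lt_one_iff, forall_eq, add_zero] at hz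
    by_cases h1 : ∀ i < m, y i = z i
    · by_cases h2 : z m = z (m + 1)
      · by_cases h3 : z (m + 1) = x n
        · by_cases hn : i < m
          · simp [hn, h1 i hn]
          · have : i = m ∨ i = m + 1 := by omega
            rcases this with e | e <;> simp [e, h2, h3]
        · simp [h3] at hz
      · simp [h2] at hz
    · simp [h1] at hz

theorem TopAx.sim {n m n' m' : ℕ} {D : Diag n m} {E : Diag n' m'} (h : TopAx D E) : Sim D E := by
  refine Sim.of_eq h.arity.1 h.arity.2 fun y x => ?_
  cases h with
  | seq_assoc D E F => simp only [ev, interp, Matrix.mul_assoc]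
  | wires_seq D => exact ev_wires_seq _ _ _
  | seq_wires D => exact ev_seq_wires _ _ _
  | par_assoc D E F =>
    simp only [ev_par, mul_assoc]
    congr 3 <;> funext i <;> simp [drop, add_assoc]
  | empty_par D =>
    simp only [ev_par, ev_wires, Nat.not_lt_zero, false_imp_iff, implies_true, if_true, one_mul]
    exact ev_congr _ (fun i _ => by simp [drop]) (fun i _ => by simp [drop])
  | par_empty D => simp [ev_par, ev_wires]
  | wires_par n m =>
    rw [ev_par, ev_wires, ev_wires, ev_wires, ite_zero_mul_ite_zero, one_mul]
    exact if_congr forall_lt_add.symm rfl rfl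
  | interchange D E D' E' => exact ev_seq_par _ _ _ _ _ _
  | swap_swap n m =>
    rw [ev_seq_swap, ev_swap, ev_wires]
    refine if_congr ?_ rfl rfl
    rw [forall_lt_add]
    refine and_congr (forall₂_congr fun i hi => ?_) (forall₂_congr fun i hi => ?_)
    · simp
    · simp [hi]
  | swap_natural D E =>
    rw [ev_seq_swap, ev_swap_seq, ev_par, ev_par, mul_comm]
    congr 1
    · exact ev_congr _ (fun i hi => by simp [drop]) (fun i hi => by simp [hi, drop])
    · exact ev_congr _ (fun i hi => by simp [drop, hi]) (fun i hi => by simp [drop])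
  | swap_empty n => simp [ev_swap, ev_wires]
  | swap_add n m k =>
    have hE : ∀ z, ev (retype (Nat.add_assoc m n k).symm (par (wires m) (swap n k))) y z =
        if (∀ i < m, y i = z i) ∧ (∀ i < n, y (m + (k + i)) = z (m + i)) ∧
          ∀ i < k, y (m + i) = z (m + (n + i)) then 1 else 0 := fun z => by
      rw [ev_retype, ev_par, ev_wires, ev_swap, ite_zero_mul_ite_zero, one_mul]
      rfl
    -- The second factor is a permutation of bits, so the output determines the intermediate string:
    -- the first `m` bits are kept and the blocks of lengths `n` and `k` are exchanged.
    rw [ev_seq_single (z₀ := fun i => if i < m then y i else if i < m + n then y (k + i) else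
      y (i - n)), hE, if_pos, ev_par, ev_swap, ev_wires, ite_zero_mul_ite_zero, ev_swap, one_mul,
      one_mul]
    · refine if_congr ?_ rfl rfl
      simp only [forall_lt_add (m := m) (n := k), and_assoc, drop]
      refine and_congr (forall₂_congr fun i hi => ?_)
        (and_congr (forall₂_congr fun i hi => ?_) (forall₂_congr fun i hi => ?_))
      · simp [hi, show k + (m + i) = m + k + i by omega]
      · simp [hi]
      · simp [show ¬ m + n + i < m by omega, show m + n + i - n = m + i by omega,
          show n + m + i = n + (m + i) by omega]
    · refine ⟨fun i hi => by simp [hi], fun i hi => ?_, fun i hi => ?_⟩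
      · simp [hi, show k + (m + i) = m + (k + i) by omega]
      · simp [show m + (n + i) - n = m + i by omega]
    · intro z hz i hi
      rw [hE] at hz
      split_ifs at hz with h
      · obtain ⟨h1, h2, h3⟩ := h
        by_cases hm : i < m
        · simp [hm, h1 i hm]
        by_cases hn : i < m + n
        · have := h2 (i - m) (by omega)
          simp only [hm, hn, if_true, if_false]
          rw [show k + i = m + (k + (i - m)) by omega, this, show m + (i - m) = i by omega]
        · have := h3 (i - (m + n)) (by omega)
          simp only [hm, hn, if_false]
          rw [show i - n = m + (i - (m + n)) by omega, this,
            show m + (n + (i - (m + n))) = i by omega]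
      · simp at hz
  | snake_left =>
    rw [ev_seq_single (z₀ := fun _ => x 0)]
    · simp [ev_par, ev_wires, ev_cap, ev_cup, drop]
    · intro z hz i hi
      simp [ev_par, ev_wires, ev_cap, ev_cup, drop] at hz
      have : i = 0 ∨ i = 1 ∨ i = 2 := by omega
      rcases this with rfl | rfl | rfl <;> grind
  | snake_right =>
    rw [ev_seq_single (z₀ := fun _ => x 0)]
    · simp [ev_par, ev_wires, ev_cap, ev_cup, drop]
    · intro z hz i hi
      simp [ev_par, ev_wires, ev_cap, ev_cup, drop] at hz
      have : i = 0 ∨ i = 1 ∨ i = 2 := by omega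
      rcases this with rfl | rfl | rfl <;> grind
  | cup_swap =>
    rw [ev_seq_swap (a := 1) (b := 1)]
    simp [ev_cup, eq_comm]
  | swap_cap =>
    rw [ev_swap_seq (a := 1) (b := 1)]
    simp [ev_cap, eq_comm]
  | swap_outputs c n a b α =>
    rw [ev_seq_transposition, ev_spider, bprod_swap _ _ (by omega), bprod_swap _ _ (by omega),
      ev_spider]
  | swap_inputs c a b m α =>
    rw [ev_seq_single (z₀ := x ∘ Equiv.swap a (a + 1)), ev_transposition, if_pos, mul_one,
      ev_spider, bprod_swap _ _ (by omega), bprod_swap _ _ (by omega), ev_spider]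
    · simp
    · intro z hz i hi
      rw [ev_transposition] at hz
      split_ifs at hz with h
      · exact h i hi
      · simp at hz
  | bend_input c n m α => exact ev_bend_input _ _ _ _ _ _
  | bend_output c n m α => exact ev_bend_output _ _ _ _ _ _
  | had_cup =>
    rw [ev_seq_single (z₀ := fun _ => y 1), ev_seq_single (z₀ := fun _ => y 0)]
    · simp [ev_par, ev_wires, ev_cup, ev_had, drop, basisVec_red_comm]
    · intro z hz i hi
      simp only [ev_par, ev_wires, ev_cup, drop, Nat.lt_one_iff, forall_eq, add_zero] at hz
      have : i = 0 ∨ i = 1 := by omega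
      by_cases h : z 0 = z 1 <;> by_cases h' : y 0 = z 0 <;> rcases this with rfl | rfl <;> simp_all
    · intro z hz i hi
      simp only [ev_par, ev_wires, ev_cup, drop, Nat.lt_one_iff, forall_eq, add_zero] at hz
      have : i = 0 ∨ i = 1 := by omega
      by_cases h : z 0 = z 1 <;> by_cases h' : y 1 = z 1 <;> rcases this with rfl | rfl <;> simp_all
  | had_cap =>
    rw [ev_seq_single (z₀ := fun _ => x 1), ev_seq_single (z₀ := fun _ => x 0)]
    · simp [ev_par, ev_wires, ev_cap, ev_had, drop, basisVec_red_comm]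
    · intro z hz i hi
      simp only [ev_par, ev_wires, ev_cap, drop, Nat.lt_one_iff, forall_eq, add_zero] at hz
      have : i = 0 ∨ i = 1 := by omega
      by_cases h : z 0 = z 1 <;> by_cases h' : z 0 = x 0 <;> rcases this with rfl | rfl <;> simp_all
    · intro z hz i hi
      simp only [ev_par, ev_wires, ev_cap, drop, Nat.lt_one_iff, forall_eq, add_zero] at hz
      have : i = 0 ∨ i = 1 := by omega
      by_cases h : z 0 = z 1 <;> by_cases h' : z 1 = x 1 <;> rcases this with rfl | rfl <;> simp_all

end ZX

end

/-! ### Soundness of the rewrite rules -/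

noncomputable section

namespace ZX

open Diag

set_option linter.unusedSimpArgs false

/-! ### Soundness of the rewrite rules -/

theorem bprod_green (b : Fin 2) (n : ℕ) (y : ℕ → Fin 2) :
    bprod .green b n y = if ∀ i < n, y i = b then 1 else 0 := by
  simp only [bprod, basisVec]
  rw [Finset.prod_ite_zero]
  simp [eq_comm]

theorem sum_bprod_green {n : ℕ} (F : (Fin n → Fin 2) → ℂ) (b : Fin 2) :
    ∑ z : Fin n → Fin 2, F z * bprod .green b n (ext z) = F fun _ => b := by
  rw [Fintype.sum_eq_single (fun _ => b)]
  · rw [bprod_green, if_pos (fun i hi => by simp [ext, hi]), mul_one]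
  · intro z hz
    rw [bprod_green, if_neg, mul_zero]
    intro h
    refine hz (funext fun i => ?_)
    rw [← h i i.2]
    simp [ext]

/-- Behind a green spider only the two constant bit strings contribute. -/
theorem ev_gn_seq {n m k : ℕ} (α : Real.Angle) (E : Diag m k) (y x : ℕ → Fin 2) :
    ev (seq (gn n m α) E) y x = ev E y (fun _ => 0) * bprod .green 0 n x +
      (Real.Angle.toCircle α : ℂ) * (ev E y (fun _ => 1) * bprod .green 1 n x) := by
  have h := fun b => sum_bprod_green (fun z : Fin m → Fin 2 => ev E y (ext z)) b
  have h' : ∀ b, ev E y (ext fun _ : Fin m => b) = ev E y fun _ => b := fun b =>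
    ev_congr E (fun _ _ => rfl) fun i hi => by simp [ext, hi]
  simp only [h'] at h
  rw [← h, ← h, ev_seq, Finset.sum_mul, Finset.sum_mul, Finset.mul_sum, ← Finset.sum_add_distrib]
  refine Finset.sum_congr rfl fun z _ => ?_
  rw [ev_spider]
  ring

theorem ev_seq_gn {n m k : ℕ} (α : Real.Angle) (D : Diag n m) (y x : ℕ → Fin 2) :
    ev (seq D (gn m k α)) y x = bprod .green 0 k y * ev D (fun _ => 0) x +
      (Real.Angle.toCircle α : ℂ) * (bprod .green 1 k y * ev D (fun _ => 1) x) := by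
  have h := fun b => sum_bprod_green (fun z : Fin m → Fin 2 => ev D (ext z) x) b
  have h' : ∀ b, ev D (ext fun _ : Fin m => b) x = ev D (fun _ => b) x := fun b =>
    ev_congr D (fun i hi => by simp [ext, hi]) fun _ _ => rfl
  simp only [h'] at h
  rw [← h, ← h, ev_seq, Finset.mul_sum, Finset.mul_sum, Finset.mul_sum, ← Finset.sum_add_distrib]
  refine Finset.sum_congr rfl fun z _ => ?_
  rw [ev_spider]
  ring

theorem bprod_zero (c : Colour) (b : Fin 2) (y : ℕ → Fin 2) : bprod c b 0 y = 1 := rfl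

theorem bprod_one (c : Colour) (b : Fin 2) (y : ℕ → Fin 2) : bprod c b 1 y = basisVec c b (y 0) := by
  simp [bprod]

theorem bprod_two (c : Colour) (b : Fin 2) (y : ℕ → Fin 2) :
    bprod c b 2 y = basisVec c b (y 0) * basisVec c b (y 1) := by
  simp [bprod, Finset.prod_range_succ]

/-- Replaces 1/√2 by an unknown with a known square, so that the remaining identities are
polynomial. -/
theorem exists_sqrt_half : ∃ s : ℂ, s * s = 1 / 2 ∧ (∀ j, basisVec .red 0 j = s) ∧
    basisVec .red 1 0 = s ∧ basisVec .red 1 1 = -s := by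
  refine ⟨(Real.sqrt 2 : ℂ)⁻¹, ?_, ?_, ?_, ?_⟩
  · rw [← mul_inv, ← Complex.ofReal_mul, Real.mul_self_sqrt (by norm_num)]
    norm_num
  all_goals simp [basisVec, neg_div]

theorem toCircle_pie : ((Real.Angle.toCircle pie : Circle) : ℂ) = -1 := by
  simp [pie]

theorem ev_copies (D : Diag 1 1) (n : ℕ) (y x : ℕ → Fin 2) :
    ev (copies D n) y x = ∏ i ∈ Finset.range n, ev D (fun _ => y i) (fun _ => x i) := by
  induction n with
  | zero => simp [copies, ev_wires]
  | succ n ih =>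
    rw [copies, ev_par, ih, Finset.prod_range_succ]
    congr 1
    exact ev_congr _ (fun i hi => by simp [drop, Nat.lt_one_iff.1 hi])
      (fun i hi => by simp [drop, Nat.lt_one_iff.1 hi])

theorem ev_inner (α β : Real.Angle) (y x : ℕ → Fin 2) {s : ℂ} (h : ∀ j, basisVec .red 0 j = s)
    (h' : basisVec .red 1 0 = s) (h'' : basisVec .red 1 1 = -s) : ev (inner α β) y x =
    s * (1 + (Real.Angle.toCircle β : ℂ)) +
      (Real.Angle.toCircle α : ℂ) * (s * (1 - (Real.Angle.toCircle β : ℂ))) := by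
  simp only [ev_seq_gn, ev_spider, bprod_zero, bprod_one, h, h', h'']
  ring

theorem ev_flip {n m : ℕ} (D : Diag n m) (y x : ℕ → Fin 2) : ev D.flip y x = ev D x y := by
  induction D generalizing y x with
  | wires n => simp [Diag.flip, ev_wires, eq_comm]
  | swap n m => simp [Diag.flip, ev_swap, eq_comm, and_comm]
  | cup => rfl
  | cap => rfl
  | spider c n m α => simp [Diag.flip, ev_spider, mul_comm]
  | had => exact basisVec_red_comm _ _
  | star => rfl
  | seq D E ih ih' =>
    rw [Diag.flip, ev_seq, ev_seq]
    exact Finset.sum_congr rfl fun z _ => by rw [ih, ih', mul_comm]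
  | par D E ih ih' => rw [Diag.flip, ev_par, ev_par, ih, ih']

theorem ev_rule_spider (n m k l : ℕ) (α β : Real.Angle) (y x : ℕ → Fin 2) :
    ev (seq (par (gn n (m + 1) α) (wires k))
      (retype (Nat.add_assoc m 1 k).symm (par (wires m) (gn (1 + k) l β)))) y x =
    ev (gn (n + k) (m + l) (α + β)) y x := by
  -- Plain wires fix all intermediate bits except the one at position `m` on the joining wire; the
  -- sum runs over that bit.
  rw [ev_seq_update (j := m) (z₀ := fun i => if i < m then y i else x (n + (i - (m + 1))))
    (hj := by omega)]
  · set z := fun b : Fin 2 => Function.update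
      (fun i => if i < m then y i else x (n + (i - (m + 1)))) m b
    have z1 : ∀ b, ∀ i < m, z b i = y i := fun b i hi => by
      simp [z, Function.update_of_ne hi.ne, hi]
    have z2 : ∀ b, z b m = b := fun b => by simp [z]
    have z3 : ∀ b i, z b (m + 1 + i) = x (n + i) := fun b i => by
      simp [z, Function.update_of_ne (show m + 1 + i ≠ m by omega), show ¬ m + 1 + i < m by omega]
    have e1 : ∀ c b, bprod .green c (m + 1) (z b) = bprod .green c m y * basisVec .green c b :=
      fun c b => by rw [bprod_succ, z2, bprod_congr _ _ (z1 b)]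
    have e2 : ∀ c b, bprod .green c (1 + k) (drop m (z b)) =
        basisVec .green c b * bprod .green c k (drop n x) := fun c b => by
      rw [bprod_drop, bprod_one]
      congr 1
      · simp [drop, z2]
      · exact bprod_congr _ _ fun i _ => by simp [drop, ← add_assoc, z3]
    have e3 : ∀ b, ev (wires k) (drop (m + 1) (z b)) (drop n x) = 1 := fun b => by
      rw [ev_wires]
      exact if_pos fun i _ => z3 b i
    have e4 : ∀ b, ev (wires m) y (z b) = 1 := fun b => by
      rw [ev_wires]
      exact if_pos fun i hi => (z1 b i hi).symm
    change ∑ b : Fin 2, ev _ y (z b) * ev _ (z b) x = _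
    simp only [ev_retype, ev_par, ev_spider, e1, e2, e3, e4, bprod_drop _ _ m l, bprod_drop _ _ n k,
      Fin.sum_univ_two, Real.Angle.toCircle_add, Circle.coe_mul]
    simp [basisVec]
    ring
  · intro z hz i hi hij
    simp only [ev_retype, ev_par, ev_wires] at hz
    by_cases h1 : ∀ i < m, y i = z i
    · by_cases h2 : ∀ i < k, drop (m + 1) z i = drop n x i
      · by_cases him : i < m
        · simp [him, h1 i him]
        · have := h2 (i - (m + 1)) (by omega)
          simp only [drop] at this
          rw [show m + 1 + (i - (m + 1)) = i by omega] at this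
          simp [him, this]
      · simp [h2] at hz
    · simp [h1] at hz

/-- The red merge computes parity: addition in `Fin 2` is exclusive or. -/
theorem ev_red_two_one {s : ℂ} (hs : s * s = 1 / 2) (h : ∀ j, basisVec .red 0 j = s)
    (h' : basisVec .red 1 0 = s) (h'' : basisVec .red 1 1 = -s) (y x : ℕ → Fin 2) :
    ev (rn 2 1 0) y x = if y 0 = x 0 + x 1 then s else 0 := by
  simp only [ev_spider, bprod_one, bprod_two, h, Real.Angle.toCircle_zero, Circle.coe_one, one_mul]
  have e : s * (s * s) + s * (s * s) = s := by rw [hs]; ring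
  generalize y 0 = a
  generalize x 0 = b
  generalize x 1 = c
  fin_cases a <;> fin_cases b <;> fin_cases c <;> simp [h', h'', e]

theorem drop_zero (y : ℕ → Fin 2) : drop 0 y = y := funext fun i => by simp [drop]

theorem forall_lt_two {P : ℕ → Prop} : (∀ i < 2, P i) ↔ P 0 ∧ P 1 :=
  ⟨fun h => ⟨h 0 (by simp), h 1 (by simp)⟩, fun h i hi => by
    rcases (by omega : i = 0 ∨ i = 1) with rfl | rfl
    exacts [h.1, h.2]⟩

theorem ev_gn_one (m : ℕ) (y x : ℕ → Fin 2) :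
    ev (gn 1 m 0) y x = if ∀ i < m, y i = x 0 then 1 else 0 := by
  simp only [ev_spider, bprod_green, bprod_one, Real.Angle.toCircle_zero, Circle.coe_one, basisVec]
  generalize x 0 = a
  fin_cases a <;> simp

theorem ev_bialgebra (y x : ℕ → Fin 2) :
    ev (par (inner 0 0)
          (seq (seq (par (gn 1 2 0) (gn 1 2 0))
              (par (n := 1 + (1 + 1)) (n' := 1) (par (wires 1) (swap 1 1)) (wires 1)))
            (par (n := 2) (n' := 2) (rn 2 1 0) (rn 2 1 0)))) y x =
    ev (seq (rn 2 1 0) (gn 1 2 0)) y x := by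
  obtain ⟨s, hs, h, h', h''⟩ := exists_sqrt_half
  have hG : ∀ z, ev (seq (par (gn 1 2 0) (gn 1 2 0))
      (par (n := 1 + (1 + 1)) (n' := 1) (par (wires 1) (swap 1 1)) (wires 1))) z x =
      if (z 0 = x 0 ∧ z 2 = x 0) ∧ z 1 = x 1 ∧ z 3 = x 1 then 1 else 0 := fun z => by
    refine (ev_seq_transposition (a := 1) (b := 1) (par (n := 1) (m := 2) (n' := 1) (m' := 2)
      (gn 1 2 0) (gn 1 2 0) : Diag 2 4) z x).trans ?_
    rw [ev_par, ev_gn_one, ev_gn_one, ite_zero_mul_ite_zero, one_mul]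
    refine if_congr ?_ rfl rfl
    have e3 : Equiv.swap 1 (1 + 1) 3 = 3 := by decide
    have e2 : Equiv.swap 1 (1 + 1) 2 = 1 := by decide
    have e1 : Equiv.swap 1 (1 + 1) 1 = 2 := by decide
    have e0 : Equiv.swap 1 (1 + 1) 0 = 0 := by decide
    rw [forall_lt_two, forall_lt_two]
    simp [drop, e0, e1, e2, e3, -Nat.reduceAdd]
  rw [ev_par, ev_inner _ _ _ _ h h' h'', drop_zero, drop_zero, ev_seq_gn,
    ev_seq_single (z₀ := fun i => if i = 0 ∨ i = 2 then x 0 else x 1), hG, if_pos (by simp), ev_par]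
  · simp only [ev_red_two_one hs h h' h'', bprod_two, drop, Real.Angle.toCircle_zero,
      Circle.coe_one, basisVec]
    have e : 2 * s * (s * s) = s := by rw [hs]; ring
    generalize x 0 = a
    generalize x 1 = b
    generalize y 0 = c
    generalize y 1 = d
    fin_cases a <;> fin_cases b <;> fin_cases c <;> fin_cases d <;> simp <;> linear_combination e
  · intro z hz i hi
    rw [hG] at hz
    split_ifs at hz with h
    · have : i = 0 ∨ i = 1 ∨ i = 2 ∨ i = 3 := by omega
      rcases this with rfl | rfl | rfl | rfl <;> simp [h]
    · simp at hz

theorem ev_copy (y x : ℕ → Fin 2) :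
    ev (par (inner 0 0) (seq (rn 0 1 0) (gn 1 2 0))) y x = ev (par (rn 0 1 0) (rn 0 1 0)) y x := by
  obtain ⟨s, hs, h, h', h''⟩ := exists_sqrt_half
  rw [ev_par, ev_inner _ _ _ _ h h' h'', ev_seq_gn, ev_par]
  simp only [ev_spider, bprod_two, bprod_one, bprod_zero, drop, Real.Angle.toCircle_zero,
    Circle.coe_one, h]
  generalize y (0 + 0) = c
  generalize y (1 + 0) = d
  fin_cases c <;> fin_cases d <;> simp [basisVec.eq_1, h', h''] <;> first | ring1 | (left; ring1)

theorem ev_pi_copy (m : ℕ) (y x : ℕ → Fin 2) :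
    ev (seq (gn 1 1 pie) (rn 1 m 0)) y x = ev (seq (rn 1 m 0) (copies (gn 1 1 pie) m)) y x := by
  obtain ⟨s, hs, h, h', h''⟩ := exists_sqrt_half
  have hg : ∀ a b : Fin 2, ev (gn 1 1 pie) (fun _ => a) (fun _ => b) =
      if a = b then (-1) ^ (a : ℕ) else 0 := fun a b => by
    simp only [ev_spider, bprod_one, toCircle_pie]
    fin_cases a <;> fin_cases b <;> simp [basisVec]
  rw [ev_gn_seq, ev_seq_single (z₀ := y)]
  -- Z on every output exchanges |+⟩ and |-⟩.
  · have hp : ∀ b : Fin 2, (∏ i ∈ Finset.range m, (-1 : ℂ) ^ (y i : ℕ)) * bprod .red b m y =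
        bprod .red (1 - b) m y := fun b => by
      rw [bprod, bprod, ← Finset.prod_mul_distrib]
      refine Finset.prod_congr rfl fun i _ => ?_
      generalize y i = c
      fin_cases b <;> fin_cases c <;> simp [h, h', h'']
    have e : ev (copies (gn 1 1 pie) m) y y * ev (rn 1 m 0) y x =
        bprod .red 1 m y * basisVec .red 0 (x 0) + bprod .red 0 m y * basisVec .red 1 (x 0) := by
      have h0 := hp 0
      have h1 := hp 1
      simp only [sub_zero, sub_self] at h0 h1
      simp only [ev_copies, hg, if_true, ev_spider, bprod_one, Real.Angle.toCircle_zero,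
        Circle.coe_one, one_mul]
      linear_combination basisVec .red 0 (x 0) * h0 + basisVec .red 1 (x 0) * h1
    rw [e]
    simp only [ev_spider, bprod_one, toCircle_pie, Real.Angle.toCircle_zero, Circle.coe_one, h, h', h'']
    generalize x 0 = a
    fin_cases a <;> simp [basisVec.eq_1, h', h''] <;> ring
  · intro z hz i hi
    by_contra hne
    refine hz (mul_eq_zero_of_left ?_ _)
    rw [ev_copies]
    exact Finset.prod_eq_zero (Finset.mem_range.2 hi) (by rw [hg, if_neg (Ne.symm hne)])

theorem ev_pi_commutation (α : Real.Angle) (y x : ℕ → Fin 2) :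
    ev (par (inner 0 0) (seq (gn 1 1 α) (rn 1 1 pie))) y x =
      ev (par (inner α pie) (seq (rn 1 1 pie) (gn 1 1 (-α)))) y x := by
  obtain ⟨s, hs, h, h', h''⟩ := exists_sqrt_half
  have ha : (Real.Angle.toCircle α : ℂ) * (Real.Angle.toCircle (-α) : ℂ) = 1 := by
    rw [← Circle.coe_mul, ← Real.Angle.toCircle_add, add_neg_cancel, Real.Angle.toCircle_zero,
      Circle.coe_one]
  rw [ev_par, ev_par, ev_inner _ _ _ _ h h' h'', ev_inner _ _ _ _ h h' h'', ev_gn_seq, ev_seq_gn]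
  simp only [ev_spider, bprod_one, toCircle_pie, Real.Angle.toCircle_zero, Circle.coe_one, h, h',
    h'', drop]
  generalize (Real.Angle.toCircle α : ℂ) = a at *
  generalize (Real.Angle.toCircle (-α) : ℂ) = a' at *
  generalize y (0 + 0) = c
  generalize x (0 + 0) = d
  fin_cases c <;> fin_cases d <;> simp [basisVec.eq_1, h, h', h''] <;>
    first | ring1 | linear_combination (-4 * s * s * s) * ha

theorem ev_colour_change (n m : ℕ) (α : Real.Angle) (y x : ℕ → Fin 2) :
    ev (seq (seq (copies had n) (gn n m α)) (copies had m)) y x = ev (rn n m α) y x := by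
  have h : ev (seq (seq (copies had n) (gn n m α)) (copies had m)) y x =
      ev (seq (copies had n) (seq (gn n m α) (copies had m))) y x :=
    congrFun (congrFun (Matrix.mul_assoc _ _ _).symm _) _
  have h1 : ∀ b, ev (copies had m) y (fun _ => b) = bprod .red b m y := fun b => ev_copies _ _ _ _
  have h2 : ∀ b, ev (copies had n) (fun _ => b) x = bprod .red b n x := fun b => by
    rw [ev_copies]
    exact Finset.prod_congr rfl fun i _ => basisVec_red_comm _ _
  rw [ev_seq]
  simp only [ev_seq_gn, h2, mul_add, Finset.sum_add_distrib]
  have e : ∀ b, ∑ z : Fin m → Fin 2, ev (copies had m) y (ext z) * bprod .green b m (ext z) =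
      bprod .red b m y := fun b => by
    rw [sum_bprod_green (fun z : Fin m → Fin 2 => ev (copies had m) y (ext z)) b, ← h1]
    exact ev_congr _ (fun _ _ => rfl) fun i hi => by simp [ext, hi]
  rw [ev_spider, ← e, ← e, Finset.sum_mul, Finset.sum_mul, Finset.mul_sum]
  congr 1 <;> exact Finset.sum_congr rfl fun z _ => by ring

theorem ev_euler (y x : ℕ → Fin 2) :
    ev (par (par (inner 0 0) (inner 0 0)) had) y x =
      ev (par (inner (-halfPi) (-halfPi))
          (seq (seq (gn 1 1 halfPi) (rn 1 1 halfPi)) (gn 1 1 halfPi))) y x := by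
  obtain ⟨s, hs, h, h', h''⟩ := exists_sqrt_half
  have hi : ((Real.Angle.toCircle halfPi : Circle) : ℂ) = Complex.I := by
    simp [halfPi, Complex.exp_pi_div_two_mul_I]
  have hi' : ((Real.Angle.toCircle (-halfPi) : Circle) : ℂ) = -Complex.I := by
    rw [Real.Angle.toCircle_neg, Circle.coe_inv, hi, Complex.inv_I]
  have e : ∀ y x : ℕ → Fin 2,
      ev (seq (seq (gn 1 1 halfPi) (rn 1 1 halfPi)) (gn 1 1 halfPi)) y x =
        Complex.I ^ (x 0 + y 0 : ℕ) * ev (rn 1 1 halfPi) y x := fun y x => by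
    rw [ev_seq_gn, ev_gn_seq, ev_gn_seq]
    simp only [ev_spider, bprod_one, h, h', h'', hi]
    generalize y 0 = c
    generalize x 0 = d
    have hI := Complex.I_mul_I
    fin_cases c <;> fin_cases d <;> simp [basisVec.eq_1, h', h''] <;>
      first | ring1 | linear_combination s ^ 2 * (1 + Complex.I) * hI
  rw [ev_par, ev_par, ev_par, ev_inner 0 0 _ _ h h' h'', ev_inner 0 0 _ _ h h' h'',
    ev_inner (-halfPi) _ _ _ h h' h'', e]
  simp only [ev_spider, ev_had, bprod_one, Real.Angle.toCircle_zero, Circle.coe_one, h, h',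
    h'', drop, hi, hi']
  have hI := Complex.I_mul_I
  generalize Complex.I = I at *
  simp only [zero_add]
  generalize y 0 = c
  generalize x 0 = d
  fin_cases c <;> fin_cases d <;> simp [h, h', h'']
  · linear_combination s ^ 3 * (3 + I) * hI
  · linear_combination s ^ 3 * (4 - I - I ^ 2) * hI
  · linear_combination s ^ 3 * (4 - I - I ^ 2) * hI
  · linear_combination s ^ 3 * (-4 + 3 * I ^ 2 + I ^ 3) * hI

theorem ev_pi_zero (y x : ℕ → Fin 2) : ev (gn 0 0 pie) y x = 0 := by
  simp [ev_spider, bprod_zero, toCircle_pie]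

theorem ev_loop (n m : ℕ) (α : Real.Angle) (y x : ℕ → Fin 2) :
    ev (seq (gn n (m + 2) α) (par (wires m) Diag.cap)) y x = ev (gn n m α) y x := by
  have h : ∀ b : Fin 2, ev (par (wires m) Diag.cap) y (fun _ => b) = bprod .green b m y := fun b => by
    rw [ev_par, ev_wires, ev_cap, bprod_green]
    simp [drop]
  have e := ev_gn_seq (n := n) α (par (m := m) (m' := 0) (wires m) Diag.cap) y x
  rw [h, h] at e
  rw [ev_spider]
  exact e

theorem ev_cup_rule (y x : ℕ → Fin 2) : ev (gn 0 2 0) y x = ev Diag.cup y x := by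
  rw [ev_spider, ev_cup, bprod_two, bprod_two]
  simp only [bprod_zero, Real.Angle.toCircle_zero, Circle.coe_one, basisVec]
  generalize y 0 = a
  generalize y 1 = b
  fin_cases a <;> fin_cases b <;> simp

theorem ev_had_had (y x : ℕ → Fin 2) : ev (seq Diag.had Diag.had) y x = ev (wires 1) y x := by
  obtain ⟨s, hs, h, h', h''⟩ := exists_sqrt_half
  rw [ev_seq_update (j := 0) (z₀ := fun _ => 0) (hj := by omega), ev_wires]
  · simp only [ev_had, Fin.sum_univ_two, Function.update_self, Nat.lt_one_iff, forall_eq]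
    have e : s * s + s * s = 1 := by rw [hs]; ring
    generalize x 0 = a
    generalize y 0 = b
    fin_cases a <;> fin_cases b <;> simp [h, h', h'', e]
  · intro z _ i hi h0
    omega

/-- Diagrams up to proportionality of the interpretations. -/
def simThy : Theory where
  rel := Sim
  top_le h := h.sim
  arity h := ⟨h.1, h.2.1⟩

theorem mk_simThy_eq_iff {n m n' m' : ℕ} {D : Diag n m} {E : Diag n' m'} :
    Q.mk simThy D = Q.mk simThy E ↔ Sim D E :=
  Q.mk_eq_iff.trans ⟨fun h => Sim.of_cong (fun h => h) h, .of⟩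

namespace Q

theorem had_had_sim : (had ⨾ had : Q simThy) = id 1 :=
  (mk_seq _ _).symm.trans (mk_simThy_eq_iff.2 (.of_eq rfl rfl ev_had_had))

theorem pw_had_sim (n : ℕ) : (pw had n ⨾ pw had n : Q simThy) = id n := by
  rw [pw_comp rfl, had_had_sim, pw_id]

theorem pw_add {T : Theory} (a : Q T) (n m : ℕ) : pw a (n + m) = pw a n ⊠ pw a m := by
  induction m with
  | zero => simp
  | succ m ih => rw [← Nat.add_assoc, pw, ih, pw, tens_assoc]

theorem conj_had_sim {a b : Q simThy} {n m : ℕ} (h : pw had n ⨾ a ⨾ pw had m = b)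
    (hn : a.dom = n) (hm : a.cod = m) : pw had n ⨾ b ⨾ pw had m = a := by
  rw [← h, comp_assoc, comp_assoc, pw_had_sim, comp_id (by simp [hm]), ← comp_assoc, pw_had_sim,
    id_comp hn]

/-- Exchanging colours is conjugation by Hadamard nodes on all legs, checked on generators.
Soundness of recoloured rules follows from that of the original ones. -/
theorem mk_recolour_sim {n m : ℕ} (D : Diag n m) :
    (mk simThy D.recolour) = pw had n ⨾ mk simThy D ⨾ pw had m := by
  have hg : ∀ n m α, mk simThy (rn n m α) = pw had n ⨾ mk simThy (gn n m α) ⨾ pw had m :=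
    fun n m α => by
      rw [had, ← mk_copies, ← mk_copies, ← mk_seq, ← mk_seq]
      refine (mk_simThy_eq_iff.2 (.of_eq rfl rfl fun y x => ?_)).symm
      rw [← ev_colour_change]
      exact congrFun (congrFun (Matrix.mul_assoc _ _ _) _) _
  induction D with
  | wires n =>
    change id n = pw had n ⨾ id n ⨾ pw had n
    rw [id_comp (by simp), pw_had_sim]
  | swap n m =>
    change sw n m = pw had (n + m) ⨾ sw n m ⨾ pw had (m + n)
    rw [pw_add, pw_add, ← comp_assoc, tens_sw (n := n) (n' := m) (by simp) (by simp) (by simp)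
      (by simp), comp_assoc, ← comp_tens_comp (by simp) (by simp), pw_had_sim, pw_had_sim,
      id_tens_id, comp_id (by simp)]
  | cup =>
    change cup = pw had 0 ⨾ cup ⨾ pw had 2
    have h : (cup ⨾ had ⊠ id 1 : Q simThy) = cup ⨾ id 1 ⊠ had := by
      have e := of_top (T := simThy) .had_cup
      rwa [mk_seq, mk_seq] at e
    rw [pw_zero, id_comp (by simp), pw_two, ← left_right (m := 1) (n := 1) (by simp) (by simp),
      reassoc h, comp_assoc, ← id_tens_comp (by simp), had_had_sim, id_tens_id, comp_id (by simp)]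
  | cap =>
    change cap = pw had 2 ⨾ cap ⨾ pw had 0
    have h : (had ⊠ id 1 ⨾ cap : Q simThy) = id 1 ⊠ had ⨾ cap := had_cap
    rw [pw_zero, comp_id (by simp), pw_two, ← left_right (m := 1) (n := 1) (by simp) (by simp),
      comp_assoc, ← h, ← comp_assoc, ← comp_tens_id (by simp), had_had_sim, id_tens_id,
      id_comp (by simp)]
  | spider c n m α =>
    cases c
    · exact hg n m α
    · exact (conj_had_sim (hg n m α).symm rfl rfl).symm
  | had =>
    change had = pw had 1 ⨾ had ⨾ pw had 1
    rw [pw_one, had_had_sim, comp_id (by simp)]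
  | star =>
    change star = id 0 ⨾ star ⨾ id 0
    rw [id_comp (by simp), comp_id (by simp)]
  | seq D E ih ih' =>
    rw [recolour, mk_seq, mk_seq, ih, ih']
    simp only [comp_assoc]
    rw [reassoc (pw_had_sim _), id_comp (by simp)]
  | par D E ih ih' =>
    rw [recolour, mk_par, mk_par, ih, ih', pw_add, pw_add, comp_tens_comp (by simp) (by simp),
      comp_tens_comp (by simp) (by simp)]

end Q

theorem Sim.recolour {n m n' m' : ℕ} {D : Diag n m} {E : Diag n' m'} (h : Sim D E) :
    Sim D.recolour E.recolour := by
  obtain ⟨rfl, rfl, -⟩ := id h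
  rw [← mk_simThy_eq_iff] at h ⊢
  rw [Q.mk_recolour_sim, Q.mk_recolour_sim, h]

theorem Sim.flip {n m n' m' : ℕ} {D : Diag n m} {E : Diag n' m'} (h : Sim D E) :
    Sim D.flip E.flip := by
  obtain ⟨hn, hm, c, hc, h⟩ := h
  exact ⟨hm, hn, c, hc, fun y x => by rw [ev_flip, ev_flip, h]⟩

/-- The rewrite rules are sound. -/
theorem Rule.sim {n m n' m' : ℕ} {D : Diag n m} {E : Diag n' m'} (h : Rule D E) : Sim D E := by
  induction h with
  | spider n m k l α β => exact .of_eq rfl rfl (ev_rule_spider n m k l α β)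
  | loop n m α => exact .of_eq rfl rfl (ev_loop n m α)
  | cup => exact .of_eq rfl rfl ev_cup_rule
  | bialgebra => exact .of_eq rfl rfl ev_bialgebra
  | copy => exact .of_eq rfl rfl ev_copy
  | pi_copy m => exact .of_eq rfl (by simp) (ev_pi_copy m)
  | pi_commutation α => exact .of_eq rfl rfl (ev_pi_commutation α)
  | colour_change n m α => exact .of_eq rfl rfl (ev_colour_change n m α)
  | euler => exact .of_eq rfl rfl ev_euler
  | star =>
    refine .of_eq rfl rfl fun y x => ?_
    rw [ev_par, ev_star, ev_spider, ev_wires]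
    simp [bprod_zero]
    norm_num
  | zero => exact .of_eq rfl rfl fun y x => by rw [ev_par, ev_par, ev_pi_zero, zero_mul, zero_mul]
  | zero_scalar α => exact .of_eq rfl rfl fun y x => by rw [ev_par, ev_pi_zero, zero_mul]
  | recolour _ ih => exact ih.recolour
  | flip _ ih => exact ih.flip

theorem StabEq.sim {n m n' m' : ℕ} {D : Diag n m} {E : Diag n' m'} (h : StabEq D E) : Sim D E :=
  Sim.of_cong (fun h => h.elim TopAx.sim fun h => h.1.sim) h

/-- The calculus modulo invertible scalars is sound up to proportionality. -/
theorem modThy_sim {n m n' m' : ℕ} {D : Diag n m} {E : Diag n' m'} (h : Cong modThy.rel D E) :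
    Sim D E := by
  refine Sim.of_cong (fun {n m n' m' D E} (h : ModAx D E) => ?_) h
  cases h with
  | stab h => exact h.elim TopAx.sim fun h => h.1.sim
  | unit s t h =>
    obtain ⟨-, -, c, hc, h⟩ := h.sim
    have e : ∀ (s : Diag 0 0) y x, ev s y x = ev s (fun _ => 0) fun _ => 0 := fun s y x =>
      ev_congr s (fun i hi => by omega) fun i hi => by omega
    have h0 := h (fun _ => 0) fun _ => 0
    rw [ev_par, ev_wires, if_pos (fun i hi => by omega), mul_one] at h0
    -- A scalar diagram has a single entry; that of `s` is nonzero because its product with that of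
    -- `t` is.
    refine ⟨rfl, rfl, ev s (fun _ => 0) fun _ => 0, left_ne_zero_of_mul (h0 ▸ hc), fun y x => ?_⟩
    rw [e, ev_wires, if_pos (fun i hi => by omega), mul_one]

end ZX

end

/-! ### Every stabilizer state is nonzero with a maximal stabiliser, or provably zero -/

noncomputable section

namespace ZX

open Diag

namespace Q

local notation "M" => Q modThy

set_option linter.unusedSimpArgs false

/-! ### Proper elements and vanishing interpretations -/

/-- Classes of diagrams. -/
def Proper (a : M) : Prop := ∃ (n m : ℕ) (D : Diag n m), a = mk modThy D

theorem Proper.mk {n m : ℕ} (D : Diag n m) : Proper (mk modThy D) := ⟨n, m, D, rfl⟩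

theorem proper_sp (c : Colour) (n m : ℕ) (a : ZMod 4) : Proper (sp c n m a) := .mk _

theorem proper_id (n : ℕ) : Proper (id n) := .mk _

theorem Proper.comp {a b : M} (ha : Proper a) (hb : Proper b) (h : a.cod = b.dom) :
    Proper (a ⨾ b) := by
  obtain ⟨n, m, D, rfl⟩ := ha
  obtain ⟨m', k, E, rfl⟩ := hb
  obtain rfl : m = m' := h
  exact ⟨n, k, Diag.seq D E, (mk_seq D E).symm⟩

theorem Proper.tens {a b : M} (ha : Proper a) (hb : Proper b) : Proper (a ⊠ b) := by
  obtain ⟨n, m, D, rfl⟩ := ha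
  obtain ⟨n', m', E, rfl⟩ := hb
  exact ⟨_, _, Diag.par D E, rfl⟩

theorem Proper.pad {a : M} (h : Proper a) (i j : ℕ) : Proper (id i ⊠ a ⊠ id j) :=
  (proper_id i).tens (h.tens (proper_id j))

/-- The class of a diagram with zero interpretation. -/
def Vanish (a : M) : Prop := ∃ (n m : ℕ) (D : Diag n m), a = mk modThy D ∧ D.interp = 0

/-- By soundness up to a nonzero factor, vanishing does not depend on the representative. -/
theorem vanish_mk {n m : ℕ} {D : Diag n m} : Vanish (mk modThy D) ↔ D.interp = 0 := by
  refine ⟨?_, fun h => ⟨n, m, D, rfl, h⟩⟩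
  rintro ⟨n', m', E, h, hE⟩
  exact (modThy_sim (mk_eq_iff.1 h)).interp_eq_zero.2 hE

theorem Vanish.comp {a b : M} (ha : Vanish a) (hb : Proper b) (h : a.cod = b.dom) :
    Vanish (a ⨾ b) := by
  obtain ⟨n, m, D, rfl, hD⟩ := ha
  obtain ⟨m', k, E, rfl⟩ := hb
  obtain rfl : m = m' := h
  exact ⟨n, k, Diag.seq D E, (mk_seq D E).symm, by rw [interp, hD, Matrix.mul_zero]⟩

/-- Diagrams that absorb the zero scalar. -/
def Zero (a : M) : Prop := zro ⊠ a = a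

theorem Zero.comp {a b : M} (ha : Zero a) (h : a.cod = b.dom) : Zero (a ⨾ b) := by
  rw [Zero, scalar_tens_comp (by simp) _ h, ha]

theorem Zero.vanish {a : M} (h : Zero a) (ha : Proper a) : Vanish a := by
  obtain ⟨n, m, D, rfl⟩ := ha
  have e : (zro : M) = mk modThy (gn 0 0 pie) := by rw [← phase_two]; rfl
  rw [← h, e, ← mk_par, vanish_mk, interp_eq_zero_iff]
  intro y x
  rw [ev_par, ev_pi_zero, zero_mul]

/-- A computational basis measurement of one qubit. -/
def meas (i j : ℕ) (s : ZMod 4) : M := id i ⊠ sp .red 1 0 s ⊠ id j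

@[simp] theorem dom_meas (i j : ℕ) (s : ZMod 4) : (meas i j s).dom = i + (1 + j) := by simp [meas]
@[simp] theorem cod_meas (i j : ℕ) (s : ZMod 4) : (meas i j s).cod = i + j := by simp [meas]

theorem proper_meas (i j : ℕ) (s : ZMod 4) : Proper (meas i j s) := (proper_sp _ _ _ _).pad i j

/-- The red effect with sign (-1)^(y i) is a multiple of the bra of the bit `y i`. Measuring with it
reads off the entries at `y`, and the output loses the bit at position `i`. -/
theorem ev_measurement {n i j : ℕ} (D : Diag n (i + (1 + j))) (y x : ℕ → Fin 2) (α : Real.Angle)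
    (hα : (Real.Angle.toCircle α : ℂ) = (-1) ^ (y i : ℕ)) : ∃ c : ℂ, c ≠ 0 ∧
      ev (seq D (Diag.par (wires i) (Diag.par (rn 1 0 α) (wires j))))
        (fun k => if k < i then y k else y (k + 1)) x = c * ev D y x := by
  obtain ⟨s, hs, h, h', h''⟩ := exists_sqrt_half
  have hb : ∀ z, ev (rn 1 0 α) (drop i fun k => if k < i then y k else y (k + 1)) z =
      if y i = z 0 then 2 * s else 0 := fun z => by
    rw [ev_spider, hα]
    simp only [bprod_zero, bprod_one, h]
    generalize y i = a
    generalize z 0 = b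
    fin_cases a <;> fin_cases b <;> simp [h', h''] <;> ring
  have e : ∀ z, ev (Diag.par (wires i) (Diag.par (rn 1 0 α) (wires j)))
      (fun k => if k < i then y k else y (k + 1)) z =
      if (∀ k < i, y k = z k) ∧ y i = z i ∧ ∀ k < j, y (i + k + 1) = z (i + (1 + k))
        then 2 * s else 0 := fun z => by
    rw [ev_par, ev_par, ev_wires, ev_wires, hb, ite_zero_mul_ite_zero, ite_zero_mul_ite_zero, one_mul,
      mul_one]
    refine if_congr (and_congr (forall₂_congr fun k hk => by simp [hk])
      (and_congr (by simp [drop]) (forall₂_congr fun k hk => by simp [drop]))) rfl rfl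
  refine ⟨2 * s, ?_, ?_⟩
  · rintro h0
    have : s = 0 := by simpa using h0
    rw [this] at hs
    norm_num at hs
  · rw [ev_seq_single (z₀ := y), e, if_pos]
    · exact ⟨fun _ _ => rfl, rfl, fun k _ => by congr 1; omega⟩
    · intro z hz
      rw [e] at hz
      split_ifs at hz with hc
      · rw [forall_lt_add, forall_lt_add]
        refine ⟨fun k hk => (hc.1 k hk).symm, fun k hk => ?_, fun k hk => ?_⟩
        · obtain rfl : k = 0 := by omega
          exact hc.2.1.symm
        · rw [← hc.2.2 k hk]
          congr 1
          omega
      · simp at hz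

/-- A diagram with a nonzero interpretation has a nonzero component for one of the outcomes. -/
theorem vanish_of_meas {φ : M} (hφ : Proper φ) {i j : ℕ} (h : φ.cod = i + (1 + j))
    (h0 : Vanish (φ ⨾ meas i j 0)) (h2 : Vanish (φ ⨾ meas i j 2)) : Vanish φ := by
  obtain ⟨n, m, D, rfl⟩ := hφ
  obtain rfl : m = i + (1 + j) := h
  have e : ∀ s, mk modThy D ⨾ meas i j s =
      mk modThy (seq D (Diag.par (wires i) (Diag.par (rn 1 0 (phase s)) (wires j)))) :=
    fun s => (mk_seq _ _).symm
  rw [e, vanish_mk, interp_eq_zero_iff] at h0 h2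
  rw [map_zero] at h0
  rw [phase_two] at h2
  rw [vanish_mk, interp_eq_zero_iff]
  intro y x
  rcases (by omega : y i = 0 ∨ y i = 1) with hy | hy
  · obtain ⟨c, hc, e⟩ := ev_measurement D y x 0 (by simp [hy])
    rw [h0] at e
    exact (mul_eq_zero.1 e.symm).resolve_left hc
  · obtain ⟨c, hc, e⟩ := ev_measurement D y x pie (by simp [hy, toCircle_pie])
    rw [h2] at e
    exact (mul_eq_zero.1 e.symm).resolve_left hc

/-! ### Pauli operators -/

/-- An action with its control in the state `1`. -/
def plug (a : M) : M := sp .red 0 1 2 ⊠ id 1 ⨾ a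

@[simp] theorem dom_plug (a : M) : (plug a).dom = 1 := by simp [plug]
@[simp] theorem cod_plug (a : M) : (plug a).cod = a.cod := by simp [plug]

theorem copy_one : (sp .red 0 1 2 ⨾ sp .green 1 2 0 : M) = sp .red 0 1 2 ⊠ sp .red 0 1 2 :=
  state_copy_two .green

theorem plug_copy : (sp .red 0 1 2 ⊠ id 1 ⨾ sp .green 1 2 0 ⊠ id 1 : M) =
    sp .red 0 1 2 ⊠ sp .red 0 1 2 ⊠ id 1 := by
  rw [← comp_tens_id (by simp), copy_one, tens_assoc]

/-- The green spider copies |1⟩, so both actions are switched on. -/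
theorem plug_conv {a b : M} (ha : a.dom = 2) (ha' : a.cod = 1) :
    plug (conv a b) = plug a ⨾ plug b := by
  rw [plug, conv, reassoc plug_copy, ← comp_assoc, ← comp_tens_comp (by simp) (by simp [ha]),
    comp_id (by simp), ← right_left (a := sp .red 0 1 2) (m := 0) (n := 1) (by simp) (by simp [ha']),
    id_zero_tens, comp_assoc]
  rfl

theorem plug_eps : plug eps = id 1 := by
  have h : (sp .red 0 1 2 ⨾ sp .green 1 0 0 : M) = id 0 := state_two_effect .green 0
  rw [plug, eps, ← comp_tens_id (by simp), h, id_zero_tens]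

theorem plug_actX : plug actX = sp .red 1 1 2 := by
  have f := fuse_in_left (T := modThy) .red 1 1 0 0 2
  norm_num at f
  rw [plug, actX, f]

theorem plug_actZ : plug actZ = sp .green 1 1 2 := by
  have f := fuse_in_left (T := modThy) .green 1 1 0 0 2
  norm_num at f
  have h : (sp .red 0 1 2 ⨾ had : M) = sp .green 0 1 2 := had_state .red 2
  rw [plug, actZ, ← comp_assoc, ← comp_tens_id (by simp), h, f]

theorem plug_weave {a : M} (ha : a.dom = 2) (ha' : a.cod = 1) :
    sp .red 0 1 2 ⊠ id 1 ⨾ weave a = plug a ⊠ sp .red 0 1 2 := by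
  rw [weave, reassoc plug_copy, ← comp_assoc, ← comp_tens_comp (by simp) (by simp [ha]),
    comp_id (by simp), tens_sw (n := 0) (n' := 1) (by simp) (by simp) (by simp) (by simp [ha']),
    zero_sw, id_comp (by simp)]
  rfl

theorem phase_two_effect {s : ZMod 4} (hs : s = 0 ∨ s = 2) :
    (sp .green 1 1 2 ⨾ sp .red 1 0 s : M) = sp .red 1 0 s := by
  have h0 : ∀ a, (sp .green 1 1 a ⨾ sp .red 1 0 0 : M) = sp .red 1 0 0 := phase_effect .green
  rcases hs with rfl | rfl
  · exact h0 2
  · have h : (sp .red 1 0 2 : M) = sp .red 1 1 2 ⨾ sp .red 1 0 0 := by rw [sp_comp, add_zero]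
    have c := pi_commutation (T := modThy) .green 2
    rw [inn_zero, inn_two, id_zero_tens, id_zero_tens] at c
    have c' := reassoc c (sp .red 1 0 0)
    rw [comp_assoc] at c'
    rw [h]
    refine c'.trans ?_
    rw [h0]
    rfl

/-- A possible Z factor only changes a basis effect by an invertible scalar, while X exchanges the
two effects. -/
theorem plug_act_effect {q : Bool × Bool} (hq : q.1 = true) {s : ZMod 4} (hs : s = 0 ∨ s = 2) :
    plug (act q) ⨾ sp .red 1 0 s = sp .red 1 0 (s + 2) := by
  obtain ⟨x, z⟩ := q
  obtain rfl : x = true := hq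
  have h : (sp .red 1 1 2 ⨾ sp .red 1 0 s : M) = sp .red 1 0 (s + 2) := by rw [sp_comp, add_comm]
  cases z
  · rw [act_true_false, plug_actX, h]
  · rw [act, cond_true, cond_true, plug_conv (by simp) (by simp), plug_actX, plug_actZ,
      comp_assoc, phase_two_effect hs, h]

/-- The operator of a Pauli string. -/
def pauli : List (Bool × Bool) → M
  | [] => id 0
  | p :: l => plug (act p) ⊠ pauli l

@[simp] theorem dom_pauli (l : List (Bool × Bool)) : (pauli l).dom = l.length := by
  induction l with
  | nil => rfl
  | cons p l ih => simp [pauli, ih, Nat.add_comm]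

@[simp] theorem cod_pauli (l : List (Bool × Bool)) : (pauli l).cod = l.length := by
  induction l with
  | nil => rfl
  | cons p l ih => simp [pauli, ih, Nat.add_comm]

theorem proper_had : Proper had := .mk _

theorem proper_plug_act (p : Bool × Bool) : Proper (plug (act p)) := by
  obtain ⟨x, z⟩ := p
  rw [act, plug_conv (by cases x <;> simp) (by cases x <;> simp [eps, actX])]
  refine .comp ?_ ?_ (by cases x <;> simp [eps, actX])
  · cases x
    · rw [cond_false, plug_eps]; exact proper_id 1
    · rw [cond_true, plug_actX]; exact proper_sp _ _ _ _
  · cases z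
    · rw [cond_false, plug_eps]; exact proper_id 1
    · rw [cond_true, plug_actZ]; exact proper_sp _ _ _ _

theorem proper_pauli (l : List (Bool × Bool)) : Proper (pauli l) := by
  induction l with
  | nil => exact proper_id 0
  | cons p l ih => exact (proper_plug_act p).tens ih

theorem pauli_append (a b : List (Bool × Bool)) : pauli (a ++ b) = pauli a ⊠ pauli b := by
  induction a with
  | nil => simp [pauli]
  | cons p a ih => rw [List.cons_append, pauli, ih, pauli, tens_assoc]

theorem plug_cp (l : List (Bool × Bool)) :
    sp .red 0 1 2 ⊠ id l.length ⨾ cp l = pauli l ⊠ sp .red 0 1 2 := by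
  induction l with
  | nil => simp [cp, pauli, comp_id]
  | cons p l ih =>
    have e : (sp .red 0 1 2 ⊠ id (p :: l).length : M) =
        (sp .red 0 1 2 ⊠ id 1) ⊠ id l.length := by
      rw [tens_assoc, id_tens_id, List.length_cons, Nat.add_comm]
    rw [cp, e, ← comp_assoc, ← comp_tens_id (by simp), plug_weave (by simp) (by simp), tens_assoc,
      ← comp_tens_comp (by simp) (by simp [Nat.add_comm]), comp_id (by simp), ih, pauli, tens_assoc]

/-- A state is fixed by its stabilisers, up to scalars. -/
theorem Slide.pauli_eq {φ : M} {w : List (Bool × Bool)} (h : Slide φ [] w) : φ ⨾ pauli w = φ := by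
  obtain ⟨k, h1, h2, h⟩ := h
  replace h1 : φ.dom = 0 := h1
  have i : ∀ k, (sp .red 0 1 2 ⨾ sp .green 1 0 k : M) = id 0 := state_two_effect .green
  have l := congrArg (fun x => sp .red 0 1 2 ⨾ x ⨾ id w.length ⊠ sp .green 1 0 0) h
  simp only [cp, comp_assoc] at l
  have e1 : sp .red 0 1 2 ⨾ id 1 ⊠ φ = φ ⨾ sp .red 0 1 2 ⊠ id w.length := by
    have := exch (a := sp .red 0 1 2) (b := φ) (m := 0) (m' := 1) (n := 0) (n' := w.length)
      (by simp) (by simp) h1 h2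
    rw [id_zero_tens, tens_id_zero] at this
    exact this.symm
  have e2 : (pauli w ⊠ sp .red 0 1 2 ⨾ id w.length ⊠ sp .green 1 0 0 : M) = pauli w := by
    rw [← comp_tens_comp (by simp) (by simp), i, comp_id (by simp), tens_id_zero]
  have e3 : (φ ⊠ sp .green 1 1 k ⨾ id w.length ⊠ sp .green 1 0 0 : M) = φ ⊠ sp .green 1 0 k := by
    rw [← comp_tens_comp (by simp [h2]) (by simp), comp_id h2, sp_comp, add_zero]
  have e4 : sp .red 0 1 2 ⨾ φ ⊠ sp .green 1 0 k = φ := by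
    have := right_left (a := φ) (b := sp .green 1 0 k) (m := 0) (n := 0) h1 (by simp)
    rw [id_zero_tens, tens_id_zero] at this
    rw [← this, ← comp_assoc, i, id_comp h1]
  rw [reassoc e1, comp_assoc, reassoc (plug_cp w), e2, id_comp (by simp [h1]), e3, e4] at l
  exact l

/-- A stabiliser that flips the measured qubit relates the two outcomes. -/
theorem meas_flip {φ : M} {a b : List (Bool × Bool)} {q : Bool × Bool} {i j : ℕ} (hq : q.1 = true)
    (ha : a.length = i) (hb : b.length = j) (h : Slide φ [] (a ++ ([q] ++ b))) {s : ZMod 4}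
    (hs : s = 0 ∨ s = 2) :
    φ ⨾ meas i j s = (φ ⨾ meas i j (s + 2)) ⨾ pauli a ⊠ pauli b := by
  have e : pauli (a ++ ([q] ++ b)) ⨾ meas i j s = meas i j (s + 2) ⨾ pauli a ⊠ pauli b := by
    rw [pauli_append, pauli_append, meas, meas, ← comp_tens_comp (by simp [ha]) (by simp [hb]),
      ← comp_tens_comp (by simp) (by simp [hb]), comp_id (by simp [ha]), comp_id (by simp [hb]),
      ← id_comp (n := i) (a := pauli a) (by simp [ha])]
    have p : pauli [q] ⨾ sp .red 1 0 s = sp .red 1 0 (s + 2) := by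
      rw [pauli, pauli, tens_id_zero, plug_act_effect hq hs]
    rw [p]
    have l := left_right (a := sp .red 1 0 (s + 2)) (b := pauli b) (m := 0) (n := j) (by simp)
      (by simp [hb])
    rw [id_zero_tens] at l
    rw [← l, comp_tens_comp (a := id i) (b := pauli a) (by simp [ha]) (by simp [hb]),
      id_comp (a := pauli a) (by simp [ha])]
  rw [comp_assoc, ← e, ← comp_assoc, h.pauli_eq]

/-! ### Stabilizer states -/

/-- A nonzero state with a maximal set of stabilisers. -/
def Good (φ : M) : Prop := Dich φ ∧ ¬ Vanish φ

/-- States that are either nonzero stabilizer states or provably zero. -/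
def Decided (φ : M) : Prop := Proper φ ∧ φ.dom = 0 ∧ (Good φ ∨ Zero φ)

/-- Operations that preserve decided states. -/
def Decides (a : M) : Prop :=
  Proper a ∧ ∀ (i j : ℕ) (φ : M), φ.cod = i + (a.dom + j) → Decided φ →
    Decided (φ ⨾ id i ⊠ a ⊠ id j)

/-- A zero scalar is kept by every further composition, so only nonzero stabilizer states need an
argument. -/
theorem Decides.of_good {a : M} (ha : Proper a) (h : ∀ (i j : ℕ) (φ : M), φ.cod = i + (a.dom + j) →
    Proper φ → φ.dom = 0 → Good φ → Good (φ ⨾ id i ⊠ a ⊠ id j) ∨ Zero (φ ⨾ id i ⊠ a ⊠ id j)) :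
    Decides a := by
  refine ⟨ha, fun i j φ hc hφ => ?_⟩
  obtain ⟨h1, h2, h3⟩ := hφ
  refine ⟨h1.comp (ha.pad i j) (by simp [hc]), by simp [h2], ?_⟩
  rcases h3 with h3 | h3
  · exact h i j φ hc h1 h2 h3
  · exact .inr (h3.comp (by simp [hc]))

theorem Decides.comp {a b : M} (ha : Decides a) (hb : Decides b) (h : a.cod = b.dom) :
    Decides (a ⨾ b) := by
  refine ⟨ha.1.comp hb.1 h, fun i j φ hc hφ => ?_⟩
  have := hb.2 i j _ (by simp [h]) (ha.2 i j φ (by simpa using hc) hφ)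
  rwa [comp_assoc, ← id_tens_comp (by simp [h]), ← comp_tens_id h] at this

theorem Decides.tens {a b : M} (ha : Decides a) (hb : Decides b) : Decides (a ⊠ b) := by
  refine ⟨ha.1.tens hb.1, fun i j φ hc hφ => ?_⟩
  have := hb.2 (i + a.cod) j _ (by simp; omega)
    (ha.2 i (b.dom + j) φ (by rw [hc, dom_tens]; omega) hφ)
  rwa [comp_assoc, ← id_tens_id_tens, ← id_tens_comp (by simp),
    left_right (b := b ⊠ id j) (by simp) (by simp), ← tens_assoc a] at this

theorem decides_id (n : ℕ) : Decides (id n) := by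
  refine ⟨proper_id n, fun i j φ hc hφ => ?_⟩
  rw [id_tens_id, id_tens_id, comp_id (by simpa using hc)]
  exact hφ

theorem Decides.pw {a : M} (h : Decides a) (n : ℕ) : Decides (pw a n) := by
  induction n with
  | zero => exact decides_id 0
  | succ n ih => exact ih.tens h

theorem not_vanish_of_left_inverse {φ a b : M} {i j : ℕ} (hb : Proper b) (hab : a ⨾ b = id a.dom)
    (h : a.cod = b.dom) (hc : φ.cod = i + (a.dom + j)) (hφ : ¬ Vanish φ) :
    ¬ Vanish (φ ⨾ id i ⊠ a ⊠ id j) := fun hv => hφ <| by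
  have := hv.comp (hb.pad i j) (by simp [h])
  rwa [comp_assoc, ← id_tens_comp (by simp [h]), ← comp_tens_id h, hab, id_tens_id, id_tens_id,
    comp_id hc] at this

theorem Clifford.decides {n : ℕ} {U V : M} (h : Clifford n U) (hU : Proper U) (hV : Proper V)
    (hUV : U ⨾ V = id n) (hV' : V.dom = n) : Decides U := by
  refine .of_good hU fun i j φ hc _ _ hg => .inl ⟨hg.1.clifford (h.1 ▸ hc) h, ?_⟩
  exact not_vanish_of_left_inverse hV (by rw [hUV, h.1]) (by rw [h.2.1, hV']) hc hg.2

theorem decides_had : Decides had := clifford_had.decides proper_had proper_had had_had rfl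

theorem decides_phase_one : Decides (sp .green 1 1 1) :=
  clifford_phase.decides (proper_sp _ _ _ _) (proper_sp _ _ _ _)
    (by rw [sp_comp, add_neg_cancel (1 : ZMod 4), sp_one]) rfl

theorem decides_sw_one : Decides (sw 1 1) :=
  clifford_sw.decides (.mk _) (.mk _) (sw_sw 1 1) rfl

theorem proper_cnot : Proper cnot :=
  ((proper_sp _ _ _ _).tens (proper_id 1)).comp ((proper_id 1).tens (proper_sp _ _ _ _)) (by simp)

theorem decides_cnot : Decides cnot :=
  clifford_cnot.decides proper_cnot proper_cnot cnot_cnot (by simp)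

/-- Preparation of a qubit. -/
theorem decides_state : Decides (sp .red 0 1 0) := by
  refine .of_good (proper_sp _ _ _ _) fun i j φ hc _ hd hg => .inl ⟨?_, ?_⟩
  · intro v hv
    obtain ⟨a, p, b, rfl, ha, hp, hb⟩ := exists_split (i := i) (n := 1) (j := j) (by simpa using hv)
    obtain ⟨⟨x, z⟩, rfl⟩ := List.length_eq_one_iff.1 hp
    have hI : ∀ z, Slide (sp .red 0 1 0) [] [(false, z)] := by
      rintro (_ | _)
      · exact Slide.trivial (n := 0) (m := 1) rfl rfl
      · exact slide_state
    -- Without X on the new qubit, the string extends one on the old state by I or Z, and both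
    -- stabilise |0⟩. With X, it anticommutes with Z on the new qubit, which is a stabiliser.
    cases x
    · rcases hg.1 (a ++ ([] ++ b)) (by simp [ha, hb, hc]) with h | ⟨w, h, hs⟩
      · exact .inl (h.seq ((hI z).pad ha hb))
      · obtain ⟨a', w, b', rfl, ha', hw, hb'⟩ := exists_split (h.cod_eq.symm.trans hc)
        obtain rfl := List.length_eq_zero_iff.1 hw
        refine .inr ⟨_, h.seq ((hI false).pad ha' hb'), ?_⟩
        rw [symp_append (by rw [ha, ha'])] at hs ⊢
        simpa [symp] using hs
    · refine .inr ⟨List.replicate i (false, false) ++ ([(false, true)] ++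
        List.replicate j (false, false)), Slide.seq (q := List.replicate i (false, false) ++ ([] ++
          List.replicate j (false, false))) ?_ (slide_state.pad (by simp) (by simp)), ?_⟩
      · rw [List.nil_append, List.replicate_append_replicate]
        exact Slide.trivial (n := 0) hd (by simpa using hc)
      · rw [symp_append (by simp [ha]), symp_append (by simp), symp_comm a, symp_comm b,
          symp_replicate, symp_replicate]
        simp [symp]
  · exact not_vanish_of_left_inverse (b := sp .red 1 0 0) (proper_sp _ _ _ _)
      (by rw [sp_comp, add_zero, sp_zero_eq_id]; rfl) rfl hc hg.2

/-- A nontrivial phase that can be created freely beside `χ` yields the phase π, after doubling if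
necessary. Closing the wire with a green state and effect turns the phase into the zero scalar, and
the bare wire into an invertible one. -/
theorem zero_of_phase {χ : M} (hd : χ.dom = 0) {k : ZMod 4} (hk : k ≠ 0)
    (h : χ ⊠ id 1 = χ ⊠ sp .green 1 1 k) : Zero χ := by
  have h2 : ∀ l, χ ⊠ sp .green 1 1 l = χ ⊠ sp .green 1 1 (k + l) := fun l => by
    have := congrArg (· ⨾ id χ.cod ⊠ sp .green 1 1 l) h
    rwa [← comp_tens_comp (by simp) (by simp), ← comp_tens_comp (by simp) (by simp),
      comp_id rfl, id_comp (by simp), sp_comp] at this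
  have key : ∀ k : ZMod 4, k ≠ 0 → k = 2 ∨ k + k = 2 := by decide
  have h3 : χ ⊠ id 1 = χ ⊠ sp .green 1 1 2 := by
    have hk' : k = 2 ∨ k + k = 2 := key k hk
    rcases hk' with rfl | hk'
    · exact h
    · rw [h, h2, hk']
  have h4 := congrArg (fun x => (id 0 ⊠ sp .green 0 1 0 ⨾ x) ⨾ id χ.cod ⊠ sp .green 1 0 0)
    h3
  simp only [← comp_tens_comp (a := χ) (b := id χ.cod) (c := id 1) (d := sp .green 1 0 0) rfl rfl,
    ← comp_tens_comp (a := χ) (b := id χ.cod) (c := sp .green 1 1 2) (d := sp .green 1 0 0) rfl rfl,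
    comp_assoc] at h4
  rw [← comp_tens_comp (by simp [hd]) (by simp), ← comp_tens_comp (by simp [hd]) (by simp),
    id_comp (by simp [hd]), comp_id rfl, id_comp (by simp), sp_comp, sp_comp, sp_comp] at h4
  norm_num [sp_zero_eq_id] at h4
  rw [Zero, ← tens_scalar (by simp) (by simp)]
  exact h4.symm

theorem slideBy_meas {s : ZMod 4} (hs : s = 0 ∨ s = 2) (i j : ℕ) :
    SlideBy s (meas i j s) (List.replicate i (false, false) ++ ([(false, true)] ++
      List.replicate j (false, false))) (List.replicate (i + j) (false, false)) := by
  have h : SlideBy s (sp .red 1 0 s) [(false, true)] [] := by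
    rcases hs with rfl | rfl
    · exact slideBy_effect
    · exact slideBy_effect_two
  have := (SlideBy.ident (List.replicate i (false, false))).par
    (h.par (SlideBy.ident (List.replicate j (false, false))))
  simpa [meas] using this

theorem slide_meas {i j : ℕ} {a b : List (Bool × Bool)} (ha : a.length = i) (hb : b.length = j)
    (z : Bool) (s : ZMod 4) (hs : s = 0 ∨ s = 2) :
    Slide (meas i j s) (a ++ ([(false, z)] ++ b)) (a ++ ([] ++ b)) := by
  refine Slide.pad ?_ ha hb
  cases z
  · exact Slide.trivial (n := 1) (m := 0) rfl rfl
  · rcases hs with rfl | rfl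
    · exact ⟨_, slideBy_effect⟩
    · exact ⟨_, slideBy_effect_two⟩

/-- Projection of a qubit. -/
theorem decides_effect : Decides (sp .red 1 0 0) := by
  refine .of_good (proper_sp _ _ _ _) fun i j φ hc hp hd hg => ?_
  change Good (φ ⨾ meas i j 0) ∨ Zero (φ ⨾ meas i j 0)
  replace hc : φ.cod = i + (1 + j) := hc
  have flip0 {a b : List (Bool × Bool)} {q : Bool × Bool} (hq : q.1 = true) (ha : a.length = i)
      (hb : b.length = j) (h : Slide φ [] (a ++ ([q] ++ b))) :=
    meas_flip hq ha hb h (s := 0) (.inl rfl)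
  have cm : ∀ s, (φ ⨾ meas i j s).cod = i + j := fun s => by simp
  -- A string on the remaining qubits is extended by I or Z on the measured one, as chosen by `z`.
  -- Stabilisers without X there survive the measurement, so the anticommuting witness must be
  -- replaced by one of that kind.
  have dich {z : List (Bool × Bool) → List (Bool × Bool) → Bool}
      (hz : ∀ a b w, a.length = i → b.length = j → Slide φ [] w →
        symp (a ++ ([(false, z a b)] ++ b)) w = true →
        ∃ a' q b', a'.length = i ∧ b'.length = j ∧ q.1 = false ∧ Slide φ [] (a' ++ ([q] ++ b')) ∧
          symp (a ++ ([(false, z a b)] ++ b)) (a' ++ ([q] ++ b')) = true) :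
      Dich (φ ⨾ meas i j 0) := by
    intro v hv
    obtain ⟨a, p, b, rfl, ha, hp, hb⟩ := exists_split (i := i) (n := 0) (j := j) (by simpa using hv)
    obtain rfl := List.length_eq_zero_iff.1 hp
    rcases hg.1 (a ++ ([(false, z a b)] ++ b)) (by simp [ha, hb, hc]; omega) with h | ⟨w, h, hs⟩
    · exact .inl (h.seq (slide_meas ha hb _ _ (.inl rfl)))
    · obtain ⟨a', ⟨x, q⟩, b', ha', hb', hq, h', hs'⟩ := hz a b w ha hb h hs
      obtain rfl : x = false := hq
      refine .inr ⟨_, h'.seq (slide_meas ha' hb' _ _ (.inl rfl)), ?_⟩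
      rw [symp_append (by rw [ha, ha']), symp_append (by simp)] at hs' ⊢
      simpa [symp] using hs'
  have split {w : List (Bool × Bool)} (h : Slide φ [] w) : ∃ a q b, w = a ++ ([q] ++ b) ∧
      a.length = i ∧ b.length = j := by
    obtain ⟨a, q, b, rfl, ha, hq, hb⟩ := exists_split (h.cod_eq.symm.trans hc)
    obtain ⟨q, rfl⟩ := List.length_eq_one_iff.1 hq
    exact ⟨a, q, b, rfl, ha, hb⟩
  -- The dichotomy is applied to Z on the measured qubit.
  rcases hg.1 (List.replicate i (false, false) ++ ([(false, true)] ++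
    List.replicate j (false, false))) (by simp [hc]; omega) with ⟨k, hk⟩ | ⟨w, hw, hs⟩
  -- After outcome `s`, this stabiliser becomes the trivial string with control phase `k + s`. Since
  -- the trivial string only crosses, a nonzero phase forces the state to be zero.
  · have key : ∀ s, s = 0 ∨ s = 2 → k + s ≠ 0 → Zero (φ ⨾ meas i j s) := fun s hs hks => by
      obtain ⟨-, -, h⟩ := hk.seq (slideBy_meas hs i j)
      refine zero_of_phase (by simp [hd]) hks ?_
      obtain ⟨k', hk'⟩ := Slide.trivial (D := φ ⨾ meas i j s) (n := 0) (by simp [hd]) (cm s)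
      have e := tens_sw (a := id 1) (b := φ ⨾ meas i j s) (n := 1) (m := 1) (n' := 0) (m' := i + j)
        (by simp) (by simp) (by simp [hd]) (cm s)
      rw [sw_zero, id_comp (by simp [hd])] at e
      rw [← e, ← cp_replicate, h]
      exact id_comp (by simp [hd])
    by_cases hk0 : k = 0
    · have z2 := key 2 (.inr rfl) (by rw [hk0]; decide)
      -- Here outcome ⟨1| is zero. A stabiliser with X on the measured qubit would carry this zero
      -- over to outcome ⟨0|; if there is none, all stabilisers survive the measurement.
      by_cases hz : ∃ a q b, Slide φ [] (a ++ ([q] ++ b)) ∧ a.length = i ∧ b.length = j ∧ q.1 = true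
      · obtain ⟨a, q, b, h, ha, hb, hq⟩ := hz
        rw [flip0 hq ha hb h]
        exact .inr (Zero.comp z2 (by simp [ha, hb]))
      · refine .inl ⟨dich (z := fun _ _ => false) ?_, fun hv => hg.2 (vanish_of_meas hp hc hv
          (z2.vanish (hp.comp (proper_meas i j 2) (by simp [hc]))))⟩
        intro a b w ha hb h hs
        obtain ⟨a', q, b', rfl, ha', hb'⟩ := split h
        refine ⟨a', q, b', ha', hb', ?_, h, hs⟩
        by_contra hq
        exact hz ⟨_, _, _, h, ha', hb', by simpa using hq⟩
    · exact .inr (key 0 (.inl rfl) (by simpa using hk0))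
  · obtain ⟨a', q, b', rfl, ha', hb'⟩ := split hw
    have hq : q.1 = true := by
      rw [symp_append (by simp [ha']), symp_append (by simp), symp_replicate, symp_replicate] at hs
      simpa [symp] using hs
    -- As `w` has X on the measured qubit, inserting Z there exactly when needed makes the extended
    -- string commute with `w`. A witness with X there can then be multiplied by `w`, which removes
    -- the X and keeps the anticommutation.
    refine .inl ⟨dich (z := fun a b => symp (a ++ ([(false, false)] ++ b)) (a' ++ ([q] ++ b'))) ?_,
      fun hv => hg.2 (vanish_of_meas hp hc hv ?_)⟩
    · intro a b w ha hb h hs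
      have h0 : symp (a ++ ([(false, symp (a ++ ([(false, false)] ++ b)) (a' ++ ([q] ++ b')))] ++ b))
          (a' ++ ([q] ++ b')) = false := by
        rw [symp_append (by rw [ha, ha']), symp_append (by simp), symp_append (by rw [ha, ha']),
          symp_append (by simp)]
        simp only [symp, hq]
        generalize symp a a' = s
        generalize symp b b' = t
        generalize q.2 = r
        clear * -
        revert s t r
        decide
      obtain ⟨a2, q2, b2, rfl, ha2, hb2⟩ := split h
      cases hq2 : q2.1
      · exact ⟨a2, q2, b2, ha2, hb2, hq2, h, hs⟩
      · have hm := h.mul hw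
        have e : (a2 ++ ([q2] ++ b2)).zipWith pmul (a' ++ ([q] ++ b')) =
            a2.zipWith pmul a' ++ ([pmul q2 q] ++ b2.zipWith pmul b') := by
          rw [List.zipWith_append (by rw [ha2, ha']), List.zipWith_append (by simp)]
          rfl
        refine ⟨_, _, _, ?_, ?_, ?_, e ▸ hm, ?_⟩
        · simp [ha2, ha']
        · simp [hb2, hb']
        · simp [pmul, hq, hq2]
        · rw [← e, symp_mul _ _ _ (by simp [ha, ha2, hb, hb2]) (by simp [ha, ha', hb, hb']), hs, h0]
          rfl
    -- The stabiliser `w` exchanges the outcomes up to Pauli operators, so if one vanished then so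
    -- would both.
    · rw [meas_flip hq ha' hb' hw (.inr rfl)]
      exact hv.comp ((proper_pauli _).tens (proper_pauli _)) (by simp [ha', hb'])

/-! ### All stabilizer diagrams preserve decided states -/

theorem decides_green_state : Decides (sp .green 0 1 0) := by
  have h : (sp .red 0 1 0 ⨾ had : M) = sp .green 0 1 0 := had_state .red 0
  exact h ▸ decides_state.comp decides_had rfl

theorem decides_green_effect : Decides (sp .green 1 0 0) := by
  have h : (had ⨾ sp .red 1 0 0 : M) = sp .green 1 0 0 := had_effect .red 0
  exact h ▸ decides_had.comp decides_effect rfl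

/-- Copying is a controlled-not onto a fresh |0⟩. -/
theorem decides_copy : Decides (sp .green 1 2 0) := by
  have f := fuse_in_right (T := modThy) .red 1 1 0 0 0
  norm_num at f
  have h : id 1 ⊠ sp .red 0 1 0 ⨾ cnot = sp .green 1 2 0 := by
    have e := exch (T := modThy) (a := sp .green 1 2 0) (b := sp .red 0 1 0) (m := 1) (m' := 2)
      (n := 0) (n' := 1) (by simp) (by simp) (by simp) (by simp)
    rw [tens_id_zero] at e
    rw [cnot, reassoc e, comp_assoc, ← id_tens_id_tens 1 1, ← id_tens_comp (by simp), f,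
      id_tens_id, comp_id (by simp)]
  exact h ▸ ((decides_id 1).tens decides_state).comp decides_cnot (by simp)

/-- Merging is a controlled-not followed by the projection of the target onto ⟨0|. -/
theorem decides_merge : Decides (sp .green 2 1 0) := by
  have f := sp_comp (T := modThy) .red 2 0 0 0
  norm_num [sp_cap] at f
  have h : cnot ⨾ id 1 ⊠ sp .red 1 0 0 = sp .green 2 1 0 := by
    rw [cnot, comp_assoc, ← id_tens_comp (by simp), f, sp_two_one']
  exact h ▸ decides_cnot.comp ((decides_id 1).tens decides_effect) (by simp)

theorem decides_green_in (n : ℕ) : Decides (sp .green n 1 0) := by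
  induction n with
  | zero => exact decides_green_state
  | succ n ih =>
    have f := fuse_in_left (T := modThy) .green 1 1 n 0 0
    norm_num at f
    exact f ▸ (ih.tens (decides_id 1)).comp decides_merge (by simp)

theorem decides_green_out (m : ℕ) : Decides (sp .green 1 m 0) := by
  induction m with
  | zero => exact decides_green_effect
  | succ m ih =>
    have f := fuse_left (T := modThy) .green 1 1 m 0 0
    norm_num at f
    exact f ▸ decides_copy.comp (ih.tens (decides_id 1)) (by simp)

theorem decides_phase (k : ZMod 4) : Decides (sp .green 1 1 k) := by
  have h : ∀ n : ℕ, Decides (sp .green 1 1 (n : ZMod 4)) := fun n => by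
    induction n with
    | zero => rw [Nat.cast_zero, sp_one]; exact decides_id 1
    | succ n ih =>
      rw [Nat.cast_succ, ← sp_comp]
      exact ih.comp decides_phase_one rfl
  have := h k.val
  rwa [ZMod.natCast_zmod_val] at this

theorem decides_green (n m : ℕ) (k : ZMod 4) : Decides (sp .green n m k) := by
  have e : (sp .green n 1 0 ⨾ sp .green 1 1 k ⨾ sp .green 1 m 0 : M) = sp .green n m k := by
    rw [sp_comp, sp_comp, add_zero, zero_add]
  exact e ▸ (decides_green_in n).comp ((decides_phase k).comp (decides_green_out m) rfl) rfl

theorem decides_sp (c : Colour) (n m : ℕ) (k : ZMod 4) : Decides (sp c n m k) := by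
  cases c
  · exact decides_green n m k
  · have e : (_ : M) = sp .red n m k := colour_change .green n m k
    exact e ▸ (decides_had.pw n).comp ((decides_green n m k).comp (decides_had.pw m) (by simp))
      (by simp)

theorem decides_sw (n m : ℕ) : Decides (sw n m) := by
  have h : ∀ m, Decides (sw 1 m) := fun m => by
    induction m with
    | zero => rw [sw_zero]; exact decides_id 1
    | succ m ih =>
      rw [sw_add]
      exact (ih.tens (decides_id 1)).comp ((decides_id m).tens decides_sw_one) (by simp)
  induction n with
  | zero => rw [zero_sw]; exact decides_id m
  | succ n ih =>
    rw [add_sw]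
    exact ((decides_id n).tens (h m)).comp (ih.tens (decides_id 1)) (by simp; omega)

theorem decides_mk {n m : ℕ} (D : Diag n m) (h : D.IsStabilizer) : Decides (mk modThy D) := by
  induction D with
  | wires n => exact decides_id n
  | swap n m => exact decides_sw n m
  | cup =>
    change Decides cup
    rw [← sp_cup .green]
    exact decides_sp .green 0 2 0
  | cap =>
    change Decides cap
    rw [← sp_cap .green]
    exact decides_sp .green 2 0 0
  | spider c n m α =>
    obtain ⟨k, rfl⟩ := h
    have e : (sp c n m k : M) = mk modThy (spider c n m (k • halfPi)) := by rw [sp, phase_intCast]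
    exact e ▸ decides_sp c n m k
  | had => exact decides_had
  | star =>
    change Decides star
    rw [star_eq_id]
    exact decides_id 0
  | seq D E ih ih' =>
    rw [mk_seq]
    exact (ih h.1).comp (ih' h.2) rfl
  | par D E ih ih' => exact (ih h.1).tens (ih' h.2)

theorem decided_empty : Decided (id 0) := by
  refine ⟨proper_id 0, rfl, .inl ⟨fun v hv => .inl ?_, ?_⟩⟩
  · obtain rfl := List.length_eq_zero_iff.1 hv
    exact Slide.ident []
  · rw [id, vanish_mk]
    exact one_ne_zero

/-- A state is obtained by applying the diagram to the empty one, so it is decided, and vanishing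
excludes `Good`. Inputs are bent into outputs one at a time; bending back by a snake preserves the
zero scalar. -/
theorem zero_of_interp {n m : ℕ} (D : Diag n m) (h : D.IsStabilizer) (h0 : D.interp = 0) :
    Zero (mk modThy D) := by
  induction n generalizing m with
  | zero =>
    have := ((decides_mk D h).2 0 0 (id 0) rfl decided_empty).2.2
    rw [id_zero_tens, tens_id_zero, id_comp (by simp)] at this
    exact this.resolve_left fun hg => hg.2 (vanish_mk.2 h0)
  | succ n ih =>
    have h1 := ih (m := m + 1) (Diag.seq (n := n) (m := n + 2) (Diag.par (wires n) Diag.cup)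
      (Diag.par (n := n + 1) (n' := 1) D (wires 1))) (by simp [h]) (by
        rw [interp, (interp_eq_zero_iff _).2, Matrix.zero_mul]
        intro y x
        rw [ev_par, (interp_eq_zero_iff _).1 h0, zero_mul])
    have h2 : mk modThy D = mk modThy (Diag.seq (n := n) (m := n + 2) (Diag.par (wires n) Diag.cup)
        (Diag.par (n := n + 1) (n' := 1) D (wires 1))) ⊠ id 1 ⨾ id m ⊠ cap := by
      have e : mk modThy (Diag.seq (n := n) (m := n + 2) (Diag.par (wires n) Diag.cup)
        (Diag.par (n := n + 1) (n' := 1) D (wires 1))) = id n ⊠ cup ⨾ mk modThy D ⊠ id 1 := mk_seq _ _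
      have x := exch (T := modThy) (a := mk modThy D) (b := cap) (m := n + 1) (m' := m) (n := 2)
        (n' := 0) (by simp) (by simp) (by simp) (by simp)
      rw [tens_id_zero] at x
      have s := congrArg (fun x => id n ⊠ x) (snake_right (T := modThy))
      rw [id_tens_comp (by simp), id_tens_id] at s
      rw [e, comp_tens_id (by simp), tens_assoc, tens_assoc, id_tens_id, comp_assoc, ← x,
        ← comp_assoc, ← id_tens_id, tens_assoc, s, id_comp (by simp)]
    rw [h2]
    have : Zero (mk modThy (Diag.seq (n := n) (m := n + 2) (Diag.par (wires n) Diag.cup)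
        (Diag.par (n := n + 1) (n' := 1) D (wires 1))) ⊠ id 1) := by
      rw [Zero, ← tens_assoc, h1]
    exact this.comp (by simp)

end Q

end ZX

end

/-! ### Return to exact scalars, and disconnection into normal forms -/

noncomputable section

namespace ZX

open Diag

namespace Q

set_option linter.unusedSimpArgs false

/-! ### Removing invertible scalars -/

/-- Scalars move freely, so the invertible scalars dropped along a derivation modulo scalars collect
into a single one. -/
theorem exists_isInv {n m n' m' : ℕ} {D : Diag n m} {E : Diag n' m'} (h : Cong modThy.rel D E) :
    ∃ u, IsInv u ∧ mk stabThy D = u ⊠ mk stabThy E := by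
  have one : IsInv (id 0 : Q stabThy) := ⟨id 0, by simp⟩
  induction h with
  | @of n m n' m' D E h =>
    change ModAx D E at h
    cases h with
    | stab h => exact ⟨id 0, one, by rw [id_zero_tens]; exact mk_eq_iff.2 (.of h)⟩
    | unit s t h => exact ⟨mk stabThy s, ⟨mk stabThy t, mk_eq_iff.2 h⟩, (tens_id_zero _).symm⟩
  | refl D => exact ⟨id 0, one, (id_zero_tens _).symm⟩
  | symm _ ih =>
    obtain ⟨u, hu, h⟩ := ih
    have d := hu.dom_cod
    obtain ⟨v, hv⟩ := hu
    have hv' : v ⊠ u = id 0 := by rw [tens_scalar d.1 d.2, hv]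
    exact ⟨v, ⟨u, hv'⟩, by rw [h, ← tens_assoc, hv', id_zero_tens]⟩
  | trans _ _ ih ih' =>
    obtain ⟨u, hu, h⟩ := ih
    obtain ⟨v, hv, h'⟩ := ih'
    exact ⟨_, hu.tens hv, by rw [h, h', tens_assoc]⟩
  | @seq n m k n' m' k' D E D' E' _ _ ih ih' =>
    obtain ⟨u, hu, h⟩ := ih
    obtain ⟨v, hv, h'⟩ := ih'
    refine ⟨_, hu.tens hv, ?_⟩
    rw [mk_seq, mk_seq, h, h', ← scalar_tens_comp hu.dom_cod.2 _ (by simp [hv.dom_cod.1]),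
      comp_scalar_tens hv.dom_cod.1 _ (by simp), tens_assoc]
  | par _ _ ih ih' =>
    obtain ⟨u, hu, h⟩ := ih
    obtain ⟨v, hv, h'⟩ := ih'
    refine ⟨_, hu.tens hv, ?_⟩
    rw [mk_par, mk_par, h, h', tens_assoc, ← tens_assoc (mk stabThy _) v,
      tens_scalar hv.dom_cod.1 hv.dom_cod.2, tens_assoc, tens_assoc]

theorem zro_tens_zro {T : Theory} [StabTheory T] : (zro ⊠ zro : Q T) = zro := zro_sp .green 2

/-- Exactly, `D` equals `u ⊠ zro ⊠ D` for some invertible `u`. Multiplying by the idempotent `zro`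
does not change that right-hand side, so it does not change `D`. -/
theorem zro_tens_of_zero {n m : ℕ} {D : Diag n m} (h : Zero (mk modThy D)) :
    zro ⊠ mk stabThy D = mk stabThy D := by
  obtain ⟨u, hu, e⟩ := exists_isInv (D := D) (E := Diag.par (gn 0 0 (phase 2)) D)
    (mk_eq_iff.1 h.symm)
  change mk stabThy D = u ⊠ zro ⊠ mk stabThy D at e
  have e' := congrArg (fun x => zro ⊠ x) e
  rw [← tens_assoc zro u, tens_scalar hu.dom_cod.1 hu.dom_cod.2, tens_assoc, ← tens_assoc zro zro,
    zro_tens_zro, ← e] at e'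
  exact e'

/-! ### Juxtapositions of nodes -/

/-- Effects beside states beside zero scalars. -/
def nodes {T : Theory} (c d : Colour) (s n m : ℕ) : Q T :=
  pw zro s ⊠ pw (sp c 1 0 0) n ⊠ pw (sp d 0 1 0) m

theorem state_tens_effect {T : Theory} {a b : Q T} (h : a.dom = 0) (h' : b.cod = 0) :
    a ⊠ b = b ⊠ a := by
  rw [← right_left (m := 0) (n := 0) h h', ← left_right (a := b) (m := 0) (n := 0) h' h,
    id_zero_tens, id_zero_tens, tens_id_zero, tens_id_zero]

theorem effect_comp_state {T : Theory} {a b : Q T} (h : a.cod = 0) (h' : b.dom = 0) :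
    a ⨾ b = a ⊠ b := by
  rw [← left_right (m := 0) (n := 0) h h', id_zero_tens, tens_id_zero]

theorem nodes_tens_nodes {T : Theory} (c d : Colour) (s n m s' n' m' : ℕ) :
    (nodes c d s n m ⊠ nodes c d s' n' m' : Q T) = nodes c d (s + s') (n + n') (m + m') := by
  have h1 : (pw (sp d 0 1 0) m ⊠ pw zro s' : Q T) = pw zro s' ⊠ pw (sp d 0 1 0) m :=
    tens_scalar (by simp) (by simp) _
  have h2 : (pw (sp c 1 0 0) n ⊠ pw zro s' : Q T) = pw zro s' ⊠ pw (sp c 1 0 0) n :=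
    tens_scalar (by simp) (by simp) _
  have h3 : (pw (sp d 0 1 0) m ⊠ pw (sp c 1 0 0) n' : Q T) =
      pw (sp c 1 0 0) n' ⊠ pw (sp d 0 1 0) m := state_tens_effect (by simp) (by simp)
  simp only [nodes, pw_add, tens_assoc]
  congr 1
  rw [← tens_assoc (pw (sp d 0 1 0) m), h1, tens_assoc, ← tens_assoc (pw (sp c 1 0 0) n), h2,
    tens_assoc, ← tens_assoc (pw (sp d 0 1 0) m), h3, tens_assoc]

/-- States, effects and scalars commute with each other under juxtaposition by monoidal laws alone.
It therefore holds for topological equality too, and gives uniqueness of normal forms. -/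
theorem mk_of_pieces {T : Theory} {c d : Colour} {s n m : ℕ} {D : Diag n m} (h : Pieces c d s D) :
    mk T D = nodes c d s n m := by
  induction h with
  | empty => simp [nodes]; rfl
  | onInput => simp [nodes, sp]
  | onOutput => simp [nodes, sp]
  | piScalar => simp [nodes, zro, sp, phase_two]
  | par _ _ ih ih' => rw [mk_par, ih, ih', nodes_tens_nodes]

theorem exists_isZeroNF (c d : Colour) (n m : ℕ) : ∃ N : Diag n m, IsZeroNF c d N := by
  induction m with
  | zero =>
    induction n with
    | zero => exact ⟨_, .piScalar⟩
    | succ n ih =>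
      obtain ⟨N, hN⟩ := ih
      exact ⟨Diag.par N (spider c 1 0 0), hN.par .onInput⟩
  | succ m ih =>
    obtain ⟨N, hN⟩ := ih
    exact ⟨Diag.par N (spider d 0 1 0), hN.par .onOutput⟩

theorem nodes_one {T : Theory} (c d : Colour) (n m : ℕ) :
    (nodes c d 1 n m : Q T) = zro ⊠ (pw (sp c 1 0 0) n ⨾ pw (sp d 0 1 0) m) := by
  rw [nodes, pw_one, effect_comp_state (by simp) (by simp)]

/-! ### Disconnecting a diagram in the presence of a zero scalar -/

section Cut

variable {T : Theory} [StabTheory T]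

theorem zro_zro_tens (a : Q T) : zro ⊠ zro ⊠ a = zro ⊠ a := by
  rw [← tens_assoc, zro_tens_zro]

/-- As the zero scalar is idempotent, one copy can be made available to every part of a diagram. -/
theorem zro_tens_comp {a b : Q T} (h : a.cod = b.dom) : zro ⊠ (a ⨾ b) = (zro ⊠ a) ⨾ (zro ⊠ b) := by
  rw [comp_scalar_tens (by simp) _ (by simpa using h), ← scalar_tens_comp (by simp) _ h,
    zro_zro_tens]

theorem zro_tens_tens (a b : Q T) : zro ⊠ a ⊠ b = (zro ⊠ a) ⊠ zro ⊠ b := by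
  rw [tens_assoc, ← tens_assoc a zro, tens_scalar (s := zro) (by simp) (by simp), tens_assoc,
    zro_zro_tens]

theorem zro_tens_congr_comp {a b a' b' : Q T} (h : a.cod = b.dom) (h' : a'.cod = b'.dom)
    (ha : zro ⊠ a = zro ⊠ a') (hb : zro ⊠ b = zro ⊠ b') : zro ⊠ (a ⨾ b) = zro ⊠ (a' ⨾ b') := by
  rw [zro_tens_comp h, zro_tens_comp h', ha, hb]

theorem zro_tens_congr_tens {a b a' b' : Q T} (ha : zro ⊠ a = zro ⊠ a') (hb : zro ⊠ b = zro ⊠ b') :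
    zro ⊠ a ⊠ b = zro ⊠ a' ⊠ b' := by
  rw [zro_tens_tens, ha, hb, ← zro_tens_tens]

/-- Legless nodes are absorbed, also in the middle of a composite. -/
theorem zro_tens_comp_sp {a b : Q T} (ha : a.cod = 0) (hb : b.dom = 0) (c : Colour) (k : ZMod 4) :
    zro ⊠ (a ⨾ sp c 0 0 k ⨾ b) = zro ⊠ (a ⨾ b) := by
  refine zro_tens_congr_comp (by simp [ha]) (by rw [ha, hb]) rfl ?_
  rw [scalar_comp (by simp) hb, ← tens_assoc, zro_sp]

/-- The rule cuts into opposite colours. For equal colours the wire is cut twice, and the legless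
node between the cuts is absorbed. -/
theorem zro_cut_any (c d : Colour) : (zro ⊠ id 1 : Q T) = zro ⊠ (sp c 1 0 0 ⨾ sp d 0 1 0) := by
  have h : ∀ c : Colour, (zro ⊠ id 1 : Q T) = zro ⊠ (sp c 1 0 0 ⨾ sp c 0 1 0) := fun c => by
    have h2 := zro_cut (T := T) c.other
    rw [Colour.other_other] at h2
    have := zro_tens_congr_comp (T := T) (a := id 1) (b := id 1) rfl (by simp) (zro_cut c) h2
    rwa [id_comp (by simp), comp_assoc, ← comp_assoc (sp c.other 0 1 0), sp_comp, zro_tens_comp_sp (by simp) (by simp)] at this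
  cases c <;> cases d
  · exact h _
  · exact zro_cut .green
  · exact zro_cut .red
  · exact h _

theorem zro_cut_wires (c d : Colour) (n : ℕ) :
    (zro ⊠ id n : Q T) = zro ⊠ (pw (sp c 1 0 0) n ⨾ pw (sp d 0 1 0) n) := by
  rw [pw_comp rfl]
  induction n with
  | zero => rfl
  | succ n ih =>
    rw [pw, ← id_tens_id]
    exact zro_tens_congr_tens ih (zro_cut_any c d)

theorem states_sp (c : Colour) (n m : ℕ) (k : ZMod 4) :
    (pw (sp c 0 1 0) n ⨾ sp c n m k : Q T) = sp c 0 m k := by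
  induction n with
  | zero => rw [pw_zero, id_comp (by simp)]
  | succ n ih =>
    have f := fuse_in_right (T := T) c m n 0 k 0
    norm_num at f
    rw [pw, ← left_right (a := pw (sp c 0 1 0) n) (m := n) (n := 0) (by simp) rfl, tens_id_zero,
      comp_assoc, f, ih]

theorem sp_effects_pw (c : Colour) (n m : ℕ) (k : ZMod 4) :
    (sp c n m k ⨾ pw (sp c 1 0 0) m : Q T) = sp c n 0 k := by
  induction m with
  | zero => rw [pw_zero, comp_id (by simp)]
  | succ m ih =>
    have f := fuse_right (T := T) c n m 0 k 0
    norm_num at f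
    rw [pw, ← right_left (a := pw (sp c 1 0 0) m) (b := sp c 1 0 0) (m := m) (n := 0) (by simp) rfl,
      tens_id_zero, ← comp_assoc, f, ih]

theorem zro_tens_inn (c d : Colour) : (zro ⊠ (sp d 0 1 0 ⨾ sp c 1 0 0) : Q T) = zro := by
  have key : ∀ c : Colour, (zro ⊠ (sp c.other 0 1 0 ⨾ sp c 1 0 0) : Q T) = zro := fun c => by
    -- Cutting the wire inside the inner product yields two inner products, which together form a
    -- legless spider and are absorbed.
    have h := zro_tens_congr_comp (T := T) (a := sp c.other 0 1 0 ⨾ id 1) (b := sp c 1 0 0)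
      (by simp) (by simp) (zro_tens_congr_comp (a := sp c.other 0 1 0) (by simp) (by simp) rfl
        (zro_cut c)) rfl
    rw [comp_id (by simp)] at h
    rw [h, ← comp_assoc, comp_assoc, scalar_comp (by simp) (by simp)]
    change zro ⊠ inn c 0 0 ⊠ inn c 0 0 = _
    rw [inn_tens_inn, zro_sp]
  have key' : ∀ c : Colour, (zro ⊠ (sp c 0 1 0 ⨾ sp c 1 0 0) : Q T) = zro := fun c => by
    rw [sp_comp, zro_sp]
  cases c <;> cases d
  · exact key' _
  · exact key .green
  · exact key .red
  · exact key' _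

theorem zro_tens_pw {T : Theory} {a : Q T} (h : zro ⊠ a = zro) (n : ℕ) : zro ⊠ pw a n = zro := by
  induction n with
  | zero => exact tens_id_zero _
  | succ n ih => rw [pw, ← tens_assoc, ih, h]

theorem zro_tens_sp (e c d : Colour) (n m : ℕ) (k : ZMod 4) :
    (zro ⊠ sp e n m k : Q T) = nodes c d 1 n m := by
  have h := zro_tens_congr_comp (T := T) (a := id n) (b := sp e n m k ⨾ id m) (by simp) (by simp)
    (zro_cut_wires c e n) (zro_tens_congr_comp (by simp) (by simp) rfl (zro_cut_wires e d m))
  rw [id_comp (by simp), comp_id (by simp), comp_assoc, ← comp_assoc (sp e n m k), sp_effects_pw,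
    ← comp_assoc (pw (sp e 0 1 0) n), states_sp, zro_tens_comp_sp (by simp) (by simp)] at h
  rw [h, nodes_one]

/-- Beside a zero scalar, cutting the legs disconnects every generator. In a composite, the states
of the first part meet the effects of the second in scalars that the zero scalar absorbs. -/
theorem zro_tens_mk (c d : Colour) {n m : ℕ} (D : Diag n m) (h : D.IsStabilizer) :
    zro ⊠ mk T D = nodes c d 1 n m := by
  induction D with
  | wires n =>
    rw [nodes_one]
    exact zro_cut_wires c d n
  | swap n m =>
    change zro ⊠ sw n m = _
    have h := zro_tens_congr_comp (T := T) (a := id (n + m)) (b := sw n m) (by simp) (by simp)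
      (zro_cut_wires c d (n + m)) rfl
    rw [id_comp (by simp), comp_assoc, pw_add _ n m, pw_add _ n m,
      tens_sw (n := 0) (n' := 0) (by simp) (by simp) (by simp) (by simp), zero_sw,
      id_comp (by simp), ← pw_add, ← pw_add] at h
    rw [h, nodes_one]
  | cup =>
    change zro ⊠ cup = _
    rw [← sp_cup .green, zro_tens_sp]
  | cap =>
    change zro ⊠ cap = _
    rw [← sp_cap .green, zro_tens_sp]
  | spider e n m α =>
    obtain ⟨k, rfl⟩ := h
    rw [← zro_tens_sp e c d n m k, sp, phase_intCast]
  | had =>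
    change zro ⊠ had = _
    have h := zro_tens_congr_comp (T := T) (a := id 1) (b := had) (by simp) (by simp)
      (zro_cut_any c d.other) rfl
    rw [id_comp (by simp), comp_assoc, had_state, Colour.other_other] at h
    rw [h, nodes_one, pw_one, pw_one]
  | star =>
    change zro ⊠ star = _
    -- The zero scalar supplies the legless node that cancels the star.
    have e : (zro : Q T) = zro ⊠ sp .green 0 0 0 := (zro_sp .green 0).symm
    rw [e, tens_assoc, tens_scalar (s := star) rfl rfl, star_sp]
    simp [nodes]
  | seq D E ih ih' =>
    rw [mk_seq, zro_tens_comp rfl, ih h.1, ih' h.2, nodes_one, nodes_one, ← zro_tens_comp (by simp), comp_assoc, nodes_one]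
    refine zro_tens_congr_comp (by simp) (by simp) rfl ?_
    rw [← comp_assoc, pw_comp (by simp), scalar_comp (by simp) (by simp), ← tens_assoc,
      zro_tens_pw (zro_tens_inn c d)]
  | par D E ih ih' =>
    rw [mk_par, zro_tens_tens, ih h.1, ih' h.2, nodes_tens_nodes, nodes, pw_two, nodes, pw_one,
      zro_tens_zro]

end Cut

end Q

end ZX

end

/-! ### Existence and uniqueness of zero normal forms, and completeness -/

namespace ZX

theorem stabEq_of_interp_eq_zero {c d : Colour} {n m : ℕ} {D N : Diag n m} (hD : D.IsStabilizer)
    (h : D.interp = 0) (hN : IsZeroNF c d N) : StabEq D N := by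
  have h1 := Q.zro_tens_of_zero (Q.zero_of_interp D hD h)
  rw [Q.zro_tens_mk c d D hD, ← Q.mk_of_pieces hN] at h1
  exact Q.mk_eq_iff.1 h1.symm

theorem IsZeroNF.topEq {c d : Colour} {n m : ℕ} {N N' : Diag n m} (h : IsZeroNF c d N)
    (h' : IsZeroNF c d N') : TopEq N N' :=
  Q.mk_eq_iff (T := topThy).1 ((Q.mk_of_pieces h).trans (Q.mk_of_pieces h').symm)

end ZX

theorem mainTheorem7 :
    (∀ (cin cout : ZX.Colour) (n m : ℕ) (D : ZX.Diag n m), D.IsStabilizer → D.interp = 0 →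
      ∃ N : ZX.Diag n m, ZX.IsZeroNF cin cout N ∧ ZX.StabEq D N ∧
        ∀ N' : ZX.Diag n m, ZX.IsZeroNF cin cout N' → ZX.TopEq N N') ∧
    (∀ (n m : ℕ) (D₁ D₂ : ZX.Diag n m), D₁.IsStabilizer → D₂.IsStabilizer →
      D₁.interp = 0 → D₂.interp = D₁.interp → ZX.StabEq D₁ D₂) := by
  refine ⟨fun cin cout n m D hD h => ?_, fun n m D₁ D₂ h₁ h₂ h h' => ?_⟩
  · obtain ⟨N, hN⟩ := ZX.Q.exists_isZeroNF cin cout n m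
    exact ⟨N, hN, ZX.stabEq_of_interp_eq_zero hD h hN, fun N' hN' => hN.topEq hN'⟩
  -- Both diagrams are rewritten to one common normal form, for which any choice of colours serves.
  · obtain ⟨N, hN⟩ := ZX.Q.exists_isZeroNF .green .green n m
    exact (ZX.stabEq_of_interp_eq_zero h₁ h hN).trans
      (ZX.stabEq_of_interp_eq_zero h₂ (h'.trans h) hN).symm
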